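/- All superspaces and Lie superalgebras are over $\mathbb C$. Let $\mathfrak g_0$ be a Lie superalgebra and $\mathfrak g_{-1}$ a $\mathfrak g_0$-module, and write $X(v)$ for the action of $X\in\mathfrak g_0$ on $v\in\mathfrak g_{-1}$. For $i\ge 1$ put $$\mathfrak g_i=\{X\in\mathrm{Hom}(\mathfrak g_{-1},\mathfrak g_{i-1}) : X(v)(w)=(-1)^{p(v)p(w)}X(w)(v)\ \text{ for all homogeneous } v,w\in\mathfrak g_{-1}\}.$$ The *Cartan prolong* $(\mathfrak g_{-1},\mathfrak g_0)_*=\bigoplus_{i\ge -1}\mathfrak g_i$ is a $\mathbb Z$-graded Lie superalgebra, with $[\mathfrak g_{-1},\mathfrak g_{-1}]=0$, with $[X,v]=X(v)$ for $X\in\mathfrak g_i$, $i\ge0$, $v\in\mathfrak g_{-1}$, with the given bracket on $\mathfrak g_0$, and with the remaining brackets determined by $[[X,Y],v]=[X,[Y,v]]+(-1)^{p(v)p(Y)}[[X,v],Y]$ for $v\in\mathfrak g_{-1}$. Let $\mathfrak{osp}(m|2n)$ be the Lie superalgebra preserving the standard nondegenerate even supersymmetric bilinear form on $\mathbb C^{m|2n}$,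 and $\mathfrak{cosp}(m|2n)=\mathfrak{osp}(m|2n)+\mathbb C\cdot 1$; $\mathrm{id}$ denotes the tautological module. Consider the two families of $\mathbb Z$-gradings $\mathfrak g=\mathfrak g_{-1}\oplus\mathfrak g_0\oplus\mathfrak g_1$ of depth $1$ of orthosymplectic Lie superalgebras: (a) $\mathfrak g=\mathfrak{osp}(m|2n)$, $m\ge2$, with $\mathfrak g_0=\mathfrak{cosp}(m-2|2n)$ and $\mathfrak g_{-1}=\mathrm{id}$; the grading element acts on $\mathbb C^{m|2n}$ as $\pm1$ on two isotropic even vectors that span a nondegenerate plane, and as $0$ on the orthogonal complement of that plane; (b) $\mathfrak g=\mathfrak{osp}(2r|2n)$ with $\mathfrak g_0=\mathfrak{gl}(r|n)$ and $\mathfrak g_{-1}=\Lambda^2(\mathrm{id})$; the grading element acts on $\mathbb C^{2r|2n}$ as $\pm\tfrac12$ on two complementary isotropic subspaces of superdimension $r|n$. Let $\hat{\mathfrak g}_0$ be $\mathfrak{osp}(m-2|2n)$ in case (a) and $\mathfrak{sl}(r|n)$ in case (b). 1. In case (a), provided that $m\ge5$ if $n=0$, and in case (b), provided that $r+n\ge2$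 and $(r,n)\notin\{(3,0),(2,0),(1,1)\}$, the Cartan prolong $(\mathfrak g_{-1},\mathfrak g_0)_*$ equals $\mathfrak g$, i.e. they are isomorphic as $\mathbb Z$-graded Lie superalgebras. 2. In case (b) with $(r,n)=(3,0)$, $(\mathfrak g_{-1},\mathfrak g_0)_*\cong\mathfrak{vect}(3|0)=\mathfrak{der}\,\mathbb C[x_1,x_2,x_3]$ as $\mathbb Z$-graded Lie superalgebras (with $\deg x_i=1$). 3. In case (a) without restriction, and in case (b) for all $(r,n)\notin\{(3,0),(2,0),(1,1)\}$, $(\mathfrak g_{-1},\hat{\mathfrak g}_0)_*=\mathfrak g_{-1}\oplus\hat{\mathfrak g}_0$, that is, all components of positive degree vanish. -/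

import Mathlib

open scoped Matrix

noncomputable section

namespace SuperLie

/-! ### Superspaces, Lie superalgebras, modules -/

/-- The sign `(-1)^a` of a parity `a`. -/
def sgn (a : ZMod 2) : ℂ := if a = 0 then 1 else -1

theorem sgn_add (a b : ZMod 2) : sgn (a + b) = sgn a * sgn b := by
  revert a b
  have h : ∀ a b : ZMod 2, (a + b = 0) ↔ ((a = 0) ↔ (b = 0)) := by decide
  intro a b
  unfold sgn
  by_cases ha : a = 0 <;> by_cases hb : b = 0 <;> simp [h, ha, hb]

theorem sgn_mul_self (a : ZMod 2) : sgn a * sgn a = 1 := by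
  unfold sgn; split_ifs <;> simp

theorem sgn_zero : sgn 0 = 1 := by simp [sgn]

/-- A complex superspace, i.e. a `ℤ/2`-graded vector space, presented by its parity operator:
the involution `par` that is `+1` on the even part and `-1` on the odd part. -/
structure SuperSpace where
  carrier : Type
  [grp : AddCommGroup carrier]
  [mod : Module ℂ carrier]
  par : carrier →ₗ[ℂ] carrier
  par_par : ∀ v, par (par v) = v

instance : CoeSort SuperSpace Type := ⟨SuperSpace.carrier⟩

instance (V : SuperSpace) : AddCommGroup V := V.grp

instance (V : SuperSpace) : Module ℂ V := V.mod

/-- `v` is homogeneous of parity `a` (the zero vector has every parity). -/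
def SuperSpace.Homog (V : SuperSpace) (a : ZMod 2) (v : V) : Prop := V.par v = sgn a • v

/-- The projection of a superspace onto its even part. -/
def SuperSpace.evenPart (V : SuperSpace) : V →ₗ[ℂ] V := (1 / 2 : ℂ) • (LinearMap.id + V.par)

/-- The projection of a superspace onto its odd part. -/
def SuperSpace.oddPart (V : SuperSpace) : V →ₗ[ℂ] V := (1 / 2 : ℂ) • (LinearMap.id - V.par)

theorem SuperSpace.evenPart_add_oddPart (V : SuperSpace) (v : V) :
    V.evenPart v + V.oddPart v = v := by
  simp only [SuperSpace.evenPart, SuperSpace.oddPart, LinearMap.smul_apply, LinearMap.add_apply,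
    LinearMap.sub_apply, LinearMap.id_apply]
  module

theorem SuperSpace.homog_evenPart (V : SuperSpace) (v : V) : V.Homog 0 (V.evenPart v) := by
  simp only [SuperSpace.Homog, SuperSpace.evenPart, LinearMap.smul_apply, LinearMap.add_apply,
    LinearMap.id_apply, map_smul, map_add, V.par_par, sgn_zero]
  module

theorem SuperSpace.homog_oddPart (V : SuperSpace) (v : V) : V.Homog 1 (V.oddPart v) := by
  simp only [SuperSpace.Homog, SuperSpace.oddPart, LinearMap.smul_apply, LinearMap.sub_apply,
    LinearMap.id_apply, map_smul, map_sub, V.par_par, sgn, one_ne_zero, if_false]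
  module

/-- The superspace `Hom(V, W)` of all linear maps. -/
def SuperSpace.hom (V W : SuperSpace) : SuperSpace where
  carrier := V →ₗ[ℂ] W
  par :=
    { toFun := fun f => W.par ∘ₗ f ∘ₗ V.par
      map_add' := by intro f g; ext v; simp
      map_smul' := by intro c f; ext v; simp }
  par_par := by intro f; ext v; simp [V.par_par, W.par_par]

/-- A subsuperspace: a subspace stable under the parity operator. -/
def SuperSpace.sub (V : SuperSpace) (S : Submodule ℂ V) (hpar : ∀ x ∈ S, V.par x ∈ S) :
    SuperSpace where
  carrier := S
  par := V.par.restrict hpar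
  par_par := by intro x; ext; simp [V.par_par]

/-- A Lie superalgebra over `ℂ`. -/
structure LieSuperalgebra extends SuperSpace where
  bracket : carrier →ₗ[ℂ] carrier →ₗ[ℂ] carrier
  par_bracket : ∀ x y, par (bracket x y) = bracket (par x) (par y)
  skew : ∀ (a b : ZMod 2) (x y : carrier), toSuperSpace.Homog a x → toSuperSpace.Homog b y →
    bracket x y = -(sgn (a * b) • bracket y x)
  jacobi : ∀ (a b : ZMod 2) (x y z : carrier), toSuperSpace.Homog a x → toSuperSpace.Homog b y →
    bracket x (bracket y z) = bracket (bracket x y) z + sgn (a * b) • bracket y (bracket x z)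

instance : CoeSort LieSuperalgebra Type := ⟨fun L => L.toSuperSpace.carrier⟩

/-- A module over a Lie superalgebra. -/
structure SuperModule (L : LieSuperalgebra) (V : SuperSpace) where
  act : L →ₗ[ℂ] V →ₗ[ℂ] V
  par_act : ∀ x v, V.par (act x v) = act (L.par x) (V.par v)
  act_bracket : ∀ (a b : ZMod 2) (x y : L) (v : V), L.Homog a x → L.Homog b y →
    act (L.bracket x y) v = act x (act y v) - sgn (a * b) • act y (act x v)

/-- A graded subspace is closed under the bracket if it is so for homogeneous elements. -/
theorem bracket_mem_of_homog (L : LieSuperalgebra) (S : Submodule ℂ L)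
    (hpar : ∀ x ∈ S, L.par x ∈ S)
    (h : ∀ (a b : ZMod 2) (x y : L), L.Homog a x → L.Homog b y → x ∈ S → y ∈ S →
      L.bracket x y ∈ S) :
    ∀ x ∈ S, ∀ y ∈ S, L.bracket x y ∈ S := by
  intro x hx y hy
  have he : ∀ z ∈ S, L.evenPart z ∈ S := fun z hz =>
    S.smul_mem _ (S.add_mem hz (hpar z hz))
  have ho : ∀ z ∈ S, L.oddPart z ∈ S := fun z hz =>
    S.smul_mem _ (S.sub_mem hz (hpar z hz))
  rw [← L.evenPart_add_oddPart x, ← L.evenPart_add_oddPart y]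
  simp only [map_add, LinearMap.add_apply]
  refine S.add_mem (S.add_mem ?_ ?_) (S.add_mem ?_ ?_)
  · exact h 0 0 _ _ (L.homog_evenPart x) (L.homog_evenPart y) (he x hx) (he y hy)
  · exact h 1 0 _ _ (L.homog_oddPart x) (L.homog_evenPart y) (ho x hx) (he y hy)
  · exact h 0 1 _ _ (L.homog_evenPart x) (L.homog_oddPart y) (he x hx) (ho y hy)
  · exact h 1 1 _ _ (L.homog_oddPart x) (L.homog_oddPart y) (ho x hx) (ho y hy)

/-- A Lie subsuperalgebra. -/
def LieSuperalgebra.sub (L : LieSuperalgebra) (S : Submodule ℂ L) (hpar : ∀ x ∈ S, L.par x ∈ S)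
    (hbr : ∀ x ∈ S, ∀ y ∈ S, L.bracket x y ∈ S) : LieSuperalgebra where
  toSuperSpace := L.toSuperSpace.sub S hpar
  bracket := LinearMap.mk₂ ℂ (fun x y : S => (⟨L.bracket x y, hbr x x.2 y y.2⟩ : S))
    (fun x x' y => Subtype.ext (LinearMap.map_add₂ L.bracket x.1 x'.1 y.1))
    (fun c x y => Subtype.ext (LinearMap.map_smul₂ L.bracket c x.1 y.1))
    (fun x y y' => Subtype.ext ((L.bracket x.1).map_add y.1 y'.1))
    (fun c x y => Subtype.ext ((L.bracket x.1).map_smul c y.1))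
  par_bracket := fun x y => Subtype.ext (L.par_bracket x.1 y.1)
  skew := fun a b x y hx hy => Subtype.ext
    (L.skew a b x.1 y.1 (congrArg Subtype.val hx) (congrArg Subtype.val hy))
  jacobi := fun a b x y z hx hy => Subtype.ext
    (L.jacobi a b x.1 y.1 z.1 (congrArg Subtype.val hx) (congrArg Subtype.val hy))

/-- Restriction of a module to a Lie subsuperalgebra. -/
def SuperModule.restrict {L : LieSuperalgebra} {V : SuperSpace} (ρ : SuperModule L V)
    (S : Submodule ℂ L) (hpar : ∀ x ∈ S, L.par x ∈ S)
    (hbr : ∀ x ∈ S, ∀ y ∈ S, L.bracket x y ∈ S) : SuperModule (L.sub S hpar hbr) V where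
  act := ρ.act ∘ₗ S.subtype
  par_act := fun x v => ρ.par_act x.1 v
  act_bracket := fun a b x y v hx hy =>
    ρ.act_bracket a b x.1 y.1 v (congrArg Subtype.val hx) (congrArg Subtype.val hy)

/-- A submodule of a module over a Lie superalgebra. -/
def SuperModule.sub {L : LieSuperalgebra} {V : SuperSpace} (ρ : SuperModule L V)
    (S : Submodule ℂ V) (hpar : ∀ v ∈ S, V.par v ∈ S) (hact : ∀ x, ∀ v ∈ S, ρ.act x v ∈ S) :
    SuperModule L (V.sub S hpar) where
  act := LinearMap.mk₂ ℂ (fun (x : L) (v : S) => (⟨ρ.act x v, hact x v v.2⟩ : S))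
    (fun x x' v => Subtype.ext (LinearMap.map_add₂ ρ.act x x' v.1))
    (fun c x v => Subtype.ext (LinearMap.map_smul₂ ρ.act c x v.1))
    (fun x v v' => Subtype.ext ((ρ.act x).map_add v.1 v'.1))
    (fun c x v => Subtype.ext ((ρ.act x).map_smul c v.1))
  par_act := fun x v => Subtype.ext (ρ.par_act x v.1)
  act_bracket := fun a b x y v hx hy => Subtype.ext (ρ.act_bracket a b x y v.1 hx hy)

/-! ### The Cartan prolong -/

section Prolong

variable {L : LieSuperalgebra} {V : SuperSpace}

/-- The superspaces in which the homogeneous components of the prolong live; the index is shifted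
by one, so that `level ρ k` belongs to degree `k - 1`: degree `-1` is `V`, degree `0` is `L`, and
degree `k + 1` is contained in `Hom(V, degree k)` for `k ≥ 0`. -/
def level (_ρ : SuperModule L V) : ℕ → SuperSpace
  | 0 => V
  | 1 => L.toSuperSpace
  | k + 2 => V.hom (level _ρ (k + 1))

/-- The value `X(v)`: the action of `L` on `V` in degree `0`, evaluation in positive degrees. -/
def ev (ρ : SuperModule L V) : (k : ℕ) → (level ρ (k + 1) →ₗ[ℂ] V →ₗ[ℂ] level ρ k)
  | 0 => ρ.act
  | _ + 1 => LinearMap.id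

/-- One step of Cartan prolongation: from the component `S` of degree `k` to the component of
degree `k + 1`, which consists of the `X ∈ Hom(V, S)` such that
`X(v)(w) = (-1)^{p(v)p(w)} X(w)(v)` for all homogeneous `v`, `w`. -/
def prolongStep (ρ : SuperModule L V) (k : ℕ) (S : Submodule ℂ (level ρ (k + 1))) :
    Submodule ℂ (V →ₗ[ℂ] level ρ (k + 1)) where
  carrier := {X | (∀ v, X v ∈ S) ∧ ∀ (a b : ZMod 2) (v w : V), V.Homog a v → V.Homog b w →
    ev ρ k (X v) w = sgn (a * b) • ev ρ k (X w) v}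
  add_mem' := by
    intro X Y hX hY
    refine ⟨fun v => S.add_mem (hX.1 v) (hY.1 v), ?_⟩
    intro a b v w hv hw
    have h1 := hX.2 a b v w hv hw
    have h2 := hY.2 a b v w hv hw
    simp only [LinearMap.add_apply, map_add, smul_add, h1, h2]
  zero_mem' := by
    refine ⟨fun v => S.zero_mem, ?_⟩
    intro a b v w hv hw
    simp
  smul_mem' := by
    intro c X hX
    refine ⟨fun v => S.smul_mem c (hX.1 v), ?_⟩
    intro a b v w hv hw
    have h1 := hX.2 a b v w hv hw
    simp only [LinearMap.smul_apply, map_smul, h1]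
    rw [smul_comm]

/-- The component of degree `k - 1` of the Cartan prolong of `(V, L)`: all of `V` and all of `L`
in degrees `-1` and `0`, and then inductively by prolongation steps. -/
def component (ρ : SuperModule L V) : (k : ℕ) → Submodule ℂ (level ρ k)
  | 0 => ⊤
  | 1 => ⊤
  | k + 2 => prolongStep ρ k (component ρ (k + 1))

/-- Families of elements, one in each degree (formal sums over all degrees). -/
abbrev Family (ρ : SuperModule L V) : Type := (k : ℕ) → level ρ k

/-- The parity operator on families. -/
def famPar (ρ : SuperModule L V) : Family ρ →ₗ[ℂ] Family ρ where
  toFun := fun F k => (level ρ k).par (F k)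
  map_add' := by intro F G; funext k; simp
  map_smul' := by intro c F; funext k; simp

/-- The family `[F, v]`, for `v` in degree `-1`: every component of `F` of degree `≥ 0` is
evaluated at `v`, and the component of degree `-1` commutes with `v`. -/
def contract (ρ : SuperModule L V) : V →ₗ[ℂ] Family ρ →ₗ[ℂ] Family ρ :=
  LinearMap.mk₂ ℂ (fun v F k => ev ρ k (F (k + 1)) v)
    (by intro v w F; funext k; simp) (by intro c v F; funext k; simp)
    (by intro v F G; funext k; simp) (by intro c v F; funext k; simp)

/-- `[v, X]` for `v` in degree `-1` and `X` in degree `k`, that is `-(-1)^{p(v)p(X)} X(v)`. -/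
def revEv (ρ : SuperModule L V) (k : ℕ) : V →ₗ[ℂ] level ρ (k + 1) →ₗ[ℂ] level ρ k :=
  -(((ev ρ k).flip ∘ₗ V.evenPart) +
    ((ev ρ k ∘ₗ (level ρ (k + 1)).par).flip ∘ₗ V.oddPart))

/-- The component of degree `-1` of a family. -/
def degNegOne (ρ : SuperModule L V) : Family ρ →ₗ[ℂ] V :=
  LinearMap.proj (φ := fun k => level ρ k) 0

/-- The component of degree `0` of a family. -/
def degZero (ρ : SuperModule L V) : Family ρ →ₗ[ℂ] L :=
  LinearMap.proj (φ := fun k => level ρ k) 1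

/-- The part of `[F, G]` of degree `k - 1` that involves the components of `F` and `G` of degree
`-1`: the sum of `[F_k, G_{-1}]` and `[F_{-1}, G_k]` (lower indices are degrees). -/
def pairing (ρ : SuperModule L V) (k : ℕ) : Family ρ →ₗ[ℂ] Family ρ →ₗ[ℂ] level ρ k :=
  (ev ρ k ∘ₗ LinearMap.proj (φ := fun k => level ρ k) (k + 1)).compl₂ (degNegOne ρ) +
    (revEv ρ k ∘ₗ degNegOne ρ).compl₂ (LinearMap.proj (φ := fun k => level ρ k) (k + 1))

/-- The bracket of the components of degree `0`. -/
def zeroBracket (ρ : SuperModule L V) : Family ρ →ₗ[ℂ] Family ρ →ₗ[ℂ] level ρ 1 :=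
  L.bracket.compl₁₂ (degZero ρ) (degZero ρ)

/-- From the component `B` of the bracket of degree `n` to that of degree `n + 1`, through
`[[F, G], v] = [F, [G, v]] + (-1)^{p(v)p(G)} [[F, v], G]`. -/
def bracketStep (ρ : SuperModule L V) (n : ℕ)
    (B : Family ρ →ₗ[ℂ] Family ρ →ₗ[ℂ] level ρ (n + 1)) :
    Family ρ →ₗ[ℂ] Family ρ →ₗ[ℂ] (V →ₗ[ℂ] level ρ (n + 1)) :=
  LinearMap.mk₂ ℂ
    (fun F G => B F ∘ₗ (contract ρ).flip G +
      (B.flip G ∘ₗ (contract ρ).flip F ∘ₗ V.evenPart +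
        B.flip (famPar ρ G) ∘ₗ (contract ρ).flip F ∘ₗ V.oddPart))
    (by intro F F' G; ext v; simp; abel)
    (by intro c F G; ext v; simp)
    (by intro F G G'; ext v; simp; abel)
    (by intro c F G; ext v; simp)

/-- The component of degree `n - 1` of the bracket `[F, G]`. In degrees `-1` and `0` it is given by
the action of `L` on `V`, by the bracket of `L` and by evaluation of elements of degree one at
elements of degree `-1`; in positive degrees it is determined by the super Jacobi identity. -/
def bracketAt (ρ : SuperModule L V) : (n : ℕ) → (Family ρ →ₗ[ℂ] Family ρ →ₗ[ℂ] level ρ n)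
  | 0 => pairing ρ 0
  | 1 => zeroBracket ρ + pairing ρ 1
  | n + 2 => bracketStep ρ n (bracketAt ρ (n + 1))

/-- The bracket of families. -/
def famBracket (ρ : SuperModule L V) (F G : Family ρ) : Family ρ := fun n => bracketAt ρ n F G

/-- The Cartan prolong `(V, L)_*`: the direct sum of its components. -/
def prolong (ρ : SuperModule L V) : Submodule ℂ (Family ρ) where
  carrier := {F | (∀ k, F k ∈ component ρ k) ∧ {k | F k ≠ 0}.Finite}
  add_mem' := by
    intro F G hF hG
    refine ⟨fun k => (component ρ k).add_mem (hF.1 k) (hG.1 k), (hF.2.union hG.2).subset ?_⟩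
    intro k hk
    by_contra h
    simp only [Set.mem_union, Set.mem_ofPred_eq, not_or, not_not] at h
    exact hk (by simp [h.1, h.2])
  zero_mem' := ⟨fun k => (component ρ k).zero_mem, by simp⟩
  smul_mem' := by
    intro c F hF
    refine ⟨fun k => (component ρ k).smul_mem c (hF.1 k), hF.2.subset ?_⟩
    intro k hk h
    exact hk (by simp [h])

/-- The elements of the Cartan prolong that are homogeneous of degree `d`. -/
def prolongDegree (ρ : SuperModule L V) (d : ℤ) : Submodule ℂ (Family ρ) where
  carrier := {F | F ∈ prolong ρ ∧ ∀ k : ℕ, F k ≠ 0 → (k : ℤ) - 1 = d}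
  add_mem' := by
    intro F G hF hG
    refine ⟨(prolong ρ).add_mem hF.1 hG.1, fun k hk => ?_⟩
    by_contra h
    have h1 : F k = 0 := by_contra fun h' => h (hF.2 k h')
    have h2 : G k = 0 := by_contra fun h' => h (hG.2 k h')
    exact hk (by simp [h1, h2])
  zero_mem' := ⟨(prolong ρ).zero_mem, fun k hk => absurd rfl hk⟩
  smul_mem' := by
    intro c F hF
    refine ⟨(prolong ρ).smul_mem c hF.1, fun k hk => hF.2 k fun h => hk ?_⟩
    simp [h]

/-- `g`, with the grading `𝒢`, is the Cartan prolong `(V, L)_*`: there is an isomorphism of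
`ℤ`-graded Lie superalgebras from `g` onto `(V, L)_*`. -/
def IsCartanProlong (g : LieSuperalgebra) (𝒢 : ℤ → Submodule ℂ g) (ρ : SuperModule L V) : Prop :=
  ∃ Φ : g →ₗ[ℂ] Family ρ,
    Function.Injective Φ ∧ LinearMap.range Φ = prolong ρ ∧
    (∀ x, Φ (g.par x) = famPar ρ (Φ x)) ∧
    (∀ x y, Φ (g.bracket x y) = famBracket ρ (Φ x) (Φ y)) ∧
    ∀ d x, x ∈ 𝒢 d ↔ Φ x ∈ prolongDegree ρ d

/-- `(V, L)_* = V ⊕ L`: the Cartan prolong consists exactly of the families without components of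
positive degree. -/
def IsTrivialProlong (ρ : SuperModule L V) : Prop :=
  ∀ F : Family ρ, F ∈ prolong ρ ↔ ∀ k, F (k + 2) = 0

end Prolong

/-! ### Supermatrices -/

section Matrices

variable {ι : Type}

/-- The parity operator on supermatrices with index parities `p`: `E_{ij}` has parity
`p i + p j`. -/
def matPar (p : ι → ZMod 2) : Matrix ι ι ℂ →ₗ[ℂ] Matrix ι ι ℂ where
  toFun := fun X => Matrix.of fun i j => sgn (p i + p j) * X i j
  map_add' := by intro X Y; ext i j; simp [mul_add]
  map_smul' := by intro c X; ext i j; simp; ring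

/-- The superspace of supermatrices with index parities `p`. It is also the tensor square of the superspace `ℂ^ι`, with `E_{ij}` for `e_i ⊗ e_j`. -/
def matSpace (p : ι → ZMod 2) : SuperSpace where
  carrier := Matrix ι ι ℂ
  par := matPar p
  par_par := by
    intro X; ext i j
    simp only [matPar, LinearMap.coe_mk, AddHom.coe_mk, Matrix.of_apply]
    rw [← mul_assoc, sgn_mul_self, one_mul]

theorem homog_matSpace (p : ι → ZMod 2) (a : ZMod 2) (X : Matrix ι ι ℂ) :
    (matSpace p).Homog a X ↔ ∀ i j, sgn (p i + p j) * X i j = sgn a * X i j := by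
  constructor
  · intro h i j
    exact congrFun (congrFun h i) j
  · intro h
    funext i j
    exact h i j

theorem parity_eq_of_homog {p : ι → ZMod 2} {a : ZMod 2} {X : Matrix ι ι ℂ}
    (h : (matSpace p).Homog a X) (i j : ι) : X i j = 0 ∨ p i + p j = a := by
  have h1 := (homog_matSpace p a X).1 h i j
  by_cases hX : X i j = 0
  · exact Or.inl hX
  · right
    have h2 := mul_right_cancel₀ hX h1
    generalize p i + p j = b at h2
    have h3 : ∀ b : ZMod 2, b = 0 ∨ b = 1 := by decide
    rcases h3 a with rfl | rfl <;> rcases h3 b with rfl | rfl <;> simp [sgn] at h2 ⊢ <;>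
      norm_num at h2

/-- The exterior square of the superspace `ℂ^ι`: the tensors `t` with
`t_{ij} = -(-1)^{p_i p_j} t_{ji}`. -/
def wedgeSquare (p : ι → ZMod 2) : Submodule ℂ (matSpace p) where
  carrier := {t : Matrix ι ι ℂ | ∀ i j, t i j = -(sgn (p i * p j) * t j i)}
  add_mem' := by
    intro s t hs ht i j
    change s i j + t i j = -(sgn (p i * p j) * (s j i + t j i))
    rw [hs i j, ht i j]; ring
  zero_mem' := by
    intro i j
    change (0 : ℂ) = -(sgn (p i * p j) * 0)
    simp
  smul_mem' := by
    intro c t ht i j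
    change c * t i j = -(sgn (p i * p j) * (c * t j i))
    rw [ht i j]; ring

theorem wedgeSquare_par (p : ι → ZMod 2) :
    ∀ t ∈ wedgeSquare p, (matSpace p).par t ∈ wedgeSquare p := by
  intro t ht i j
  have h : (t : Matrix ι ι ℂ) i j = -(sgn (p i * p j) * (t : Matrix ι ι ℂ) j i) := ht i j
  change sgn (p i + p j) * (t : Matrix ι ι ℂ) i j =
    -(sgn (p i * p j) * (sgn (p j + p i) * (t : Matrix ι ι ℂ) j i))
  rw [h, add_comm (p j)]; ring

variable [Fintype ι]

/-- The supercommutator, extended bilinearly from `[X, Y] = XY - (-1)^{p(X)p(Y)} YX`. -/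
def superComm (p : ι → ZMod 2) (X Y : Matrix ι ι ℂ) : Matrix ι ι ℂ :=
  Matrix.of fun i j => ∑ k, (X i k * Y k j - sgn ((p i + p k) * (p k + p j)) * (Y i k * X k j))

theorem superComm_of_homog {p : ι → ZMod 2} {a b : ZMod 2} {X Y : Matrix ι ι ℂ}
    (hX : (matSpace p).Homog a X) (hY : (matSpace p).Homog b Y) :
    superComm p X Y = X * Y - sgn (a * b) • (Y * X) := by
  ext i j
  simp only [superComm, Matrix.of_apply, Matrix.sub_apply, Matrix.smul_apply, Matrix.mul_apply,
    smul_eq_mul, Finset.mul_sum, ← Finset.sum_sub_distrib]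
  refine Finset.sum_congr rfl fun k _ => ?_
  rcases parity_eq_of_homog hY i k with h | h
  · simp [h]
  rcases parity_eq_of_homog hX k j with h' | h'
  · simp [h']
  rw [h, h', mul_comm b a]

theorem homog_mul {p : ι → ZMod 2} {a b : ZMod 2} {X Y : Matrix ι ι ℂ}
    (hX : (matSpace p).Homog a X) (hY : (matSpace p).Homog b Y) :
    (matSpace p).Homog (a + b) (X * Y) := by
  rw [homog_matSpace]
  intro i j
  simp only [Matrix.mul_apply, Finset.mul_sum]
  refine Finset.sum_congr rfl fun k _ => ?_
  rcases parity_eq_of_homog hX i k with h | h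
  · simp [h]
  rcases parity_eq_of_homog hY k j with h' | h'
  · simp [h']
  have h2 : ∀ x y z : ZMod 2, x + z = (x + y) + (y + z) := by decide
  rw [h2 (p i) (p k) (p j), h, h']

theorem homog_superComm {p : ι → ZMod 2} {a b : ZMod 2} {X Y : Matrix ι ι ℂ}
    (hX : (matSpace p).Homog a X) (hY : (matSpace p).Homog b Y) :
    (matSpace p).Homog (a + b) (superComm p X Y) := by
  rw [superComm_of_homog hX hY]
  have h1 := (homog_matSpace p _ _).1 (homog_mul hX hY)
  have h2 := (homog_matSpace p _ _).1 (homog_mul hY hX)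
  rw [homog_matSpace]
  intro i j
  have h1' := h1 i j
  have h2' := h2 i j
  rw [add_comm b a] at h2'
  simp only [Matrix.sub_apply, Matrix.smul_apply, smul_eq_mul]
  linear_combination h1' - sgn (a * b) * h2'

/-- The supercommutator as a bilinear map. -/
def superCommL (p : ι → ZMod 2) : Matrix ι ι ℂ →ₗ[ℂ] Matrix ι ι ℂ →ₗ[ℂ] Matrix ι ι ℂ :=
  LinearMap.mk₂ ℂ (superComm p)
    (by
      intro X X' Y; ext i j
      simp only [superComm, Matrix.of_apply, Matrix.add_apply, ← Finset.sum_add_distrib]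
      exact Finset.sum_congr rfl fun k _ => by ring)
    (by
      intro c X Y; ext i j
      simp only [superComm, Matrix.of_apply, Matrix.smul_apply, smul_eq_mul, Finset.mul_sum]
      exact Finset.sum_congr rfl fun k _ => by ring)
    (by
      intro X Y Y'; ext i j
      simp only [superComm, Matrix.of_apply, Matrix.add_apply, ← Finset.sum_add_distrib]
      exact Finset.sum_congr rfl fun k _ => by ring)
    (by
      intro c X Y; ext i j
      simp only [superComm, Matrix.of_apply, Matrix.smul_apply, smul_eq_mul, Finset.mul_sum]
      exact Finset.sum_congr rfl fun k _ => by ring)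

theorem superComm_jacobi_of_homog {p : ι → ZMod 2} {a b c : ZMod 2} {X Y Z : Matrix ι ι ℂ}
    (hX : (matSpace p).Homog a X) (hY : (matSpace p).Homog b Y) (hZ : (matSpace p).Homog c Z) :
    superComm p X (superComm p Y Z) = superComm p (superComm p X Y) Z +
      sgn (a * b) • superComm p Y (superComm p X Z) := by
  rw [superComm_of_homog hX (homog_superComm hY hZ),
    superComm_of_homog (homog_superComm hX hY) hZ,
    superComm_of_homog hY (homog_superComm hX hZ),
    superComm_of_homog hX hY, superComm_of_homog hX hZ, superComm_of_homog hY hZ]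
  have e : sgn (b * a) = sgn (a * b) := by rw [mul_comm]
  have h := sgn_mul_self (a * b)
  simp only [mul_add, add_mul, sgn_add, mul_sub, sub_mul, smul_sub, smul_smul,
    Matrix.mul_smul, Matrix.smul_mul, mul_assoc]
  simp only [e]
  generalize sgn (a * b) = u at h
  generalize sgn (a * c) = v
  generalize sgn (b * c) = w
  match_scalars <;> first
    | ring1
    | linear_combination h
    | linear_combination -h
    | linear_combination w * h
    | linear_combination -w * h
    | linear_combination v * w * h
    | linear_combination -v * w * h

/-- The general linear Lie superalgebra of supermatrices with index parities `p`. -/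
def gl (p : ι → ZMod 2) : LieSuperalgebra where
  toSuperSpace := matSpace p
  bracket := superCommL p
  par_bracket := by
    intro X Y
    refine Matrix.ext fun i j => ?_
    change sgn (p i + p j) * superComm p X Y i j =
      superComm p (fun i j => sgn (p i + p j) * X i j) (fun i j => sgn (p i + p j) * Y i j) i j
    simp only [superComm, Matrix.of_apply, Finset.mul_sum]
    refine Finset.sum_congr rfl fun k _ => ?_
    have h2 : ∀ x y z : ZMod 2, x + z = (x + y) + (y + z) := by decide
    rw [h2 (p i) (p k) (p j), sgn_add (p i + p k)]
    ring
  skew := by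
    intro a b X Y hX hY
    change superComm p X Y = -(sgn (a * b) • superComm p Y X)
    rw [superComm_of_homog hX hY, superComm_of_homog hY hX, smul_sub, smul_smul, mul_comm b a,
      sgn_mul_self, one_smul, neg_sub]
  jacobi := by
    intro a b X Y Z hX hY
    have h0 : superCommL p X (superCommL p Y ((matSpace p).evenPart Z)) = _ :=
      superComm_jacobi_of_homog hX hY ((matSpace p).homog_evenPart Z)
    have h1 : superCommL p X (superCommL p Y ((matSpace p).oddPart Z)) = _ :=
      superComm_jacobi_of_homog hX hY ((matSpace p).homog_oddPart Z)
    have hs : (matSpace p).evenPart Z + (matSpace p).oddPart Z = Z :=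
      (matSpace p).evenPart_add_oddPart Z
    generalize (matSpace p).evenPart Z = Z0 at h0 hs
    generalize (matSpace p).oddPart Z = Z1 at h1 hs
    subst hs
    change superCommL p X (superCommL p Y (Z0 + Z1)) =
      superCommL p (superCommL p X Y) (Z0 + Z1) +
        sgn (a * b) • superCommL p Y (superCommL p X (Z0 + Z1))
    refine ((congrArg (superCommL p X) ((superCommL p Y).map_add Z0 Z1)).trans
      ((superCommL p X).map_add _ _)).trans ?_
    rw [h0, h1]
    have e1 : superCommL p (superCommL p X Y) (Z0 + Z1) =
      superCommL p (superCommL p X Y) Z0 + superCommL p (superCommL p X Y) Z1 :=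
        LinearMap.map_add _ _ _
    have e2 : superCommL p Y (superCommL p X (Z0 + Z1)) =
      superCommL p Y (superCommL p X Z0) + superCommL p Y (superCommL p X Z1) :=
        (congrArg (superCommL p Y) ((superCommL p X).map_add Z0 Z1)).trans
          ((superCommL p Y).map_add _ _)
    rw [e1, e2, smul_add]
    exact add_add_add_comm _ _ _ _

/-- The superspace `ℂ^ι` in which the `i`-th basis vector has parity `p i`. -/
def vecSpace (p : ι → ZMod 2) : SuperSpace where
  carrier := ι → ℂ
  par :=
    { toFun := fun v i => sgn (p i) * v i
      map_add' := by intro v w; ext i; simp [mul_add]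
      map_smul' := by intro c v; ext i; simp; ring }
  par_par := by
    intro v; ext i
    simp only [LinearMap.coe_mk, AddHom.coe_mk]
    rw [← mul_assoc, sgn_mul_self, one_mul]

theorem superComm_mulVec {p : ι → ZMod 2} {a b : ZMod 2} {X Y : Matrix ι ι ℂ}
    (hX : (matSpace p).Homog a X) (hY : (matSpace p).Homog b Y) (v : ι → ℂ) :
    superComm p X Y *ᵥ v = X *ᵥ (Y *ᵥ v) - sgn (a * b) • (Y *ᵥ (X *ᵥ v)) := by
  rw [superComm_of_homog hX hY, Matrix.sub_mulVec, Matrix.smul_mulVec, Matrix.mulVec_mulVec,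
    Matrix.mulVec_mulVec]

/-- The identity (tautological) module of the general linear Lie superalgebra. -/
def idModule (p : ι → ZMod 2) : SuperModule (gl p) (vecSpace p) where
  act := LinearMap.mk₂ ℂ (fun (X : Matrix ι ι ℂ) (v : ι → ℂ) => X *ᵥ v)
    (fun X Y v => Matrix.add_mulVec X Y v) (fun c X v => Matrix.smul_mulVec c X v)
    (fun X v w => Matrix.mulVec_add X v w) (fun c X v => Matrix.mulVec_smul X c v)
  par_act := by
    intro X v
    funext i
    change sgn (p i) * ∑ k, X i k * v k = ∑ k, (sgn (p i + p k) * X i k) * (sgn (p k) * v k)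
    rw [Finset.mul_sum]
    refine Finset.sum_congr rfl fun k _ => ?_
    rw [sgn_add]
    linear_combination (-(sgn (p i) * X i k * v k)) * sgn_mul_self (p k)
  act_bracket := by
    intro a b X Y v hX hY
    exact superComm_mulVec hX hY v

/-- The action on the tensor square: `X (v ⊗ w) = X v ⊗ w + (-1)^{p(X)p(v)} v ⊗ X w`, where the
matrix `t` stands for the tensor `∑ t_{ij} e_i ⊗ e_j`. -/
def tensorAct (p : ι → ZMod 2) (X t : Matrix ι ι ℂ) : Matrix ι ι ℂ :=
  Matrix.of fun i j => ∑ k, (X i k * t k j + sgn ((p j + p k) * p i) * (X j k * t i k))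

/-- The action on the tensor square as a bilinear map. -/
def tensorActL (p : ι → ZMod 2) : Matrix ι ι ℂ →ₗ[ℂ] Matrix ι ι ℂ →ₗ[ℂ] Matrix ι ι ℂ :=
  LinearMap.mk₂ ℂ (tensorAct p)
    (by
      intro X X' Y; ext i j
      simp only [tensorAct, Matrix.of_apply, Matrix.add_apply, ← Finset.sum_add_distrib]
      exact Finset.sum_congr rfl fun k _ => by ring)
    (by
      intro c X Y; ext i j
      simp only [tensorAct, Matrix.of_apply, Matrix.smul_apply, smul_eq_mul, Finset.mul_sum]
      exact Finset.sum_congr rfl fun k _ => by ring)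
    (by
      intro X Y Y'; ext i j
      simp only [tensorAct, Matrix.of_apply, Matrix.add_apply, ← Finset.sum_add_distrib]
      exact Finset.sum_congr rfl fun k _ => by ring)
    (by
      intro c X Y; ext i j
      simp only [tensorAct, Matrix.of_apply, Matrix.smul_apply, smul_eq_mul, Finset.mul_sum]
      exact Finset.sum_congr rfl fun k _ => by ring)

section DecEq

variable [DecidableEq ι]

theorem tensorAct_of_homog {p : ι → ZMod 2} {a : ZMod 2} {X : Matrix ι ι ℂ}
    (hX : (matSpace p).Homog a X) (t : Matrix ι ι ℂ) :
    tensorAct p X t = X * t + Matrix.diagonal (fun i => sgn (a * p i)) * (t * Xᵀ) := by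
  ext i j
  simp only [tensorAct, Matrix.of_apply, Matrix.add_apply, Matrix.diagonal_mul]
  simp only [Matrix.mul_apply, Matrix.transpose_apply, Finset.sum_add_distrib, Finset.mul_sum]
  congr 1
  refine Finset.sum_congr rfl fun k _ => ?_
  rcases parity_eq_of_homog hX j k with h | h
  · simp [h]
  · rw [h]; ring

theorem mul_diagonal_of_homog {p : ι → ZMod 2} {a : ZMod 2} (b : ZMod 2) {X : Matrix ι ι ℂ}
    (hX : (matSpace p).Homog a X) :
    X * Matrix.diagonal (fun i => sgn (b * p i)) =
      sgn (a * b) • (Matrix.diagonal (fun i => sgn (b * p i)) * X) := by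
  ext i j
  simp only [Matrix.mul_diagonal, Matrix.diagonal_mul, Matrix.smul_apply, smul_eq_mul]
  rcases parity_eq_of_homog hX i j with h | h
  · simp [h]
  · rw [← h, ← mul_assoc, ← sgn_add]
    have h2 : ∀ x y b : ZMod 2, (x + y) * b + b * x = b * y := by decide
    rw [h2]; ring

theorem tensorAct_superComm {p : ι → ZMod 2} {a b : ZMod 2} {X Y : Matrix ι ι ℂ}
    (hX : (matSpace p).Homog a X) (hY : (matSpace p).Homog b Y) (t : Matrix ι ι ℂ) :
    tensorAct p (superComm p X Y) t =
      tensorAct p X (tensorAct p Y t) - sgn (a * b) • tensorAct p Y (tensorAct p X t) := by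
  rw [tensorAct_of_homog (homog_superComm hX hY), tensorAct_of_homog hX, tensorAct_of_homog hY,
    tensorAct_of_homog hX, tensorAct_of_homog hY, superComm_of_homog hX hY]
  have hD : Matrix.diagonal (fun i => sgn ((a + b) * p i)) =
      Matrix.diagonal (fun i => sgn (a * p i)) * Matrix.diagonal (fun i => sgn (b * p i)) := by
    rw [Matrix.diagonal_mul_diagonal]
    congr 1
    funext i
    rw [add_mul, sgn_add]
  have hC : Matrix.diagonal (fun i => sgn (b * p i)) * Matrix.diagonal (fun i => sgn (a * p i)) =
      Matrix.diagonal (fun i => sgn (a * p i)) * Matrix.diagonal (fun i => sgn (b * p i)) := by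
    rw [Matrix.diagonal_mul_diagonal, Matrix.diagonal_mul_diagonal]
    congr 1
    funext i
    ring
  have hXD := mul_diagonal_of_homog b hX
  have hYD := mul_diagonal_of_homog a hY
  rw [hD]
  rw [mul_comm b a] at hYD
  generalize Matrix.diagonal (fun i => sgn (a * p i)) = D at *
  generalize Matrix.diagonal (fun i => sgn (b * p i)) = E at *
  have h := sgn_mul_self (a * b)
  generalize sgn (a * b) = u at *
  have hXD' : ∀ s, X * (E * s) = u • (E * (X * s)) := fun s => by
    rw [← mul_assoc, hXD, Matrix.smul_mul, mul_assoc]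
  have hYD' : ∀ s, Y * (D * s) = u • (D * (Y * s)) := fun s => by
    rw [← mul_assoc, hYD, Matrix.smul_mul, mul_assoc]
  have hC' : ∀ s, E * (D * s) = D * (E * s) := fun s => by
    rw [← mul_assoc, hC, mul_assoc]
  simp only [Matrix.transpose_sub, Matrix.transpose_smul, Matrix.transpose_mul, mul_add, add_mul,
    mul_sub, sub_mul, Matrix.mul_smul, Matrix.smul_mul, smul_add, smul_smul, mul_assoc,
    hXD', hYD', hC', h, one_smul]
  abel

/-- The tensor square of the identity module. -/
def tensorModule (p : ι → ZMod 2) : SuperModule (gl p) (matSpace p) where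
  act := tensorActL p
  par_act := by
    intro X t
    refine Matrix.ext fun i j => ?_
    change sgn (p i + p j) * tensorAct p X t i j =
      tensorAct p (fun i j => sgn (p i + p j) * X i j) (fun i j => sgn (p i + p j) * t i j) i j
    simp only [tensorAct, Matrix.of_apply, Finset.mul_sum]
    refine Finset.sum_congr rfl fun k _ => ?_
    simp only [sgn_add]
    linear_combination (-(sgn (p i) * sgn (p j) * (X i k * t k j +
      sgn ((p j + p k) * p i) * (X j k * t i k)))) * sgn_mul_self (p k)
  act_bracket := by
    intro a b X Y t hX hY
    exact tensorAct_superComm hX hY t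

theorem wedgeSquare_act (p : ι → ZMod 2) (X : gl p) :
    ∀ t ∈ wedgeSquare p, (tensorModule p).act X t ∈ wedgeSquare p := by
  intro t ht i j
  change tensorAct p X t i j = -(sgn (p i * p j) * tensorAct p X t j i)
  have h : ∀ i j, (t : Matrix ι ι ℂ) i j = -(sgn (p i * p j) * (t : Matrix ι ι ℂ) j i) := ht
  simp only [tensorAct, Matrix.of_apply, Finset.mul_sum, ← Finset.sum_neg_distrib]
  refine Finset.sum_congr rfl fun k _ => ?_
  rw [h k j, h i k]
  simp only [add_mul, sgn_add, mul_comm (p k), mul_comm (p j) (p i)]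
  have h1 := sgn_mul_self (p i * p j)
  have h2 := sgn_mul_self (p i * p k)
  have h3 := sgn_mul_self (p j * p k)
  generalize sgn (p i * p j) = u at *
  generalize sgn (p i * p k) = v at *
  generalize sgn (p j * p k) = w at *
  linear_combination ((X : Matrix ι ι ℂ) i k * (t : Matrix ι ι ℂ) j k * w) * h1 -
    ((X : Matrix ι ι ℂ) j k * (t : Matrix ι ι ℂ) k i * u) * h2

/-- The exterior square `Λ²(id)` of the identity module. -/
def wedgeModule (p : ι → ZMod 2) :
    SuperModule (gl p) ((matSpace p).sub (wedgeSquare p) (wedgeSquare_par p)) :=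
  (tensorModule p).sub (wedgeSquare p) (wedgeSquare_par p) (wedgeSquare_act p)

end DecEq

/-! ### The Lie superalgebras `sl`, `osp`, `cosp` -/

theorem superComm_mem_of_homog (p : ι → ZMod 2) (S : Submodule ℂ (Matrix ι ι ℂ))
    (hpar : ∀ X ∈ S, matPar p X ∈ S)
    (h : ∀ (a b : ZMod 2) (X Y : Matrix ι ι ℂ), (matSpace p).Homog a X → (matSpace p).Homog b Y →
      X ∈ S → Y ∈ S → superComm p X Y ∈ S) :
    ∀ X ∈ S, ∀ Y ∈ S, superComm p X Y ∈ S :=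
  bracket_mem_of_homog (gl p) S hpar h

/-- The Lie subsuperalgebra of `gl` with a given underlying space of matrices. -/
def glSub (p : ι → ZMod 2) (S : Submodule ℂ (Matrix ι ι ℂ)) (hpar : ∀ X ∈ S, matPar p X ∈ S)
    (hbr : ∀ X ∈ S, ∀ Y ∈ S, superComm p X Y ∈ S) : LieSuperalgebra :=
  (gl p).sub S hpar hbr

/-- The restriction of a module over `gl` to a Lie subsuperalgebra. -/
def glRestrict {p : ι → ZMod 2} {V : SuperSpace} (ρ : SuperModule (gl p) V)
    (S : Submodule ℂ (Matrix ι ι ℂ)) (hpar : ∀ X ∈ S, matPar p X ∈ S)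
    (hbr : ∀ X ∈ S, ∀ Y ∈ S, superComm p X Y ∈ S) : SuperModule (glSub p S hpar hbr) V :=
  ρ.restrict S hpar hbr

/-- The supertrace. -/
def supertrace (p : ι → ZMod 2) : Matrix ι ι ℂ →ₗ[ℂ] ℂ where
  toFun := fun X => ∑ i, sgn (p i) * X i i
  map_add' := by intro X Y; simp [mul_add, Finset.sum_add_distrib]
  map_smul' := by
    intro c X
    simp only [Matrix.smul_apply, smul_eq_mul, Finset.mul_sum, RingHom.id_apply]
    exact Finset.sum_congr rfl fun i _ => by ring

theorem slSub_par (p : ι → ZMod 2) :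
    ∀ X ∈ LinearMap.ker (supertrace p), matPar p X ∈ LinearMap.ker (supertrace p) := by
  intro X hX
  rw [LinearMap.mem_ker] at hX ⊢
  rw [← hX]
  change ∑ i, sgn (p i) * (sgn (p i + p i) * X i i) = ∑ i, sgn (p i) * X i i
  refine Finset.sum_congr rfl fun i _ => ?_
  rw [sgn_add, sgn_mul_self, one_mul]

theorem slSub_bracket (p : ι → ZMod 2) :
    ∀ X ∈ LinearMap.ker (supertrace p), ∀ Y ∈ LinearMap.ker (supertrace p),
      superComm p X Y ∈ LinearMap.ker (supertrace p) := by
  intro X _ Y _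
  rw [LinearMap.mem_ker]
  change ∑ i, sgn (p i) * superComm p X Y i i = 0
  simp only [superComm, Matrix.of_apply, Finset.mul_sum, mul_sub, Finset.sum_sub_distrib]
  rw [sub_eq_zero, Finset.sum_comm]
  refine Finset.sum_congr rfl fun i _ => Finset.sum_congr rfl fun k _ => ?_
  have h : ∀ x y : ZMod 2, x + (x + y) * (y + x) = y := by decide
  rw [← mul_assoc (sgn (p i)) (sgn _), ← sgn_add, h]
  ring

/-- The special linear Lie superalgebra of supertraceless supermatrices. -/
def sl (p : ι → ZMod 2) : LieSuperalgebra :=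
  glSub p (LinearMap.ker (supertrace p)) (slSub_par p) (slSub_bracket p)

/-- The supertransposed matrix, `(X^{st})_{ij} = (-1)^{(p_i+p_j)(p_i+p(X))} X_{ji}`, extended
linearly. -/
def supertranspose (p : ι → ZMod 2) : Matrix ι ι ℂ →ₗ[ℂ] Matrix ι ι ℂ where
  toFun := fun X => Matrix.of fun i j => sgn ((p i + p j) * (p i + (p j + p i))) * X j i
  map_add' := by intro X Y; ext i j; simp only [Matrix.add_apply, Matrix.of_apply]; ring
  map_smul' := by
    intro c X; ext i j
    simp only [Matrix.smul_apply, Matrix.of_apply, smul_eq_mul, RingHom.id_apply]; ring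

theorem supertranspose_apply (p : ι → ZMod 2) (X : Matrix ι ι ℂ) (i j : ι) :
    supertranspose p X i j = sgn ((p i + p j) * (p i + (p j + p i))) * X j i := rfl

theorem supertranspose_mul {p : ι → ZMod 2} {a b : ZMod 2} {X Y : Matrix ι ι ℂ}
    (hX : (matSpace p).Homog a X) (hY : (matSpace p).Homog b Y) :
    supertranspose p (X * Y) = sgn (a * b) • (supertranspose p Y * supertranspose p X) := by
  ext i j
  simp only [supertranspose_apply, Matrix.smul_apply, Matrix.mul_apply, smul_eq_mul,
    Finset.mul_sum]
  refine Finset.sum_congr rfl fun k _ => ?_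
  rcases parity_eq_of_homog hX j k with h | h
  · simp [h]
  rcases parity_eq_of_homog hY k i with h' | h'
  · simp [h']
  have h2 : ∀ x y z : ZMod 2, (x + z) * (x + (z + x)) =
      (z + y) * (y + x) + ((x + y) * (x + (y + x)) + (y + z) * (y + (z + y))) := by decide
  rw [h2 (p i) (p k) (p j), sgn_add, sgn_add, h, h']
  ring

/-- The supermatrices that preserve the even bilinear form with matrix `B`:
`X^{st} B + B X = 0`. -/
def autSub (p : ι → ZMod 2) (B : Matrix ι ι ℂ) : Submodule ℂ (Matrix ι ι ℂ) where
  carrier := {X | supertranspose p X * B + B * X = 0}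
  add_mem' := by
    intro X Y (hX : supertranspose p X * B + B * X = 0)
      (hY : supertranspose p Y * B + B * Y = 0)
    change supertranspose p (X + Y) * B + B * (X + Y) = 0
    rw [map_add, add_mul, mul_add, add_add_add_comm, hX, hY, add_zero]
  zero_mem' := by simp
  smul_mem' := by
    intro c X (hX : supertranspose p X * B + B * X = 0)
    change supertranspose p (c • X) * B + B * (c • X) = 0
    rw [map_smul, Matrix.smul_mul, Matrix.mul_smul, ← smul_add, hX, smul_zero]

theorem autSub_par (p : ι → ZMod 2) (B : Matrix ι ι ℂ) (hB : (matSpace p).Homog 0 B) :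
    ∀ X ∈ autSub p B, matPar p X ∈ autSub p B := by
  intro X (h : supertranspose p X * B + B * X = 0)
  change supertranspose p (matPar p X) * B + B * matPar p X = 0
  ext i j
  have hij := congrFun (congrFun h i) j
  simp only [Matrix.add_apply, Matrix.mul_apply, supertranspose_apply, matPar, LinearMap.coe_mk,
    AddHom.coe_mk, Matrix.of_apply, Matrix.zero_apply] at hij ⊢
  have h2 : ∀ x y : ZMod 2, x + y = 0 → x = y := by decide
  have e1 : ∀ k, sgn ((p i + p k) * (p i + (p k + p i))) * (sgn (p k + p i) * X k i) * B k j =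
      sgn (p i + p j) * (sgn ((p i + p k) * (p i + (p k + p i))) * X k i * B k j) := by
    intro k
    rcases parity_eq_of_homog hB k j with h0 | h0
    · simp [h0]
    · rw [h2 _ _ h0, add_comm (p j) (p i)]; ring
  have e2 : ∀ k, B i k * (sgn (p k + p j) * X k j) = sgn (p i + p j) * (B i k * X k j) := by
    intro k
    rcases parity_eq_of_homog hB i k with h0 | h0
    · simp [h0]
    · rw [h2 _ _ h0]; ring
  rw [Finset.sum_congr rfl fun k _ => e1 k, Finset.sum_congr rfl fun k _ => e2 k,
    ← Finset.mul_sum, ← Finset.mul_sum, ← mul_add, hij, mul_zero]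

theorem autSub_superComm {p : ι → ZMod 2} {a b : ZMod 2} {B X Y : Matrix ι ι ℂ}
    (hX : (matSpace p).Homog a X) (hY : (matSpace p).Homog b Y)
    (h : supertranspose p X * B + B * X = 0) (h' : supertranspose p Y * B + B * Y = 0) :
    supertranspose p (superComm p X Y) * B + B * superComm p X Y = 0 := by
  rw [superComm_of_homog hX hY, map_sub, map_smul,
    supertranspose_mul hX hY, supertranspose_mul hY hX, mul_comm b a, smul_smul, sgn_mul_self,
    one_smul]
  have hx := eq_neg_of_add_eq_zero_left h
  have hy := eq_neg_of_add_eq_zero_left h'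
  have hxy : supertranspose p X * supertranspose p Y * B = B * X * Y := by
    rw [mul_assoc, hy, mul_neg, ← mul_assoc, hx, neg_mul, neg_neg]
  have hyx : supertranspose p Y * supertranspose p X * B = B * Y * X := by
    rw [mul_assoc, hx, mul_neg, ← mul_assoc, hy, neg_mul, neg_neg]
  rw [sub_mul, Matrix.smul_mul, hxy, hyx, mul_sub, Matrix.mul_smul, ← mul_assoc, ← mul_assoc]
  abel

theorem autSub_bracket (p : ι → ZMod 2) (B : Matrix ι ι ℂ) (hB : (matSpace p).Homog 0 B) :
    ∀ X ∈ autSub p B, ∀ Y ∈ autSub p B, superComm p X Y ∈ autSub p B :=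
  superComm_mem_of_homog p (autSub p B) (autSub_par p B hB)
    fun _ _ _ _ hX hY h h' => autSub_superComm hX hY h h'

variable [DecidableEq ι]

/-- The sums of an element of `autSub p B` and a scalar matrix. -/
def cautSub (p : ι → ZMod 2) (B : Matrix ι ι ℂ) : Submodule ℂ (Matrix ι ι ℂ) :=
  autSub p B ⊔ Submodule.span ℂ {1}

theorem matPar_one (p : ι → ZMod 2) : matPar p (1 : Matrix ι ι ℂ) = 1 := by
  ext i j
  change sgn (p i + p j) * (1 : Matrix ι ι ℂ) i j = (1 : Matrix ι ι ℂ) i j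
  by_cases h : i = j
  · subst h
    rw [sgn_add, sgn_mul_self, one_mul]
  · simp [h]

theorem cautSub_par (p : ι → ZMod 2) (B : Matrix ι ι ℂ) (hB : (matSpace p).Homog 0 B) :
    ∀ X ∈ cautSub p B, matPar p X ∈ cautSub p B := by
  intro X hX
  obtain ⟨Y, hY, Z, hZ, rfl⟩ := Submodule.mem_sup.1 hX
  obtain ⟨c, rfl⟩ := Submodule.mem_span_singleton.1 hZ
  rw [map_add, map_smul, matPar_one]
  exact Submodule.add_mem_sup (autSub_par p B hB Y hY)
    (Submodule.smul_mem _ _ (Submodule.mem_span_singleton_self 1))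

theorem superComm_one (p : ι → ZMod 2) (X : Matrix ι ι ℂ) : superCommL p X 1 = 0 := by
  ext i j
  change ∑ k, (X i k * (1 : Matrix ι ι ℂ) k j -
    sgn ((p i + p k) * (p k + p j)) * ((1 : Matrix ι ι ℂ) i k * X k j)) = 0
  have h : p i + p i = 0 := CharTwo.add_self_eq_zero _
  simp [Finset.sum_sub_distrib, Matrix.one_apply, h, sgn_zero]

theorem one_superComm (p : ι → ZMod 2) (X : Matrix ι ι ℂ) : superCommL p 1 X = 0 := by
  ext i j
  change ∑ k, ((1 : Matrix ι ι ℂ) i k * X k j -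
    sgn ((p i + p k) * (p k + p j)) * (X i k * (1 : Matrix ι ι ℂ) k j)) = 0
  have h : p j + p j = 0 := CharTwo.add_self_eq_zero _
  simp [Finset.sum_sub_distrib, Matrix.one_apply, h, sgn_zero]

theorem cautSub_bracket (p : ι → ZMod 2) (B : Matrix ι ι ℂ) (hB : (matSpace p).Homog 0 B) :
    ∀ X ∈ cautSub p B, ∀ Y ∈ cautSub p B, superComm p X Y ∈ cautSub p B := by
  intro X hX Y hY
  obtain ⟨X, hX', Z, hZ, rfl⟩ := Submodule.mem_sup.1 hX
  obtain ⟨c, rfl⟩ := Submodule.mem_span_singleton.1 hZ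
  obtain ⟨Y, hY', Z, hZ, rfl⟩ := Submodule.mem_sup.1 hY
  obtain ⟨d, rfl⟩ := Submodule.mem_span_singleton.1 hZ
  have e : superComm p (X + c • (1 : Matrix ι ι ℂ)) (Y + d • (1 : Matrix ι ι ℂ)) =
      superComm p X Y := by
    change superCommL p (X + c • (1 : Matrix ι ι ℂ)) (Y + d • (1 : Matrix ι ι ℂ)) =
      superCommL p X Y
    simp [superComm_one, one_superComm]
  rw [e]
  exact Submodule.mem_sup_left (autSub_bracket p B hB X hX' Y hY')

end Matrices

section Osp

variable (M N : Type)

/-- The standard format `|M| | 2|N|`. -/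
def ospParity : M ⊕ (N ⊕ N) → ZMod 2 := Sum.elim (fun _ => 0) (fun _ => 1)

variable [DecidableEq M] [DecidableEq N]

/-- The canonical nondegenerate even supersymmetric form, with matrix `diag(1_M, J)`, where
`J = (0 1; -1 0)`. -/
def ospForm : Matrix (M ⊕ (N ⊕ N)) (M ⊕ (N ⊕ N)) ℂ :=
  Matrix.fromBlocks 1 0 0 (Matrix.fromBlocks 0 1 (-1) 0)

theorem ospForm_even : (matSpace (ospParity M N)).Homog 0 (ospForm M N) := by
  rw [homog_matSpace]
  have h : (1 : ZMod 2) + 1 = 0 := by decide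
  rintro (i | i) (j | j) <;> simp [ospParity, ospForm, h, sgn_zero]

variable [Fintype M] [Fintype N]

/-- The orthosymplectic Lie superalgebra `osp(|M| | 2|N|)`. -/
def osp : LieSuperalgebra :=
  glSub (ospParity M N) (autSub (ospParity M N) (ospForm M N))
    (autSub_par _ _ (ospForm_even M N)) (autSub_bracket _ _ (ospForm_even M N))

/-- Its identity module, of superdimension `|M| | 2|N|`. -/
def ospId : SuperModule (osp M N) (vecSpace (ospParity M N)) :=
  glRestrict (idModule (ospParity M N)) (autSub (ospParity M N) (ospForm M N))
    (autSub_par _ _ (ospForm_even M N)) (autSub_bracket _ _ (ospForm_even M N))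

/-- The conformal Lie superalgebra `cosp(|M| | 2|N|)`: `osp` together with the scalar matrices. -/
def cosp : LieSuperalgebra :=
  glSub (ospParity M N) (cautSub (ospParity M N) (ospForm M N))
    (cautSub_par _ _ (ospForm_even M N)) (cautSub_bracket _ _ (ospForm_even M N))

/-- Its identity module, of superdimension `|M| | 2|N|`. -/
def cospId : SuperModule (cosp M N) (vecSpace (ospParity M N)) :=
  glRestrict (idModule (ospParity M N)) (cautSub (ospParity M N) (ospForm M N))
    (cautSub_par _ _ (ospForm_even M N)) (cautSub_bracket _ _ (ospForm_even M N))

variable {M N}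

/-- The eigenspaces `{X ∈ osp : [h, X] = d X}`, for integers `d`, of a grading element `h`. -/
def ospDegree (h : Matrix (M ⊕ (N ⊕ N)) (M ⊕ (N ⊕ N)) ℂ) (d : ℤ) : Submodule ℂ (osp M N) :=
  Submodule.comap (autSub (ospParity M N) (ospForm M N)).subtype
    (LinearMap.ker (superCommL (ospParity M N) h - (d : ℂ) • LinearMap.id))

end Osp

/-- The grading element of `osp(p+2|2n)` that is `1` and `-1` on the two isotropic vectors
`e₁ ± i e₂` of the first (two-dimensional) summand and `0` on its orthogonal complement. -/
def quadricElement (p n : ℕ) :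
    Matrix ((Fin 2 ⊕ Fin p) ⊕ (Fin n ⊕ Fin n)) ((Fin 2 ⊕ Fin p) ⊕ (Fin n ⊕ Fin n)) ℂ :=
  Matrix.fromBlocks (Matrix.fromBlocks !![0, -Complex.I; Complex.I, 0] 0 0 0) 0 0 0

/-- The grading element of `osp(2r|2n)` that is `1/2` and `-1/2` on two complementary maximal
isotropic subspaces, each of superdimension `r|n`. -/
def lagrangianElement (r n : ℕ) :
    Matrix ((Fin r ⊕ Fin r) ⊕ (Fin n ⊕ Fin n)) ((Fin r ⊕ Fin r) ⊕ (Fin n ⊕ Fin n)) ℂ :=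
  (1 / 2 : ℂ) • Matrix.fromBlocks
    (Matrix.fromBlocks 0 (-(Complex.I • 1)) (Complex.I • 1) 0) 0 0
    (Matrix.fromBlocks 1 0 0 (-1))

section Linear

variable (r n : ℕ)

/-- The standard format `r|n`. -/
def glParity : Fin r ⊕ Fin n → ZMod 2 := Sum.elim (fun _ => 0) (fun _ => 1)

/-- The exterior square `Λ²(id)` as a superspace, `id` having superdimension `r|n`. -/
def wedgeSpace : SuperSpace :=
  (matSpace (glParity r n)).sub (wedgeSquare (glParity r n)) (wedgeSquare_par (glParity r n))

/-- The module `Λ²(id)` over `gl(r|n)`. -/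
def glWedge : SuperModule (gl (glParity r n)) (wedgeSpace r n) := wedgeModule (glParity r n)

/-- The module `Λ²(id)` over `sl(r|n)`. -/
def slWedge : SuperModule (sl (glParity r n)) (wedgeSpace r n) :=
  glRestrict (glWedge r n) (LinearMap.ker (supertrace (glParity r n)))
    (slSub_par _) (slSub_bracket _)

end Linear

/-! ### Polynomial vector fields -/

theorem eq_zero_or_of_even {W : Type*} [AddCommGroup W] [Module ℂ W] (a : ZMod 2) (x : W)
    (h : x = sgn a • x) : x = 0 ∨ sgn a = 1 ∧ a = 0 := by
  by_cases ha : a = 0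
  · exact Or.inr ⟨by simp [sgn, ha], ha⟩
  · left
    rw [sgn, if_neg ha, neg_one_smul] at h
    have h2 : (2 : ℂ) • x = 0 := by
      rw [two_smul]
      nth_rewrite 2 [h]
      exact add_neg_cancel x
    exact (smul_eq_zero.1 h2).resolve_left two_ne_zero

theorem even_skew {W : Type} [LieRing W] [LieAlgebra ℂ W] (a b : ZMod 2) (x y : W)
    (hx : x = sgn a • x) : ⁅x, y⁆ = -(sgn (a * b) • ⁅y, x⁆) := by
  rcases eq_zero_or_of_even a x hx with rfl | ⟨_, rfl⟩
  · rw [zero_lie, lie_zero, smul_zero, neg_zero]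
  · rw [zero_mul, sgn_zero, one_smul, lie_skew]

theorem even_jacobi {W : Type} [LieRing W] [LieAlgebra ℂ W] (a b : ZMod 2) (x y z : W)
    (hx : x = sgn a • x) : ⁅x, ⁅y, z⁆⁆ = ⁅⁅x, y⁆, z⁆ + sgn (a * b) • ⁅y, ⁅x, z⁆⁆ := by
  rcases eq_zero_or_of_even a x hx with rfl | ⟨_, rfl⟩
  · simp
  · rw [zero_mul, sgn_zero, one_smul, leibniz_lie]

/-- A Lie algebra as a purely even Lie superalgebra. -/
def ofLieAlgebra (W : Type) [LieRing W] [LieAlgebra ℂ W] : LieSuperalgebra where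
  carrier := W
  par := LinearMap.id
  par_par := fun _ => rfl
  bracket := LinearMap.mk₂ ℂ (fun x y => ⁅x, y⁆) add_lie smul_lie lie_add
    (fun c x y => lie_smul c x y)
  par_bracket := fun _ _ => rfl
  skew := fun a b x y hx _ => even_skew a b x y hx
  jacobi := fun a b x y z hx _ => even_jacobi a b x y z hx

/-- `vect(n|0) = der ℂ[x_1, …, x_n]`. -/
def vect (n : ℕ) : LieSuperalgebra :=
  ofLieAlgebra (Derivation ℂ (MvPolynomial (Fin n) ℂ) (MvPolynomial (Fin n) ℂ))

/-- The vector fields of degree `d`: those whose coefficients are homogeneous polynomials of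
degree `d + 1`. -/
def vectDegree (n : ℕ) (d : ℤ) : Submodule ℂ (vect n) :=
  let S : Submodule ℂ (Derivation ℂ (MvPolynomial (Fin n) ℂ) (MvPolynomial (Fin n) ℂ)) :=
    { carrier := {D | ∀ (i : Fin n) (m : Fin n →₀ ℕ), (D (MvPolynomial.X i)).coeff m ≠ 0 →
        (m.degree : ℤ) = d + 1}
      add_mem' := by
        intro D E hD hE i m hm
        by_contra h
        have h1 : (D (MvPolynomial.X i)).coeff m = 0 := by_contra fun h' => h (hD i m h')
        have h2 : (E (MvPolynomial.X i)).coeff m = 0 := by_contra fun h' => h (hE i m h')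
        exact hm (by simp [h1, h2])
      zero_mem' := by intro i m hm; simp at hm
      smul_mem' := by
        intro c D hD i m hm
        refine hD i m fun h => hm ?_
        simp [h] }
  S

end SuperLie

end

/-!
A grading `g = g_{-1} ⊕ g_0 ⊕ g_1 ⊕ …` of depth one, with `g_{-1}` commutative, that is transitive
(no nonzero element of degree `≥ 1` commutes with `g_{-1}`) and whose `g_0` is identified with the
given Lie superalgebra, embeds into the Cartan prolong of `(g_{-1}, g_0)`: the element `x` of degree
`k` goes to the map `(v_0, …, v_k) ↦ [… [x, v_0], …, v_k]`. This is a homomorphism, because in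
positive degrees the bracket of the prolong is determined by the super Jacobi identity. The
structure `LocalPart` collects the data, and `LocalPart.isCartanProlong` reduces the claim `g =
(g_{-1}, g_0)_*` to the surjectivity of this map in positive degrees, that is, to the computation of
prolongs.

For the isotropic line, let `X` be an element of degree one of the prolong of `cosp`. Its values
`X(v)` have a scalar part `c(v)`, and `g_1` contains an element with the same scalar parts, so that
one may assume `X(v) ∈ osp`. Then `⟨u, X(v) w⟩` is supersymmetric in `v, w` and super-antisymmetric
in `u, w`, hence zero (`osp_tensor_eq_zero`); this is also the vanishing of the prolong of `osp`. So
the first prolong is `g_1`, and the second is a space of maps from `g_{-1}` to `g_1` that is seen to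
vanish by comparing matrix entries (`quadricTensor_eq_zero`).

For the exterior square the supertrace takes the place of the scalar part: `g_1` realizes all
possible supertraces of `X(v)` (`str_lowElem`), and the first prolong of `sl(r|n)` on `Λ²` vanishes
(`IsWedgeSymbol.eq_zero`) unless `(r, n)` is `(2, 0)`, `(3, 0)` or `(1, 1)`, when there are too few
indices to eliminate the unknown matrix entries. The second prolong vanishes by `lowCoeff_eq_zero`.

In the exceptional case `(3, 0)`, the module `Λ²(ℂ³)` is three-dimensional and `gl(3)` acts on it by
all matrices, so that the prolong consists of all polynomial vector fields; surjectivity is the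
Poincaré lemma (`isCartanProlong_vect`).

The orthosymplectic computations take place in bases that consist of eigenvectors of the grading
element. `IsCartanProlong.of_conj` transports the results to the standard form `diag(1, J)`.
-/

set_option linter.unusedSectionVars false
set_option linter.unusedSimpArgs false
set_option linter.flexible false

noncomputable section

namespace SuperLie

/-! ### Signs -/

theorem parity_zero_or_one (x : ZMod 2) : x = 0 ∨ x = 1 := by revert x; decide

theorem sgn_one : sgn 1 = -1 := by simp [sgn]

theorem sgn_ne_zero (a : ZMod 2) : sgn a ≠ 0 := by unfold sgn; split_ifs <;> simp

theorem one_add_one_parity : (1 + 1 : ZMod 2) = 0 := by decide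

/-! ### The first prolong of `sl` on the exterior square -/

section WedgeSymbols

variable {K : Type} [DecidableEq K]

/-- The coefficient of `e_a ⊗ e_b` in `M · (e_k ∧ e_l)`, where `e_k ∧ e_l = e_k ⊗ e_l - (-1)^{p_k
p_l} e_l ⊗ e_k`. -/
def wedgeCoeff (p : K → ZMod 2) (M : Matrix K K ℂ) (k l a b : K) : ℂ :=
  (if b = l then M a k else 0) + (if a = k then sgn ((p b + p l) * p a) * M b l else 0) -
    sgn (p k * p l) * ((if b = k then M a l else 0) +
      (if a = l then sgn ((p b + p k) * p a) * M b k else 0))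

/-- The matrices `Q_{ij} = X(e_i ∧ e_j)` of an element `X` of the first prolong of `gl` acting on
the exterior square. The second condition is the supersymmetry `X(v)(w) = (-1)^{p(v)p(w)} X(w)(v)`
for `v = e_i ∧ e_j` and `w = e_k ∧ e_l`, read off at the coefficient of `e_a ⊗ e_b`. -/
structure IsWedgeSymbol (p : K → ZMod 2) (Q : K → K → Matrix K K ℂ) : Prop where
  anti : ∀ i j a k, Q i j a k = -(sgn (p i * p j) * Q j i a k)
  symm : ∀ i j k l a b, wedgeCoeff p (Q i j) k l a b =
    sgn ((p i + p j) * (p k + p l)) * wedgeCoeff p (Q k l) i j a b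

/-- Either there is an odd index, or any two distinct even indices can be avoided by two further
ones. For the format `r|n` this excludes exactly `2|0` and `3|0`. -/
def EnoughEven (p : K → ZMod 2) : Prop :=
  ∀ j k, p j = 0 → p k = 0 → j ≠ k → (∃ b, p b = 1) ∨
    ∃ a b, a ≠ b ∧ a ≠ j ∧ a ≠ k ∧ b ≠ j ∧ b ≠ k

/-- An even and an odd index never exhaust all indices; this excludes the format `1|1`. -/
def EnoughMixed (p : K → ZMod 2) : Prop :=
  ∀ a i, p a = 0 → p i = 1 → ∃ b, b ≠ a ∧ b ≠ i

variable {p : K → ZMod 2} {Q : K → K → Matrix K K ℂ}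

/-- For pairwise distinct `i`, `j`, `k` and a fixed `a` the entries `(Q_{ij})_{ak}` are
antisymmetric in `i, j` and, comparing coefficients of `e_a ⊗ e_j`, supersymmetric in `i, k`; up to
signs this makes them both symmetric and antisymmetric. -/
theorem IsWedgeSymbol.eq_zero_of_distinct (h : IsWedgeSymbol p Q) {i j k a : K} (hij : i ≠ j)
    (hik : i ≠ k) (hjk : j ≠ k) (hai : a ≠ i) (haj : a ≠ j) (hak : a ≠ k) : Q i j a k = 0 := by
  have s : ∀ {i j k : K}, i ≠ j → i ≠ k → j ≠ k → a ≠ i → a ≠ j → a ≠ k →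
      Q i j a k = sgn ((p i + p j) * (p k + p j)) * Q k j a i := by
    intro i j k hij hik hjk hai haj hak
    simpa [wedgeCoeff, hij, hik, hjk, hai, haj, hak, hij.symm, hik.symm, hjk.symm]
      using h.symm i j k j a j
  have z : ∀ {i j k : K}, i ≠ j → i ≠ k → j ≠ k → a ≠ i → a ≠ j → a ≠ k → p k = 1 →
      Q i j a k = 0 := by
    intro i j k hij hik hjk hai haj hak hk
    have e := h.symm i j k k a k
    simp [wedgeCoeff, hik, hjk, hai, haj, hak, hik.symm, hjk.symm, hk, sgn_one] at e
    grind
  have e1 := s hij hik hjk hai haj hak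
  have e2 := h.anti i j a k
  have e3 := s hij.symm hjk hik haj hai hak
  rcases parity_zero_or_one (p k) with hk | hk
  · rcases parity_zero_or_one (p i) with hi | hi
    · rcases parity_zero_or_one (p j) with hj | hj
      · have e4 := h.anti k j a i
        have e5 := h.anti k i a j
        have e6 := s hjk hij.symm hik.symm haj hak hai
        simp only [hi, hj, hk, sgn_zero, mul_zero, add_zero, one_mul] at e1 e2 e3 e4 e5 e6
        grind
      · rw [e2, e3, z hik.symm hjk.symm hij hak hai haj hj]; simp
    · rw [e1, z hjk.symm hik.symm hij.symm hak haj hai hi]; simp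
  · exact z hij hik hjk hai haj hak hk

/-- The entry `(a, i)` of `Q_{ij}` vanishes for `a ∉ {i, j}`. When all of `i`, `j`, `a` are even, a
fourth index is needed to see this. -/
theorem IsWedgeSymbol.eq_zero_of_ne (h : IsWedgeSymbol p Q)
    (hK : EnoughEven p)
    {i j a : K} (hij : i ≠ j) (hai : a ≠ i) (haj : a ≠ j) : Q i j a i = 0 := by
  rcases parity_zero_or_one (p i) with hi | hi <;> rcases parity_zero_or_one (p j) with hj | hj
  · rcases parity_zero_or_one (p a) with ha | ha
    · obtain ⟨b, hba, hbi, hbj⟩ : ∃ b, b ≠ a ∧ b ≠ i ∧ b ≠ j := by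
        rcases hK i j hi hj hij with ⟨b, hb⟩ | ⟨b, c, hbc, hbi, hbj, hci, hcj⟩
        · refine ⟨b, ?_, ?_, ?_⟩ <;> rintro rfl <;> simp_all
        · by_cases hba : b = a
          · exact ⟨c, fun hca => hbc (hba.trans hca.symm), hci, hcj⟩
          · exact ⟨b, hba, hbi, hbj⟩
      simpa [wedgeCoeff, hij, hai, haj, hba, hbi, hbj, hij.symm, hai.symm, haj.symm, hba.symm,
        hbi.symm, hbj.symm] using h.symm i j i b a b
    · have e := h.symm i j i a a a
      simp [wedgeCoeff, hij, hai, haj, hij.symm, hai.symm, haj.symm, hi, hj, ha, sgn_zero,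
          sgn_one, one_add_one_parity] at e
      grind
  · have e := h.symm i j i j a j
    simp [wedgeCoeff, hij, hai, haj, hij.symm, hai.symm, haj.symm, hi, hj, sgn_zero, sgn_one,
        one_add_one_parity] at e
    grind
  · have e := h.symm i j i j a j
    simp [wedgeCoeff, hij, hai, haj, hij.symm, hai.symm, haj.symm, hi, hj, sgn_zero, sgn_one,
        one_add_one_parity] at e
    grind
  · have e1 := h.symm i j i i a i
    have e2 := h.symm j j i i a i
    have e3 := h.symm i i j j a j
    simp [wedgeCoeff, hij, hai, haj, hij.symm, hai.symm, haj.symm, hi, hj, sgn_zero, sgn_one,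
        one_add_one_parity] at e1 e2 e3
    grind

theorem IsWedgeSymbol.self_eq_zero (h : IsWedgeSymbol p Q) {i : K} (hi : p i = 0) (a b : K) :
    Q i i a b = 0 := by
  have := h.anti i i a b
  simp [hi, sgn_zero] at this
  grind

/-- `Q_{ij}` has off-diagonal entries in the rows `i` and `j` only. -/
theorem IsWedgeSymbol.offdiag_eq_zero (h : IsWedgeSymbol p Q)
    (hK : EnoughEven p)
    (hK' : EnoughMixed p)
    {i j a k : K} (hai : a ≠ i) (haj : a ≠ j) (hak : a ≠ k) : Q i j a k = 0 := by
  by_cases hij : i = j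
  · subst hij
    rcases parity_zero_or_one (p i) with hi | hi
    · exact h.self_eq_zero hi a k
    by_cases hik : i = k
    · subst hik
      rcases parity_zero_or_one (p a) with ha | ha
      · obtain ⟨b, hba, hbi⟩ := hK' a i ha hi
        simpa [wedgeCoeff, hai, hba, hbi, hai.symm, hba.symm, hbi.symm] using h.symm i i i b a b
      · have e := h.symm i i i a a a
        simp [wedgeCoeff, hai, hai.symm, hi, ha, sgn_zero, sgn_one, one_add_one_parity] at e
        grind
    · have e := h.symm i i k i a i
      have e1 := h.eq_zero_of_ne hK hik hai hak
      have e2 := h.anti i k a i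
      rcases parity_zero_or_one (p k) with hk | hk <;>
      simp [wedgeCoeff, hai, hak, hik, hai.symm, hak.symm, Ne.symm hik, hi, hk, sgn_zero,
          sgn_one, one_add_one_parity] at e e2 <;> grind
  · by_cases hik : i = k
    · subst hik; exact h.eq_zero_of_ne hK hij hai haj
    by_cases hjk : j = k
    · subst hjk
      rw [h.anti, h.eq_zero_of_ne hK (Ne.symm hij) haj hai, mul_zero, neg_zero]
    · exact h.eq_zero_of_distinct hij hik hjk hai haj hak

/-- For distinct `j`, `k` with `j` odd, the diagonal of `Q_{jk}` is supported at `j` and `k`, and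
its two entries contribute equally to the supertrace; so it vanishes if the supertrace does. -/
theorem IsWedgeSymbol.diag_of_odd (h : IsWedgeSymbol p Q) {j k : K} (hjk : j ≠ k) (hj : p j = 1) :
    (∀ a, a ≠ j → a ≠ k → Q j k a a = 0) ∧ sgn (p k) * Q j k k k = sgn (p j) * Q j k j j := by
  have key : sgn (p k) * Q j k k k = sgn (p j) * Q j k j j := by
    have s1 := h.symm j k j j j j
    rcases parity_zero_or_one (p k) with hk | hk
    · have e := h.symm j k j k j k
      simp [wedgeCoeff, hjk, hjk.symm, hj, hk, sgn_zero, sgn_one, one_add_one_parity] at e s1 ⊢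
      grind
    · have e := h.symm j j k k j k
      have e' := h.symm j k k k k k
      have t1 := h.anti k k j k
      have t2 := h.anti k k k j
      have t3 := h.anti j j j k
      simp [wedgeCoeff, hjk, hjk.symm, hj, hk, sgn_zero, sgn_one, one_add_one_parity] at e e' s1 ⊢
      grind
  refine ⟨fun a haj hak => ?_, key⟩
  have s1 := h.symm j k j j j j
  have s2 := h.symm a k j j a j
  have s3 := h.symm j k a k a k
  rcases parity_zero_or_one (p k) with hk | hk <;> rcases parity_zero_or_one (p a) with ha | ha <;>
  simp [wedgeCoeff, hjk, hjk.symm, haj, haj.symm, hak, hak.symm, ha, hj, hk, sgn_zero, sgn_one,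
      one_add_one_parity] at s1 s2 s3 key <;>
  grind

/-- The analogue of `IsWedgeSymbol.diag_of_odd` for two even indices. For `3|0` there are further
solutions, which is what makes that case exceptional. -/
theorem IsWedgeSymbol.diag_of_even (h : IsWedgeSymbol p Q)
    (hK : EnoughEven p)
    {j k : K} (hjk : j ≠ k) (hj : p j = 0) (hk : p k = 0) :
    (∀ a, a ≠ j → a ≠ k → Q j k a a = 0) ∧ Q j k k k = Q j k j j := by
  -- `R1` says that the diagonal entries outside `j`, `k` change sign from one index to the next,
  -- `R2`, `R3`, `R4` relate them to the entries at `j` and `k`. An odd index or two further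
  -- indices then force them to vanish.
  have R1 : ∀ a b, a ≠ b → a ≠ j → a ≠ k → b ≠ j → b ≠ k → Q j k a a = -Q j k b b := by
    intro a b hab haj hak hbj hbk
    have e := h.symm j k a b a b
    simp [wedgeCoeff, hab, haj, hak, hbj, hbk, hab.symm, haj.symm, hak.symm, hbj.symm, hbk.symm,
      hj, hk, sgn_zero, CharTwo.add_self_eq_zero] at e
    grind
  have R2 : ∀ a, a ≠ j → a ≠ k → Q j k a a + Q j k k k = Q a k a j := by
    intro a haj hak
    have e := h.symm j k a k a k
    simp [wedgeCoeff, hjk, hjk.symm, haj, hak, haj.symm, hak.symm, hj, hk, sgn_zero] at e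
    grind
  have R3 : ∀ a, a ≠ j → a ≠ k → Q j k a a + Q j k j j = -Q a j a k := by
    intro a haj hak
    have e := h.symm j k a j a j
    simp [wedgeCoeff, hjk, hjk.symm, haj, hak, haj.symm, hak.symm, hj, hk, sgn_zero] at e
    grind
  have R4 : ∀ a b, a ≠ b → a ≠ j → a ≠ k → b ≠ j → b ≠ k → Q a j a k = -Q b k b j := by
    intro a b hab haj hak hbj hbk
    have e := h.symm a j b k a b
    have t := h.anti b k b j
    rcases parity_zero_or_one (p a) with ha | ha <;> rcases parity_zero_or_one (p b) with hb | hb <;>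
    simp [wedgeCoeff, hab, haj, hak, hbj, hbk, hab.symm, haj.symm, hak.symm, hbj.symm, hbk.symm,
      hj, hk, ha, hb, sgn_zero, sgn_one, hjk, hjk.symm] at e t <;> grind
  rcases hK j k hj hk hjk with ⟨o, ho⟩ | ⟨a, b, hab, haj, hak, hbj, hbk⟩
  · have hoj : o ≠ j := by rintro rfl; simp [hj] at ho
    have hok : o ≠ k := by rintro rfl; simp [hk] at ho
    have e := h.symm j k o o o o
    have e1 := h.symm o k o j o o
    simp [wedgeCoeff, hoj, hok, hoj.symm, hok.symm, hj, hk, ho, sgn_zero, sgn_one,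
        one_add_one_parity] at e e1
    have e2 := R2 o hoj hok
    have e3 := R3 o hoj hok
    have e4 : Q j k o o = 0 := by grind
    refine ⟨fun a haj hak => ?_, by grind⟩
    by_cases hao : a = o
    · rw [hao, e4]
    · rw [R1 a o hao haj hak hoj hok, e4, neg_zero]
  · have e1 := R1 a b hab haj hak hbj hbk
    have e2 := R4 a b hab haj hak hbj hbk
    have e3 := R4 b a hab.symm hbj hbk haj hak
    have e4 := R2 a haj hak
    have e5 := R2 b hbj hbk
    have e6 := R3 a haj hak
    have e7 := R3 b hbj hbk
    have e8 : Q j k a a = 0 := by grind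
    have e9 : Q j k b b = 0 := by grind
    refine ⟨fun c hcj hck => ?_, by grind⟩
    by_cases hca : c = a
    · rw [hca, e8]
    · rw [R1 c a hca hcj hck haj hak, e8, neg_zero]

theorem IsWedgeSymbol.diag_self (h : IsWedgeSymbol p Q) (hK' : EnoughMixed p) {j a : K}
    (hj : p j = 1) (haj : a ≠ j) : Q j j a a = 0 := by
  rcases parity_zero_or_one (p a) with ha | ha
  · obtain ⟨b, hba, hbj⟩ := hK' a j ha hj
    have e1 := h.symm j j a b a b
    have e2 := h.symm a j j j a j
    have e3 := h.symm b j j j b j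
    have e4 := h.symm a j j b a b
    have e5 := h.anti j b b j
    have e6 := h.anti j a a j
    rcases parity_zero_or_one (p b) with hb | hb <;>
    simp [wedgeCoeff, haj, haj.symm, hba, hba.symm, hbj, hbj.symm, hj, ha, hb, sgn_zero, sgn_one,
      one_add_one_parity] at e1 e2 e3 e4 e5 e6 <;> grind
  · have e := h.symm j j a a a a
    simp [wedgeCoeff, haj, haj.symm, hj, ha, sgn_zero, sgn_one, one_add_one_parity] at e
    grind

theorem IsWedgeSymbol.even_pair (h : IsWedgeSymbol p Q) (hK : EnoughEven p) {j a : K}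
    (hj : p j = 0) (haj : a ≠ j) : Q a j a j = 0 := by
  have odd : ∀ a, p a = 1 → Q a j a j = 0 := by
    intro a ha
    have haj : a ≠ j := by rintro rfl; simp [hj] at ha
    have e := h.symm a j a j a a
    simp [wedgeCoeff, haj, haj.symm, hj, ha, sgn_zero, sgn_one, one_add_one_parity] at e
    grind
  have R : ∀ a b, p a = 0 → a ≠ b → a ≠ j → b ≠ j → Q a j a j = -Q b j b j := by
    intro a b ha hab haj hbj
    have e := h.symm a j j b a b
    have t := h.anti j b b j
    simp [wedgeCoeff, haj, haj.symm, hab, hab.symm, hbj, hbj.symm, hj, ha, sgn_zero] at e t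
    grind
  rcases parity_zero_or_one (p a) with ha | ha
  · rcases hK a j ha hj haj with ⟨b, hb⟩ | ⟨b, c, hbc, hba, hbj, hca, hcj⟩
    · have hbj : b ≠ j := by rintro rfl; simp [hj] at hb
      have hba : a ≠ b := by rintro rfl; simp [ha] at hb
      rw [R a b ha hba haj hbj, odd b hb, neg_zero]
    · rcases parity_zero_or_one (p b) with hb | hb
      · have e1 := R a b ha hba.symm haj hbj
        have e2 := R a c ha hca.symm haj hcj
        have e3 := R b c hb hbc hbj hcj
        grind
      · rw [R a b ha hba.symm haj hbj, odd b hb, neg_zero]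
  · exact odd a ha

variable [Fintype K]

/-- A symbol with values of vanishing supertrace is zero: the first prolong of `sl` on the exterior
square vanishes. -/
theorem IsWedgeSymbol.eq_zero (h : IsWedgeSymbol p Q) (hK : EnoughEven p) (hK' : EnoughMixed p)
    (hstr : ∀ i j, ∑ a, sgn (p a) * Q i j a a = 0) (i j : K) : Q i j = 0 := by
  have hs : ∀ a, sgn (p a) ≠ 0 := fun a => by
    rcases parity_zero_or_one (p a) with ha | ha <;> simp [ha, sgn_zero, sgn_one]
  -- The diagonals of `Q_{jk}`, `j ≠ k`, have two entries of equal supertrace, hence vanish.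
  have D0 : ∀ j k, j ≠ k → (∀ a, a ≠ j → a ≠ k → Q j k a a = 0) ∧
      sgn (p k) * Q j k k k = sgn (p j) * Q j k j j := by
    intro j k hjk
    rcases parity_zero_or_one (p j) with hj | hj
    · rcases parity_zero_or_one (p k) with hk | hk
      · have := h.diag_of_even hK hjk hj hk
        simpa [hj, hk, sgn_zero] using this
      · have := h.diag_of_odd hjk.symm hk
        refine ⟨fun a haj hak => ?_, ?_⟩
        · rw [h.anti, this.1 a hak haj]; simp
        · rw [h.anti j k k k, h.anti j k j j]
          linear_combination (sgn (p j * p k)) * this.2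
    · exact h.diag_of_odd hjk hj
  have D : ∀ j k a, j ≠ k → Q j k a a = 0 := by
    intro j k a hjk
    obtain ⟨h1, h2⟩ := D0 j k hjk
    have t := hstr j k
    rw [Fintype.sum_eq_add j k hjk (fun c hc => by rw [h1 c hc.1 hc.2, mul_zero]), h2,
      ← two_mul] at t
    have tj : Q j k j j = 0 := by simpa [hs] using t
    have tk : Q j k k k = 0 := by simpa [hs, tj] using h2
    by_cases haj : a = j
    · rw [haj, tj]
    by_cases hak : a = k
    · rw [hak, tk]
    exact h1 a haj hak
  -- The row `i` of `Q_{ij}`; by antisymmetry this also covers the row `j`.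
  have first : ∀ i j k, Q i j i k = 0 := by
    intro i j k
    by_cases hij : i = j
    · subst hij
      rcases parity_zero_or_one (p i) with hi | hi
      · exact h.self_eq_zero hi i k
      by_cases hik : i = k
      · subst hik
        have t := hstr i i
        rw [Fintype.sum_eq_single i (fun c hc => by rw [h.diag_self hK' hi hc, mul_zero])] at t
        simpa [hs] using t
      · have e := h.symm i k i i i i
        have d := D i k i hik
        rcases parity_zero_or_one (p k) with hk | hk <;>
        simp [wedgeCoeff, hik, Ne.symm hik, hi, hk, d, sgn_zero, sgn_one,
            one_add_one_parity] at e <;>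
        grind
    · by_cases hik : i = k
      · subst hik; exact D i j i hij
      by_cases hjk : j = k
      · subst hjk
        rcases parity_zero_or_one (p j) with hj | hj
        · exact h.even_pair hK hj hij
        · have e := h.symm i j j j i j
          have t := hstr j j
          rw [Fintype.sum_eq_single j (fun c hc => by rw [h.diag_self hK' hj hc, mul_zero])] at t
          have t' : Q j j j j = 0 := by simpa [hs] using t
          have d := h.diag_self hK' hj hij
          rcases parity_zero_or_one (p i) with hi | hi <;>
          simp [wedgeCoeff, hij, Ne.symm hij, hi, hj, d, t', sgn_zero, sgn_one,
              one_add_one_parity] at e <;>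
          grind
      · have e := h.symm j k i j i j
        rw [wedgeCoeff, wedgeCoeff] at e
        simp only [D j k _ hjk, hij, hik, hjk, Ne.symm hij, Ne.symm hik, Ne.symm hjk, if_true,
            if_false, zero_add, add_zero, mul_zero, sub_zero, zero_sub] at e
        simpa [hs, sgn_ne_zero] using e
  ext a k
  rw [Matrix.zero_apply]
  by_cases hai : a = i
  · subst hai; exact first a j k
  by_cases haj : a = j
  · subst haj; rw [h.anti, first a i k]; simp
  by_cases hak : a = k
  · subst hak
    by_cases hij : i = j
    · subst hij
      rcases parity_zero_or_one (p i) with hi | hi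
      · exact h.self_eq_zero hi a a
      · exact h.diag_self hK' hi hai
    · exact D i j a hij
  · exact h.offdiag_eq_zero hK hK' hai haj hak

end WedgeSymbols

/-! ### Brackets of inhomogeneous elements -/

section Parity

theorem SuperSpace.homog_induction (V : SuperSpace) {P : V → Prop}
    (hadd : ∀ x y, P x → P y → P (x + y)) (h : ∀ a x, V.Homog a x → P x) (x : V) : P x := by
  rw [← V.evenPart_add_oddPart x]
  exact hadd _ _ (h 0 _ (V.homog_evenPart x)) (h 1 _ (V.homog_oddPart x))

theorem SuperSpace.homog_cases (V : SuperSpace) {a : ZMod 2} {v : V} (h : V.Homog a v) :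
    (a = 0 ∧ V.par v = v ∧ V.evenPart v = v ∧ V.oddPart v = 0) ∨
      (a = 1 ∧ V.par v = -v ∧ V.evenPart v = 0 ∧ V.oddPart v = v) := by
  have ha : a = 0 ∨ a = 1 := parity_zero_or_one a
  rcases ha with rfl | rfl
  · left
    have hv : V.par v = v := by simpa [SuperSpace.Homog, sgn] using h
    refine ⟨rfl, hv, ?_, ?_⟩
    · simp only [SuperSpace.evenPart, LinearMap.smul_apply, LinearMap.add_apply,
        LinearMap.id_apply, hv]
      module
    · simp [SuperSpace.oddPart, hv]
  · right
    have hv : V.par v = -v := by simpa [SuperSpace.Homog, sgn] using h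
    refine ⟨rfl, hv, ?_, ?_⟩
    · simp [SuperSpace.evenPart, hv]
    · simp only [SuperSpace.oddPart, LinearMap.smul_apply, LinearMap.sub_apply,
        LinearMap.id_apply, hv]
      module

/-- Super-antisymmetry for arbitrary elements, the sign being expressed by the parity operator. -/
theorem LieSuperalgebra.bracket_eq_neg (g : LieSuperalgebra) (x y : g) :
    g.bracket x y = -(g.bracket y (g.evenPart x) + g.bracket (g.par y) (g.oddPart x)) := by
  refine g.homog_induction (P := fun x => g.bracket x y =
    -(g.bracket y (g.evenPart x) + g.bracket (g.par y) (g.oddPart x))) ?_ ?_ x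
  · intro x x' hx hx'
    simp only [map_add, LinearMap.add_apply, hx, hx']; abel
  intro a x hx
  refine g.homog_induction (P := fun y => g.bracket x y =
    -(g.bracket y (g.evenPart x) + g.bracket (g.par y) (g.oddPart x))) ?_ ?_ y
  · intro y y' hy hy'
    simp only [map_add, LinearMap.add_apply, hy, hy']; abel
  intro b y hy
  rw [g.skew a b x y hx hy]
  rcases g.homog_cases hx with ⟨rfl, _, h2, h3⟩ | ⟨rfl, _, h2, h3⟩ <;>
  rcases g.homog_cases hy with ⟨rfl, h1, _, _⟩ | ⟨rfl, h1, _, _⟩ <;>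
  simp [h1, h2, h3, sgn]

/-- The super Jacobi identity for arbitrary elements, in the form that defines the bracket of the
Cartan prolong. -/
theorem LieSuperalgebra.bracket_bracket (g : LieSuperalgebra) (x y z : g) :
    g.bracket (g.bracket x y) z = g.bracket x (g.bracket y z) +
      (g.bracket (g.bracket x (g.evenPart z)) y +
        g.bracket (g.bracket x (g.oddPart z)) (g.par y)) := by
  refine g.homog_induction (P := fun y => g.bracket (g.bracket x y) z =
    g.bracket x (g.bracket y z) +
      (g.bracket (g.bracket x (g.evenPart z)) y + g.bracket (g.bracket x (g.oddPart z)) (g.par y)))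
      ?_ ?_ y
  · intro x x' hx hx'
    simp only [map_add, LinearMap.add_apply, hx, hx']; abel
  intro b y hy
  refine g.homog_induction (P := fun z => g.bracket (g.bracket x y) z =
    g.bracket x (g.bracket y z) +
      (g.bracket (g.bracket x (g.evenPart z)) y + g.bracket (g.bracket x (g.oddPart z)) (g.par y)))
      ?_ ?_ z
  · intro x x' hx hx'
    simp only [map_add, LinearMap.add_apply, hx, hx']; abel
  intro c z hz
  refine g.homog_induction (P := fun x => g.bracket (g.bracket x y) z =
    g.bracket x (g.bracket y z) +
      (g.bracket (g.bracket x (g.evenPart z)) y + g.bracket (g.bracket x (g.oddPart z)) (g.par y)))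
      ?_ ?_ x
  · intro x x' hx hx'
    simp only [map_add, LinearMap.add_apply, hx, hx']; abel
  intro a x hx
  have hxz : g.Homog (a + c) (g.bracket x z) := by
    have hx' : g.par x = sgn a • x := hx
    have hz' : g.par z = sgn c • z := hz
    change g.par (g.bracket x z) = _
    rw [g.par_bracket, hx', hz', sgn_add]
    simp [smul_smul, mul_comm]
  have j := g.jacobi a b x y z hx hy
  rw [g.skew b (a + c) y _ hy hxz, smul_neg, smul_smul, mul_add, sgn_add, ← mul_assoc, mul_comm b a,
    sgn_mul_self, one_mul] at j
  rw [j]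
  rcases g.homog_cases hy with ⟨rfl, h1, _, _⟩ | ⟨rfl, h1, _, _⟩ <;>
  rcases g.homog_cases hz with ⟨rfl, _, h2, h3⟩ | ⟨rfl, _, h2, h3⟩ <;>
  simp [h1, h2, h3, sgn]

end Parity

/-! ### Embedding a graded Lie superalgebra into a Cartan prolong -/

section LocalParts

variable {L : LieSuperalgebra} {V : SuperSpace} {g : LieSuperalgebra} {𝒢 : ℤ → Submodule ℂ g}
  {ρ : SuperModule L V}

/-- An identification of the components of degree `-1` and `0` of a graded Lie superalgebra `g` with
`V` and `L`, compatible with brackets, for a grading of depth one that is transitive: an element of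
degree `≥ 1` that commutes with degree `-1` vanishes. The maps to `V` and `L` are defined on all of
`g` and vanish in the other degrees, which avoids subtypes of homogeneous elements. -/
structure LocalPart (g : LieSuperalgebra) (𝒢 : ℤ → Submodule ℂ g) (ρ : SuperModule L V) where
  /-- The inclusion of `V` as the component of degree `-1`. -/
  inc : V →ₗ[ℂ] g
  /-- The component of degree `-1`. -/
  projV : g →ₗ[ℂ] V
  /-- The component of degree `0`. -/
  projL : g →ₗ[ℂ] L
  inc_par : ∀ v, inc (V.par v) = g.par (inc v)
  projV_par : ∀ x, projV (g.par x) = V.par (projV x)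
  projL_par : ∀ x, projL (g.par x) = L.par (projL x)
  inc_comm : ∀ v w, g.bracket (inc v) (inc w) = 0
  projV_inc : ∀ v, projV (inc v) = v
  projL_inc : ∀ v, projL (inc v) = 0
  projV_bracket_inc : ∀ x v, projV (g.bracket x (inc v)) = ρ.act (projL x) v
  projV_bracket : ∀ x y, projV x = 0 → projV y = 0 → projV (g.bracket x y) = 0
  projL_bracket : ∀ x y, projV x = 0 → projV y = 0 →
    projL (g.bracket x y) = L.bracket (projL x) (projL y)
  inc_mem : ∀ v, inc v ∈ 𝒢 (-1)
  bracket_inc_mem : ∀ d x v, x ∈ 𝒢 d → g.bracket x (inc v) ∈ 𝒢 (d - 1)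
  projV_eq_zero : ∀ d x, x ∈ 𝒢 d → d ≠ -1 → projV x = 0
  projL_eq_zero : ∀ d x, x ∈ 𝒢 d → d ≠ 0 → projL x = 0
  iSup_eq_top : ⨆ k : ℕ, 𝒢 ((k : ℤ) - 1) = ⊤
  eq_zero_of_projV : ∀ x ∈ 𝒢 (-1), projV x = 0 → x = 0
  eq_zero_of_projL : ∀ x ∈ 𝒢 0, projL x = 0 → x = 0
  transitive : ∀ (k : ℕ), ∀ x ∈ 𝒢 ((k : ℤ) + 1), (∀ v, g.bracket x (inc v) = 0) → x = 0
  projL_surj : ∀ A, ∃ x ∈ 𝒢 0, projL x = A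

namespace LocalPart

variable (D : LocalPart g 𝒢 ρ)

/-- The component of degree `k - 1` of `x`, as an element of the Cartan prolong: the multilinear map
`(v_1, …, v_k) ↦ [… [x, v_1], …, v_k]`, stopped when it reaches degree `0`. -/
def toLevel (D : LocalPart g 𝒢 ρ) : (k : ℕ) → (g →ₗ[ℂ] level ρ k)
  | 0 => D.projV
  | 1 => D.projL
  | k + 2 => (g.bracket.compr₂ (toLevel D (k + 1))).compl₂ D.inc

theorem ev_toLevel (k : ℕ) (x : g) (v : V) :
    ev ρ k (D.toLevel (k + 1) x) v = D.toLevel k (g.bracket x (D.inc v)) := by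
  cases k with
  | zero => exact (D.projV_bracket_inc x v).symm
  | succ k => rfl

theorem inc_evenPart (v : V) : D.inc (V.evenPart v) = g.evenPart (D.inc v) := by
  simp [SuperSpace.evenPart, D.inc_par]

theorem inc_oddPart (v : V) : D.inc (V.oddPart v) = g.oddPart (D.inc v) := by
  simp [SuperSpace.oddPart, D.inc_par]

theorem toLevel_par (k : ℕ) (x : g) : D.toLevel k (g.par x) = (level ρ k).par (D.toLevel k x) := by
  induction k using Nat.twoStepInduction generalizing x with
  | zero => exact D.projV_par x
  | one => exact D.projL_par x
  | more k _ ih =>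
    refine LinearMap.ext fun v => ?_
    change D.toLevel (k + 1) (g.bracket (g.par x) (D.inc v)) =
      (level ρ (k + 1)).par (D.toLevel (k + 1) (g.bracket x (D.inc (V.par v))))
    rw [← ih, g.par_bracket, ← D.inc_par, V.par_par]

/-- The embedding of `g` into families; it is the isomorphism with the Cartan prolong as soon as it
is onto. -/
def toFamily : g →ₗ[ℂ] Family ρ := LinearMap.pi fun k => D.toLevel k

theorem famPar_toFamily (x : g) : D.toFamily (g.par x) = famPar ρ (D.toFamily x) :=
  funext fun k => D.toLevel_par k x

theorem contract_toFamily (v : V) (x : g) :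
    contract ρ v (D.toFamily x) = D.toFamily (g.bracket x (D.inc v)) :=
  funext fun k => D.ev_toLevel k x v

theorem revEv_toLevel (k : ℕ) (v : V) (x : g) :
    revEv ρ k v (D.toLevel (k + 1) x) = D.toLevel k (g.bracket (D.inc v) x) := by
  rw [g.bracket_eq_neg (D.inc v) x, map_neg, map_add, ← inc_evenPart, ← inc_oddPart,
    ← ev_toLevel, ← ev_toLevel, toLevel_par]
  rfl

/-- The terms `[x, y_{-1}]` and `[x_{-1}, y]` of a bracket, computed in `g`. -/
theorem pairing_toFamily (k : ℕ) (x y : g) :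
    pairing ρ k (D.toFamily x) (D.toFamily y) =
      D.toLevel k (g.bracket x (D.inc (D.projV y))) +
        D.toLevel k (g.bracket (D.inc (D.projV x)) y) := by
  rw [← ev_toLevel, ← revEv_toLevel]
  rfl

/-- The bracket of `x` and `y` splits into that of their parts of degree `≥ 0` and the terms that
involve a part of degree `-1`. -/
theorem bracket_split (x y : g) : g.bracket x y =
    g.bracket (x - D.inc (D.projV x)) (y - D.inc (D.projV y)) +
      (g.bracket x (D.inc (D.projV y)) + g.bracket (D.inc (D.projV x)) y) := by
  simp only [map_sub, LinearMap.sub_apply, D.inc_comm]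
  abel

/-- `toFamily` is a homomorphism. In degrees `-1` and `0` this is an assumption on the local part;
in positive degrees both brackets satisfy the same recursion, given by the super Jacobi identity. -/
theorem bracketAt_toFamily (k : ℕ) (x y : g) :
    D.toLevel k (g.bracket x y) = bracketAt ρ k (D.toFamily x) (D.toFamily y) := by
  have h0 : ∀ z, D.projV (z - D.inc (D.projV z)) = 0 := fun z => by
    rw [map_sub, D.projV_inc, sub_self]
  have h1 : ∀ z, D.projL (z - D.inc (D.projV z)) = D.projL z := fun z => by
    rw [map_sub, D.projL_inc, sub_zero]
  induction k using Nat.twoStepInduction generalizing x y with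
  | zero =>
    change _ = pairing ρ 0 _ _
    rw [pairing_toFamily, D.bracket_split x y, map_add, map_add]
    have h : D.toLevel 0 (g.bracket (x - D.inc (D.projV x)) (y - D.inc (D.projV y))) = 0 :=
      D.projV_bracket _ _ (h0 x) (h0 y)
    rw [h, zero_add]
  | one =>
    change _ = zeroBracket ρ _ _ + pairing ρ 1 _ _
    rw [pairing_toFamily, D.bracket_split x y, map_add, map_add]
    congr 1
    refine (D.projL_bracket _ _ (h0 x) (h0 y)).trans ?_
    rw [h1, h1]
    rfl
  | more k _ ih =>
    refine LinearMap.ext fun v => ?_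
    change D.toLevel (k + 1) (g.bracket (g.bracket x y) (D.inc v)) =
      bracketAt ρ (k + 1) (D.toFamily x) (contract ρ v (D.toFamily y)) +
      (bracketAt ρ (k + 1) (contract ρ (V.evenPart v) (D.toFamily x)) (D.toFamily y) +
      bracketAt ρ (k + 1) (contract ρ (V.oddPart v) (D.toFamily x)) (famPar ρ (D.toFamily y)))
    rw [g.bracket_bracket, map_add, map_add, contract_toFamily, contract_toFamily,
      contract_toFamily, ← famPar_toFamily, ← ih, ← ih, ← ih, inc_evenPart, inc_oddPart]

/-- The iterated brackets are supersymmetric since degree `-1` is commutative. -/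
theorem toLevel_mem (k : ℕ) (x : g) : D.toLevel k x ∈ component ρ k := by
  induction k using Nat.twoStepInduction generalizing x with
  | zero => trivial
  | one => trivial
  | more k _ ih =>
    refine ⟨fun v => ih (g.bracket x (D.inc v)), fun a b v w hv hw => ?_⟩
    change ev ρ k (D.toLevel (k + 1) (g.bracket x (D.inc v))) w =
      sgn (a * b) • ev ρ k (D.toLevel (k + 1) (g.bracket x (D.inc w))) v
    have hw' := V.homog_cases hw
    have hv' := V.homog_cases hv
    rw [ev_toLevel, ev_toLevel, g.bracket_bracket, D.inc_comm, map_zero, zero_add,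
      ← inc_evenPart, ← inc_oddPart, ← D.inc_par]
    rcases hw' with ⟨rfl, _, h2, h3⟩ | ⟨rfl, _, h2, h3⟩ <;>
    rcases hv' with ⟨rfl, h1, _, _⟩ | ⟨rfl, h1, _, _⟩ <;>
    simp [h1, h2, h3, sgn]

theorem toLevel_eq_zero (k : ℕ) (d : ℤ) (x : g) (hx : x ∈ 𝒢 d) (hd : d ≠ (k : ℤ) - 1) :
    D.toLevel k x = 0 := by
  induction k using Nat.twoStepInduction generalizing x d with
  | zero => exact D.projV_eq_zero d x hx (by simpa using hd)
  | one => exact D.projL_eq_zero d x hx (by simpa using hd)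
  | more k _ ih =>
    refine LinearMap.ext fun v => ?_
    refine ih (d - 1) _ (D.bracket_inc_mem d x v hx) ?_
    push_cast at hd ⊢
    omega

theorem eq_zero_of_toLevel (k : ℕ) (x : g) (hx : x ∈ 𝒢 ((k : ℤ) - 1)) (h : D.toLevel k x = 0) :
    x = 0 := by
  induction k using Nat.twoStepInduction generalizing x with
  | zero => exact D.eq_zero_of_projV x (by simpa using hx) h
  | one => exact D.eq_zero_of_projL x (by simpa using hx) h
  | more k _ ih =>
    have e : ((k + 2 : ℕ) : ℤ) - 1 = (k : ℤ) + 1 := by push_cast; ring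
    rw [e] at hx
    refine D.transitive k x hx fun v => ih _ ?_ (LinearMap.congr_fun h v)
    have := D.bracket_inc_mem _ x v hx
    convert this using 2
    push_cast; ring

/-- Injectivity is transitivity, applied in each degree. -/
theorem toFamily_injective : Function.Injective D.toFamily := by
  rw [← LinearMap.ker_eq_bot, LinearMap.ker_eq_bot']
  intro x hx
  have hmem : x ∈ ⨆ k : ℕ, 𝒢 ((k : ℤ) - 1) := by rw [D.iSup_eq_top]; trivial
  obtain ⟨f, hf, rfl⟩ := (Submodule.mem_iSup_iff_exists_finsupp _ _).1 hmem
  refine Finset.sum_eq_zero fun k _ => ?_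
  refine D.eq_zero_of_toLevel k _ (hf k) ?_
  have h := congrFun hx k
  change D.toLevel k (f.sum fun _ x => x) = 0 at h
  rw [Finsupp.sum, map_sum, Finset.sum_eq_single k] at h
  · exact h
  · intro j _ hj
    exact D.toLevel_eq_zero k _ _ (hf j) (by omega)
  · intro hk
    rw [Finsupp.notMem_support_iff.1 hk, map_zero]

theorem toFamily_mem (d : ℤ) (x : g) (hx : x ∈ 𝒢 d) : D.toFamily x ∈ prolongDegree ρ d := by
  have h : ∀ k : ℕ, D.toFamily x k ≠ 0 → (k : ℤ) - 1 = d := by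
    intro k hk
    by_contra h
    exact hk (D.toLevel_eq_zero k d x hx (Ne.symm h))
  refine ⟨⟨fun k => D.toLevel_mem k x, ?_⟩, h⟩
  refine (Set.finite_singleton (d + 1).toNat).subset fun k hk => ?_
  have := h k hk
  simp only [Set.mem_singleton_iff]
  omega

/-- If every element of positive degree of the Cartan prolong comes from an element of `g`, then `g`
is the Cartan prolong. -/
theorem isCartanProlong
    (hsurj : ∀ k : ℕ, ∀ X ∈ component ρ (k + 2), ∃ x ∈ 𝒢 ((k : ℤ) + 1), D.toLevel (k + 2) x = X) :
    IsCartanProlong g 𝒢 ρ := by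
  have surj : ∀ k : ℕ, ∀ X ∈ component ρ k, ∃ x ∈ 𝒢 ((k : ℤ) - 1), D.toLevel k x = X := by
    intro k X hX
    match k, X, hX with
    | 0, X, _ => exact ⟨D.inc X, by simpa using D.inc_mem X, D.projV_inc X⟩
    | 1, X, _ =>
      obtain ⟨x, hx, h⟩ := D.projL_surj X
      exact ⟨x, by simpa using hx, h⟩
    | k + 2, X, hX =>
      obtain ⟨x, hx, h⟩ := hsurj k X hX
      refine ⟨x, ?_, h⟩
      convert hx using 2
      push_cast; ring
  have lift : ∀ k : ℕ, ∀ F ∈ prolong ρ, ∃ x ∈ 𝒢 ((k : ℤ) - 1),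
      D.toFamily x = Pi.single (M := fun k => level ρ k) k (F k) := by
    intro k F hF
    obtain ⟨x, hx, h⟩ := surj k (F k) (hF.1 k)
    refine ⟨x, hx, funext fun j => ?_⟩
    by_cases hj : j = k
    · subst hj
      rw [Pi.single_eq_same]; exact h
    · rw [Pi.single_eq_of_ne hj]
      exact D.toLevel_eq_zero j _ x hx (by omega)
  refine ⟨D.toFamily, D.toFamily_injective, ?_, D.famPar_toFamily,
    fun x y => funext fun k => D.bracketAt_toFamily k x y, fun d x => ⟨D.toFamily_mem d x, ?_⟩⟩
  · apply le_antisymm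
    · rw [LinearMap.range_eq_map, ← D.iSup_eq_top, Submodule.map_iSup, iSup_le_iff]
      rintro k _ ⟨x, hx, rfl⟩
      exact (D.toFamily_mem _ x hx).1
    · intro F hF
      have e : F = ∑ k ∈ hF.2.toFinset, Pi.single (M := fun k => level ρ k) k (F k) := by
        funext j
        rw [Finset.sum_apply]
        by_cases hj : F j = 0
        · rw [hj, Finset.sum_eq_zero]
          intro k _
          by_cases hjk : j = k
          · subst hjk; rw [Pi.single_eq_same, hj]
          · rw [Pi.single_eq_of_ne hjk]
        · rw [Finset.sum_eq_single j, Pi.single_eq_same]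
          · intro k _ hk
            rw [Pi.single_eq_of_ne (Ne.symm hk)]
          · intro h; simp [hj] at h
      rw [e]
      refine Submodule.sum_mem _ fun k _ => ?_
      obtain ⟨x, _, h⟩ := lift k F hF
      exact ⟨x, h⟩
  · rintro ⟨hx, hd⟩
    by_cases h : ∃ k : ℕ, (k : ℤ) - 1 = d
    · obtain ⟨k, rfl⟩ := h
      obtain ⟨y, hy, h⟩ := lift k _ hx
      have : x = y := by
        apply D.toFamily_injective
        rw [h]
        funext j
        by_cases hj : j = k
        · subst hj; rw [Pi.single_eq_same]
        · rw [Pi.single_eq_of_ne hj]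
          by_contra hne
          have := hd j hne
          omega
      rw [this]; exact hy
    · have : x = 0 := by
        apply D.toFamily_injective
        rw [map_zero]
        funext k
        by_contra hne
        exact h ⟨k, hd k hne⟩
      rw [this]; exact (𝒢 d).zero_mem

end LocalPart

/-- Once a component of positive degree vanishes, so do all the following ones. -/
theorem component_eq_bot_of_le {m n : ℕ} (h : component ρ (m + 2) = ⊥) (hmn : m ≤ n) :
    component ρ (n + 2) = ⊥ := by
  induction n, hmn using Nat.le_induction with
  | base => exact h
  | succ n _ ih =>
    rw [eq_bot_iff]
    intro X hX
    refine LinearMap.ext fun v => ?_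
    have := hX.1 v
    rw [ih] at this
    exact this

theorem isTrivialProlong_of_component (h : component ρ 2 = ⊥) : IsTrivialProlong ρ := by
  intro F
  constructor
  · intro hF k
    have := hF.1 (k + 2)
    rw [component_eq_bot_of_le h (Nat.zero_le k)] at this
    exact this
  · intro hF
    refine ⟨fun k => ?_, (Set.finite_Iio 2).subset fun k hk => ?_⟩
    · match k with
      | 0 => trivial
      | 1 => trivial
      | k + 2 => rw [hF k]; exact Submodule.zero_mem _
    · match k, hk with
      | 0, _ => simp
      | 1, _ => simp
      | k + 2, hk => exact absurd (hF k) hk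

end LocalParts

/-! ### Transport of gradings along changes of basis -/

section Transport

theorem IsCartanProlong.of_equiv {L : LieSuperalgebra} {V : SuperSpace} {ρ : SuperModule L V}
    {g g' : LieSuperalgebra} {𝒢 : ℤ → Submodule ℂ g} {𝒢' : ℤ → Submodule ℂ g'}
    (e : g ≃ₗ[ℂ] g') (hpar : ∀ x, e (g.par x) = g'.par (e x))
    (hbr : ∀ x y, e (g.bracket x y) = g'.bracket (e x) (e y))
    (hdeg : ∀ d x, x ∈ 𝒢 d ↔ e x ∈ 𝒢' d) (h : IsCartanProlong g' 𝒢' ρ) :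
    IsCartanProlong g 𝒢 ρ := by
  obtain ⟨Φ, h1, h2, h3, h4, h5⟩ := h
  refine ⟨Φ ∘ₗ e.toLinearMap, h1.comp e.injective, ?_, fun x => ?_, fun x y => ?_, fun d x => ?_⟩
  · rw [LinearMap.range_comp, LinearEquiv.range, Submodule.map_top, h2]
  · change Φ (e (g.par x)) = famPar ρ (Φ (e x))
    rw [hpar, h3]
  · change Φ (e (g.bracket x y)) = famBracket ρ (Φ (e x)) (Φ (e y))
    rw [hbr, h4]
  · exact (hdeg d x).trans (h5 d (e x))

variable {ι κ : Type} [Fintype ι] [Fintype κ]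

/-- The supercommutator in terms of matrix products and the parity operator, from which its
behaviour under conjugation is clear. -/
theorem superComm_eq (p : ι → ZMod 2) (X Y : Matrix ι ι ℂ) :
    superComm p X Y =
      X * Y - (1 / 2 : ℂ) • (Y * (X + matPar p X) + matPar p Y * (X - matPar p X)) := by
  ext i j
  simp only [superComm, Matrix.of_apply, Matrix.sub_apply, Matrix.smul_apply, Matrix.add_apply,
    Matrix.mul_apply, smul_eq_mul, ← Finset.sum_add_distrib, Finset.mul_sum,
    ← Finset.sum_sub_distrib]
  refine Finset.sum_congr rfl fun k _ => ?_
  change _ = _ - 1 / 2 * (Y i k * (X k j + sgn (p k + p j) * X k j) +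
    sgn (p i + p k) * Y i k * (X k j - sgn (p k + p j) * X k j))
  rcases parity_zero_or_one (p i + p k) with h | h <;>
  rcases parity_zero_or_one (p k + p j) with h' | h' <;>
  simp only [h, h', mul_zero, mul_one, sgn_zero, sgn_one] <;> ring

/-- A rectangular matrix is even if its nonzero entries join indices of the same parity. -/
def IsEven (p : ι → ZMod 2) (q : κ → ZMod 2) (P : Matrix ι κ ℂ) : Prop :=
  ∀ i a, P i a = 0 ∨ p i = q a

variable {p : ι → ZMod 2} {q : κ → ZMod 2} {P : Matrix ι κ ℂ} {Q : Matrix κ ι ℂ}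

theorem matPar_conj (hP : IsEven p q P) (hQ : IsEven q p Q) (X : Matrix ι ι ℂ) :
    matPar q (Q * X * P) = Q * matPar p X * P := by
  ext a b
  change sgn (q a + q b) * (Q * X * P) a b = _
  simp only [Matrix.mul_apply, Finset.mul_sum, Finset.sum_mul]
  refine Finset.sum_congr rfl fun i _ => Finset.sum_congr rfl fun j _ => ?_
  change _ = Q a j * (sgn (p j + p i) * X j i) * P i b
  rcases hP i b with h | h
  · simp [h]
  rcases hQ a j with h' | h'
  · simp [h']
  rw [h, h']; ring

theorem superComm_conj [DecidableEq ι] (hP : IsEven p q P) (hQ : IsEven q p Q) (hPQ : P * Q = 1)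
    (X Y : Matrix ι ι ℂ) :
    superComm q (Q * X * P) (Q * Y * P) = Q * superComm p X Y * P := by
  have e : ∀ A B : Matrix ι ι ℂ, Q * A * P * (Q * B * P) = Q * (A * B) * P := by
    intro A B
    calc Q * A * P * (Q * B * P) = Q * A * (P * Q) * B * P := by simp only [Matrix.mul_assoc]
      _ = _ := by rw [hPQ, Matrix.mul_one]; simp only [Matrix.mul_assoc]
  rw [superComm_eq, superComm_eq, matPar_conj hP hQ, matPar_conj hP hQ]
  simp only [← Matrix.mul_add, ← Matrix.add_mul, ← Matrix.mul_sub, ← Matrix.sub_mul, e]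
  rw [Matrix.mul_sub Q (X * Y), Matrix.sub_mul, Matrix.mul_smul, Matrix.smul_mul]

theorem supertranspose_conj (hP : IsEven p q P) (hQ : IsEven q p Q) (X : Matrix ι ι ℂ) :
    supertranspose q (Q * X * P) = Pᵀ * supertranspose p X * Qᵀ := by
  ext a b
  rw [supertranspose_apply]
  simp only [Matrix.mul_apply, Finset.mul_sum, Finset.sum_mul, Matrix.transpose_apply,
    supertranspose_apply]
  rw [Finset.sum_comm]
  refine Finset.sum_congr rfl fun i _ => Finset.sum_congr rfl fun j _ => ?_
  rcases hP j a with h | h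
  · simp [h]
  rcases hQ b i with h' | h'
  · simp [h']
  rw [h, h']; ring

/-- The Lie superalgebra of the supermatrices that preserve the even bilinear form `B`. -/
def autLie (p : ι → ZMod 2) (B : Matrix ι ι ℂ) (hB : (matSpace p).Homog 0 B) : LieSuperalgebra :=
  glSub p (autSub p B) (autSub_par p B hB) (autSub_bracket p B hB)

/-- The eigenspace of eigenvalue `d` of the grading element `h`. -/
def autDegree (p : ι → ZMod 2) (B : Matrix ι ι ℂ) (hB : (matSpace p).Homog 0 B)
    (h : Matrix ι ι ℂ) (d : ℤ) : Submodule ℂ (autLie p B hB) :=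
  Submodule.comap (autSub p B).subtype (LinearMap.ker (superCommL p h - (d : ℂ) • LinearMap.id))

/-- The matrices of degree `d` for the grading that gives `E_{ij}` the degree `m i - m j`. -/
def weightDegree (p : ι → ZMod 2) (B : Matrix ι ι ℂ) (hB : (matSpace p).Homog 0 B)
    (m : ι → ℤ) (d : ℤ) : Submodule ℂ (autLie p B hB) :=
  Submodule.comap (autSub p B).subtype
    { carrier := {X : Matrix ι ι ℂ | ∀ i j, X i j = 0 ∨ m i - m j = d}
      add_mem' := by
        intro X Y hX hY i j
        rcases hX i j with h | h
        · rcases hY i j with h' | h'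
          · left; simp [h, h']
          · exact Or.inr h'
        · exact Or.inr h
      zero_mem' := fun i j => Or.inl rfl
      smul_mem' := by
        intro c X hX i j
        rcases hX i j with h | h
        · left; simp [h]
        · exact Or.inr h }

theorem mem_autSub {p : ι → ZMod 2} {B X : Matrix ι ι ℂ} :
    X ∈ autSub p B ↔ supertranspose p X * B + B * X = 0 := Iff.rfl

theorem superComm_diagonal [DecidableEq ι] (p : ι → ZMod 2) (w : ι → ℂ) (X : Matrix ι ι ℂ) (i j :
    ι) :
    superComm p (Matrix.diagonal w) X i j = (w i - w j) * X i j := by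
  simp only [superComm, Matrix.of_apply, Finset.sum_sub_distrib]
  rw [Finset.sum_eq_single i (fun k _ hk => by rw [Matrix.diagonal_apply_ne' _ hk, zero_mul])
    (by simp), Finset.sum_eq_single j (fun k _ hk => by rw [Matrix.diagonal_apply_ne _ hk]; simp)
    (by simp)]
  simp [CharTwo.add_self_eq_zero, sgn_zero]
  ring

theorem autSub_conj {B : Matrix ι ι ℂ} [DecidableEq ι] (hP : IsEven p q P) (hQ : IsEven q p Q)
    (hPQ : P * Q = 1) {X : Matrix ι ι ℂ} (hX : X ∈ autSub p B) :
    Q * X * P ∈ autSub q (Pᵀ * B * P) := by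
  have hX' := mem_autSub.1 hX
  rw [mem_autSub, supertranspose_conj hP hQ]
  have e : Qᵀ * Pᵀ = 1 := by rw [← Matrix.transpose_mul, hPQ, Matrix.transpose_one]
  calc Pᵀ * supertranspose p X * Qᵀ * (Pᵀ * B * P) + Pᵀ * B * P * (Q * X * P)
      = Pᵀ * supertranspose p X * (Qᵀ * Pᵀ) * B * P + Pᵀ * B * (P * Q) * X * P := by
        simp only [Matrix.mul_assoc]
    _ = Pᵀ * (supertranspose p X * B + B * X) * P := by
        rw [e, hPQ]
        simp only [Matrix.mul_one, Matrix.mul_add, Matrix.add_mul, Matrix.mul_assoc]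
    _ = 0 := by rw [hX']; simp

/-- A change of basis `P` that carries the form `B` to `B'` and diagonalizes the grading element `h`
reduces the claim for `(B, h)` to that for `B'` and the weights `m`. Since only differences of
weights matter, the eigenvalues of `h` may be shifted by a constant `c` to make them integral. -/
theorem IsCartanProlong.of_conj [DecidableEq ι] [DecidableEq κ]
    {L : LieSuperalgebra} {V : SuperSpace} {ρ : SuperModule L V}
    (hP : IsEven p q P) (hQ : IsEven q p Q) (hPQ : P * Q = 1) (hQP : Q * P = 1)
    {B : Matrix ι ι ℂ} {B' : Matrix κ κ ℂ} (hB : (matSpace p).Homog 0 B)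
    (hB' : (matSpace q).Homog 0 B') (hBB' : Pᵀ * B * P = B') {h : Matrix ι ι ℂ} {m : κ → ℤ} (c : ℂ)
    (hh : h * P = P * Matrix.diagonal fun i => (m i : ℂ) - c)
    (H : IsCartanProlong (autLie q B' hB') (weightDegree q B' hB' m) ρ) :
    IsCartanProlong (autLie p B hB) (autDegree p B hB h) ρ := by
  have hBB : Qᵀ * B' * Q = B := by
    have e : Qᵀ * Pᵀ = 1 := by rw [← Matrix.transpose_mul, hPQ, Matrix.transpose_one]
    calc Qᵀ * B' * Q = (Qᵀ * Pᵀ) * B * (P * Q) := by rw [← hBB']; simp only [Matrix.mul_assoc]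
      _ = B := by rw [e, hPQ, Matrix.one_mul, Matrix.mul_one]
  have inv : ∀ X : Matrix ι ι ℂ, P * (Q * X * P) * Q = X := by
    intro X
    calc P * (Q * X * P) * Q = (P * Q) * X * (P * Q) := by simp only [Matrix.mul_assoc]
      _ = X := by rw [hPQ, Matrix.one_mul, Matrix.mul_one]
  have inv' : ∀ X : Matrix κ κ ℂ, Q * (P * X * Q) * P = X := by
    intro X
    calc Q * (P * X * Q) * P = (Q * P) * X * (Q * P) := by simp only [Matrix.mul_assoc]
      _ = X := by rw [hQP, Matrix.one_mul, Matrix.mul_one]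
  let e : autSub p B ≃ₗ[ℂ] autSub q B' :=
    { toFun := fun X => ⟨Q * X.1 * P, by rw [← hBB']; exact autSub_conj hP hQ hPQ X.2⟩
      invFun := fun X => ⟨P * X.1 * Q, by rw [← hBB]; exact autSub_conj hQ hP hQP X.2⟩
      map_add' := fun X Y => Subtype.ext (by
        change Q * (X.1 + Y.1) * P = Q * X.1 * P + Q * Y.1 * P
        rw [Matrix.mul_add, Matrix.add_mul])
      map_smul' := fun c X => Subtype.ext (by
        change Q * (c • X.1) * P = c • (Q * X.1 * P)
        rw [Matrix.mul_smul, Matrix.smul_mul])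
      left_inv := fun X => Subtype.ext (inv X.1)
      right_inv := fun X => Subtype.ext (inv' X.1) }
  have hd : Q * h * P = Matrix.diagonal fun i => (m i : ℂ) - c := by
    rw [Matrix.mul_assoc, hh, ← Matrix.mul_assoc, hQP, Matrix.one_mul]
  suffices key : ∀ (d : ℤ) (X : Matrix ι ι ℂ), superComm p h X - (d : ℂ) • X = 0 ↔
      ∀ i j, (Q * X * P) i j = 0 ∨ m i - m j = d from
    IsCartanProlong.of_equiv (g := autLie p B hB) (g' := autLie q B' hB')
      (𝒢' := weightDegree q B' hB' m) e
      (fun X => Subtype.ext (matPar_conj hP hQ X.1).symm)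
      (fun X Y => Subtype.ext (superComm_conj hP hQ hPQ X.1 Y.1).symm) (fun d X => key d X.1) H
  intro d X
  have h1 : superComm p h X - (d : ℂ) • X = 0 ↔
      superComm q (Q * h * P) (Q * X * P) - (d : ℂ) • (Q * X * P) = 0 := by
    rw [superComm_conj hP hQ hPQ]
    constructor
    · intro h0
      rw [← Matrix.smul_mul, ← Matrix.mul_smul, ← Matrix.sub_mul, ← Matrix.mul_sub, h0]
      simp
    · intro h0
      rw [← Matrix.smul_mul, ← Matrix.mul_smul, ← Matrix.sub_mul, ← Matrix.mul_sub] at h0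
      rw [← inv (superComm p h X - (d : ℂ) • X), h0]
      simp
  rw [h1, hd, ← Matrix.ext_iff]
  refine forall_congr' fun i => forall_congr' fun j => ?_
  rw [Matrix.sub_apply, superComm_diagonal, Matrix.smul_apply, smul_eq_mul, ← sub_mul,
    Matrix.zero_apply, mul_eq_zero, or_comm]
  refine or_congr Iff.rfl ?_
  rw [sub_eq_zero, ← Int.cast_inj (α := ℂ)]
  push_cast
  rw [sub_sub_sub_cancel_right]

/-- The part of degree `d` of a matrix. -/
def maskDegree (m : ι → ℤ) (d : ℤ) (X : Matrix ι ι ℂ) : Matrix ι ι ℂ :=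
  Matrix.of fun i j => if m i - m j = d then X i j else 0

/-- If `B` is homogeneous for the weights `m`, the homogeneous parts of a matrix preserving `B`
preserve it too. -/
theorem maskDegree_mem {B : Matrix ι ι ℂ} {m : ι → ℤ} {c : ℤ}
    (hm : ∀ i j, B i j = 0 ∨ m i + m j = c) (d : ℤ) {X : Matrix ι ι ℂ} (hX : X ∈ autSub p B) :
    maskDegree m d X ∈ autSub p B := by
  rw [mem_autSub] at hX ⊢
  ext i j
  have h := congrFun (congrFun hX i) j
  simp only [Matrix.add_apply, Matrix.mul_apply, supertranspose_apply, maskDegree,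
    Matrix.of_apply, Matrix.zero_apply] at h ⊢
  have e1 : ∀ k, sgn ((p i + p k) * (p i + (p k + p i))) * (if m k - m i = d then X k i else 0) *
      B k j = (if c - m i - m j = d then 1 else 0) *
        (sgn ((p i + p k) * (p i + (p k + p i))) * X k i * B k j) := by
    intro k
    rcases hm k j with h0 | h0
    · simp [h0]
    · rw [show m k - m i = c - m i - m j by omega]
      split_ifs <;> ring
  have e2 : ∀ k, B i k * (if m k - m j = d then X k j else 0) =
      (if c - m i - m j = d then 1 else 0) * (B i k * X k j) := by
    intro k
    rcases hm i k with h0 | h0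
    · simp [h0]
    · rw [show m k - m j = c - m i - m j by omega]
      split_ifs <;> ring
  rw [Finset.sum_congr rfl fun k _ => e1 k, Finset.sum_congr rfl fun k _ => e2 k,
    ← Finset.mul_sum, ← Finset.mul_sum, ← mul_add, h, mul_zero]

/-- A grading with degrees `-1`, `0`, `1` only is exhausted by its homogeneous components. -/
theorem iSup_weightDegree {B : Matrix ι ι ℂ} (hB : (matSpace p).Homog 0 B) {m : ι → ℤ} {c : ℤ}
    (hm : ∀ i j, B i j = 0 ∨ m i + m j = c)
    (hdeg : ∀ X ∈ autSub p B, ∀ i j, X i j = 0 ∨ (-1 ≤ m i - m j ∧ m i - m j ≤ 1)) :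
    ⨆ k : ℕ, weightDegree p B hB m ((k : ℤ) - 1) = ⊤ := by
  rw [eq_top_iff]
  rintro ⟨X, hX⟩ -
  have e : (⟨X, hX⟩ : autSub p B) = ∑ k ∈ Finset.range 3,
      ⟨maskDegree m ((k : ℤ) - 1) X, maskDegree_mem hm _ hX⟩ := by
    refine Subtype.ext ?_
    rw [AddSubmonoidClass.coe_finsetSum]
    ext i j
    simp only [Finset.sum_range_succ, Finset.sum_range_zero, zero_add, Matrix.add_apply,
      maskDegree, Matrix.of_apply]
    rcases hdeg X hX i j with h | ⟨h1, h2⟩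
    · simp [h]
    · have h3 : m i - m j = -1 ∨ m i - m j = 0 ∨ m i - m j = 1 := by omega
      rcases h3 with h | h | h <;> simp [h]
  refine (congrArg (· ∈ ⨆ k : ℕ, weightDegree p B hB m ((k : ℤ) - 1)) e).mpr ?_
  refine Submodule.sum_mem _ fun k _ => Submodule.mem_iSup_of_mem k ?_
  intro i j
  change (if m i - m j = _ then X i j else 0) = 0 ∨ _
  split_ifs with h
  · exact Or.inr h
  · exact Or.inl rfl

theorem mem_autSub_apply {ι : Type} [Fintype ι] {p : ι → ZMod 2} {B X : Matrix ι ι ℂ} :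
    X ∈ autSub p B ↔
      ∀ i j, ∑ k, sgn ((p i + p k) * p k) * X k i * B k j + ∑ k, B i k * X k j = 0 := by
  rw [mem_autSub, ← Matrix.ext_iff]
  refine forall_congr' fun i => forall_congr' fun j => ?_
  have h : ∀ x y : ZMod 2, (x + y) * (x + (y + x)) = (x + y) * y := by decide
  simp only [Matrix.add_apply, Matrix.mul_apply, supertranspose_apply, Matrix.zero_apply, h]

theorem superComm_mem_weightDegree {ι : Type} [Fintype ι] {p : ι → ZMod 2} {B : Matrix ι ι ℂ}
    {hB : (matSpace p).Homog 0 B} {m : ι → ℤ} {d e : ℤ} {X Y : autLie p B hB}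
    (hX : X ∈ weightDegree p B hB m d) (hY : Y ∈ weightDegree p B hB m e) :
    (autLie p B hB).bracket X Y ∈ weightDegree p B hB m (d + e) := by
  intro i j
  by_cases h : m i - m j = d + e
  · exact Or.inr h
  left
  refine Finset.sum_eq_zero fun k _ => ?_
  have z : ∀ {d e : ℤ} {X Y : autLie p B hB}, X ∈ weightDegree p B hB m d →
      Y ∈ weightDegree p B hB m e → ¬ m i - m j = d + e → X.1 i k * Y.1 k j = 0 := by
    intro d e X Y hX hY h
    rcases hX i k with h1 | h1
    · exact mul_eq_zero_of_left h1 _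
    rcases hY k j with h2 | h2
    · exact mul_eq_zero_of_right _ h2
    · exact absurd (by omega) h
  refine sub_eq_zero.2 ?_
  rw [z hX hY h]
  refine (mul_eq_zero_of_right _ (z hY hX ?_)).symm
  rwa [add_comm]

end Transport

/-! ### Orthosymplectic Lie superalgebras graded by an isotropic line -/

section Quadric

variable {I : Type} [Fintype I] [DecidableEq I]

/-- The parities of the sum of an even hyperbolic plane and a superspace with parities `q`. -/
def hypParity (q : I → ZMod 2) : Fin 2 ⊕ I → ZMod 2 := Sum.elim (fun _ => 0) q

/-- The orthogonal sum of the hyperbolic plane and the form `G`. -/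
def hypForm (G : Matrix I I ℂ) : Matrix (Fin 2 ⊕ I) (Fin 2 ⊕ I) ℂ :=
  Matrix.fromBlocks !![0, 1; 1, 0] 0 0 G

/-- The weights `1`, `-1` on the isotropic basis of the hyperbolic plane, and `0` on its complement.
-/
def hypWeight : Fin 2 ⊕ I → ℤ := Sum.elim ![1, -1] fun _ => 0

theorem hypForm_even {q : I → ZMod 2} {G : Matrix I I ℂ} (hG : (matSpace q).Homog 0 G) :
    (matSpace (hypParity q)).Homog 0 (hypForm G) := by
  rw [homog_matSpace] at hG ⊢
  rintro (i | i) (j | j)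
  · simp [hypParity]
  · simp [hypForm]
  · simp [hypForm]
  · exact hG i j

/-- `G` is the matrix of an even nondegenerate supersymmetric bilinear form. -/
structure IsSuperForm (q : I → ZMod 2) (G : Matrix I I ℂ) : Prop where
  even : (matSpace q).Homog 0 G
  symm : ∀ i j, G i j = sgn (q j) * G j i
  unit : IsUnit G

variable {q : I → ZMod 2} {G : Matrix I I ℂ}

theorem IsSuperForm.eq_zero_or (hG : IsSuperForm q G) (i j : I) : G i j = 0 ∨ q i = q j := by
  rcases parity_eq_of_homog hG.even i j with h | h
  · exact Or.inl h
  · exact Or.inr (by revert h; generalize q i = x; generalize q j = y; revert x y; decide)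

theorem IsSuperForm.eq_zero_of_mulVec (hG : IsSuperForm q G) {w : I → ℂ} (h : G *ᵥ w = 0) :
    w = 0 := by
  have := Matrix.mulVec_injective_of_isUnit hG.unit
  exact this (by rw [h, Matrix.mulVec_zero])

theorem IsSuperForm.exists_mulVec (hG : IsSuperForm q G) (a : I → ℂ) : ∃ w, G *ᵥ w = a := by
  refine ⟨G⁻¹ *ᵥ a, ?_⟩
  rw [Matrix.mulVec_mulVec, Matrix.mul_nonsing_inv _ ((Matrix.isUnit_iff_isUnit_det G).1 hG.unit),
    Matrix.one_mulVec]

theorem IsSuperForm.mulVec_sgn (hG : IsSuperForm q G) (w : I → ℂ) (i : I) :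
    (G *ᵥ fun k => sgn (q k) * w k) i = sgn (q i) * (G *ᵥ w) i := by
  simp only [Matrix.mulVec, dotProduct, Finset.mul_sum]
  refine Finset.sum_congr rfl fun k _ => ?_
  rcases hG.eq_zero_or i k with h | h
  · simp [h]
  · rw [h]; ring

theorem IsSuperForm.mulVec_eq (hG : IsSuperForm q G) (w : I → ℂ) (j : I) :
    ∑ k, sgn (q k) * w k * G k j = (G *ᵥ w) j := by
  simp only [Matrix.mulVec, dotProduct]
  refine Finset.sum_congr rfl fun k _ => ?_
  rw [hG.symm j k]; ring

/-- A matrix preserving the sum of the hyperbolic plane and `G` is determined by its columns in the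
direction of the plane, one scalar and a matrix preserving `G`. -/
theorem mem_autSub_hypForm {X : Matrix (Fin 2 ⊕ I) (Fin 2 ⊕ I) ℂ} (hG : IsSuperForm q G) :
    X ∈ autSub (hypParity q) (hypForm G) ↔
      (X (.inl 1) (.inl 0) = 0 ∧ X (.inl 0) (.inl 1) = 0 ∧
        X (.inl 1) (.inl 1) = -X (.inl 0) (.inl 0)) ∧
      (∀ j, X (.inl 1) (.inr j) = -(G *ᵥ fun k => X (.inr k) (.inl 0)) j) ∧
      (∀ j, X (.inl 0) (.inr j) = -(G *ᵥ fun k => X (.inr k) (.inl 1)) j) ∧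
      (X.submatrix Sum.inr Sum.inr) ∈ autSub q G := by
  rw [mem_autSub_apply, mem_autSub_apply]
  have e : ∀ s j, ∑ k, sgn ((0 + q k) * q k) * X (.inr k) (.inl s) * G k j =
      (G *ᵥ fun k => X (.inr k) (.inl s)) j := by
    intro s j
    rw [← hG.mulVec_eq]
    refine Finset.sum_congr rfl fun k _ => ?_
    rcases parity_zero_or_one (q k) with h | h <;> simp [h]
  have e' : ∀ s j, ∑ k, G j k * X (.inr k) (.inl s) =
      (G *ᵥ fun k => X (.inr k) (.inl s)) j := fun s j => rfl
  constructor
  · intro h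
    have h00 := h (.inl 0) (.inl 0)
    have h11 := h (.inl 1) (.inl 1)
    have h01 := h (.inl 0) (.inl 1)
    have h2 := fun j => h (.inl 0) (.inr j)
    have h3 := fun j => h (.inl 1) (.inr j)
    have h4 := fun i j => h (.inr i) (.inr j)
    simp [hypForm, hypParity, Fintype.sum_sum_type, Fin.sum_univ_two,
        sgn_zero] at h00 h11 h01 h2 h3 h4
    refine ⟨⟨h00, h11, ?_⟩, ?_, ?_, h4⟩
    · linear_combination h01
    · intro j
      rw [← e]
      simpa using eq_neg_of_add_eq_zero_right (h2 j)
    · intro j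
      rw [← e]
      simpa using eq_neg_of_add_eq_zero_right (h3 j)
  · rintro ⟨⟨h1, h2, h3⟩, h4, h5, h6⟩
    rintro (i | i) (j | j)
    · fin_cases i <;> fin_cases j <;>
      simp [hypForm, hypParity, Fintype.sum_sum_type, Fin.sum_univ_two, sgn_zero, h1, h2, h3]
    · fin_cases i <;>
      simp [hypForm, hypParity, Fintype.sum_sum_type, Fin.sum_univ_two, sgn_zero, h4, h5, ← e]
    · fin_cases j <;>
      simp [hypForm, hypParity, Fintype.sum_sum_type, Fin.sum_univ_two, sgn_zero, h4, h5, e']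
    · have := h6 i j
      simpa [hypForm, hypParity, Fintype.sum_sum_type, Fin.sum_univ_two, sgn_zero] using this

/-- The element of degree `-1` (for `s = 0`) or `1` (for `s = 1`) with column `v`. -/
def colElem (G : Matrix I I ℂ) (s : Fin 2) : (I → ℂ) →ₗ[ℂ] Matrix (Fin 2 ⊕ I) (Fin 2 ⊕ I) ℂ where
  toFun := fun v => Matrix.fromBlocks 0 (Matrix.of fun t j => if t = s then 0 else -(G *ᵥ v) j)
    (Matrix.of fun i t => if t = s then v i else 0) 0
  map_add' := by
    intro v w
    ext (i | i) (j | j) <;> simp [Matrix.mulVec_add] <;> split_ifs <;> ring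
  map_smul' := by
    intro c v
    ext (i | i) (j | j) <;> simp [Matrix.mulVec_smul]

theorem colElem_mem (hG : IsSuperForm q G) (s : Fin 2) (v : I → ℂ) :
    colElem G s v ∈ autSub (hypParity q) (hypForm G) := by
  rw [mem_autSub_hypForm hG]
  have z : (colElem G s v).submatrix Sum.inr Sum.inr = 0 := by
    ext i j; simp [colElem]
  rw [z]
  refine ⟨⟨?_, ?_, ?_⟩, ?_, ?_, Submodule.zero_mem _⟩ <;> fin_cases s <;>
    simp [colElem, Matrix.mulVec, dotProduct]

/-- The Lie superalgebra of supermatrices that preserve `G` up to an infinitesimal factor. -/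
def cautLie (q : I → ZMod 2) (G : Matrix I I ℂ) (hG : (matSpace q).Homog 0 G) : LieSuperalgebra :=
  glSub q (cautSub q G) (cautSub_par q G hG) (cautSub_bracket q G hG)

/-- The identity module of `cautLie`. -/
def cautId (q : I → ZMod 2) (G : Matrix I I ℂ) (hG : (matSpace q).Homog 0 G) :
    SuperModule (cautLie q G hG) (vecSpace q) :=
  glRestrict (idModule q) (cautSub q G) (cautSub_par q G hG) (cautSub_bracket q G hG)

/-- The action on degree `-1` of the component of degree `0` of a matrix: the element of `osp` in
its lower right block, minus the weight of the isotropic vector that spans the first column. -/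
def quadricBlock : Matrix (Fin 2 ⊕ I) (Fin 2 ⊕ I) ℂ →ₗ[ℂ] Matrix I I ℂ where
  toFun := fun X => X.submatrix Sum.inr Sum.inr - X (.inl 0) (.inl 0) • 1
  map_add' := by intro X Y; ext i j; simp; ring
  map_smul' := by intro c X; ext i j; simp; ring

theorem superComm_add_smul_one (X Y : Matrix I I ℂ) (c d : ℂ) :
    superComm q (X + c • 1) (Y + d • 1) = superComm q X Y := by
  change superCommL q (X + c • 1) (Y + d • 1) = superCommL q X Y
  simp [superComm_one, one_superComm]

theorem quadricBlock_mem (hG : IsSuperForm q G) {X : Matrix (Fin 2 ⊕ I) (Fin 2 ⊕ I) ℂ}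
    (hX : X ∈ autSub (hypParity q) (hypForm G)) : quadricBlock X ∈ cautSub q G := by
  change X.submatrix Sum.inr Sum.inr - X (.inl 0) (.inl 0) • (1 : Matrix I I ℂ) ∈ cautSub q G
  rw [sub_eq_add_neg, ← neg_smul]
  exact Submodule.add_mem_sup ((mem_autSub_hypForm hG).1 hX).2.2.2
    (Submodule.smul_mem _ _ (Submodule.mem_span_singleton_self 1))

theorem quadricBlock_superComm (hG : IsSuperForm q G) {X Y : Matrix (Fin 2 ⊕ I) (Fin 2 ⊕ I) ℂ}
    (hX : X ∈ autSub (hypParity q) (hypForm G)) (hY : Y ∈ autSub (hypParity q) (hypForm G))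
    (hX0 : ∀ i, X (.inr i) (.inl 0) = 0) (hY0 : ∀ i, Y (.inr i) (.inl 0) = 0) :
    quadricBlock (superComm (hypParity q) X Y) = superComm q (quadricBlock X) (quadricBlock Y) := by
  obtain ⟨⟨x1, x2, x3⟩, x4, x5, x6⟩ := (mem_autSub_hypForm hG).1 hX
  obtain ⟨⟨y1, y2, y3⟩, y4, y5, y6⟩ := (mem_autSub_hypForm hG).1 hY
  have x4' : ∀ j, X (.inl 1) (.inr j) = 0 := fun j => by
    rw [x4]; simp [hX0, Matrix.mulVec, dotProduct]
  have y4' : ∀ j, Y (.inl 1) (.inr j) = 0 := fun j => by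
    rw [y4]; simp [hY0, Matrix.mulVec, dotProduct]
  have e : ∀ Z : Matrix (Fin 2 ⊕ I) (Fin 2 ⊕ I) ℂ, quadricBlock Z =
      Z.submatrix Sum.inr Sum.inr + (-Z (.inl 0) (.inl 0)) • 1 := fun Z => by
    rw [neg_smul, ← sub_eq_add_neg]; rfl
  rw [e X, e Y, superComm_add_smul_one]
  ext i j
  rw [e]
  simp [superComm, Fintype.sum_sum_type, Fin.sum_univ_two, hypParity, hX0, hY0, x1, x2, x4', y1, y2,
    y4', sgn_zero, mul_comm]

theorem superComm_colElem_apply (X : Matrix (Fin 2 ⊕ I) (Fin 2 ⊕ I) ℂ) (v : I → ℂ) (i : I) :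
    superComm (hypParity q) X (colElem G 0 v) (.inr i) (.inl 0) = (quadricBlock X *ᵥ v) i := by
  simp [superComm, Fintype.sum_sum_type, Fin.sum_univ_two, hypParity, colElem, quadricBlock,
    Matrix.sub_mulVec, Matrix.smul_mulVec, Matrix.mulVec, dotProduct, sgn_zero]
  simp [Matrix.mulVec, dotProduct, Matrix.one_apply, mul_comm, mul_sub, Finset.sum_sub_distrib]

theorem superComm_apply_inl_zero_eq_zero (hG : IsSuperForm q G) {X Y : Matrix (Fin 2 ⊕ I) (Fin 2
    ⊕ I) ℂ}
    (hX : X ∈ autSub (hypParity q) (hypForm G)) (hY : Y ∈ autSub (hypParity q) (hypForm G))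
    (hX0 : ∀ i, X (.inr i) (.inl 0) = 0) (hY0 : ∀ i, Y (.inr i) (.inl 0) = 0) (i : I) :
    superComm (hypParity q) X Y (.inr i) (.inl 0) = 0 := by
  obtain ⟨⟨x1, x2, x3⟩, x4, x5, x6⟩ := (mem_autSub_hypForm hG).1 hX
  obtain ⟨⟨y1, y2, y3⟩, y4, y5, y6⟩ := (mem_autSub_hypForm hG).1 hY
  simp [superComm, Fintype.sum_sum_type, Fin.sum_univ_two, hypParity, hX0, hY0, x1, y1]

theorem colElem_superComm (hG : IsSuperForm q G) (v w : I → ℂ) :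
    superComm (hypParity q) (colElem G 0 v) (colElem G 0 w) = 0 := by
  have h := autSub_bracket (hypParity q) (hypForm G) (hypForm_even hG.even) _ (colElem_mem hG 0 v) _
    (colElem_mem hG 0 w)
  obtain ⟨⟨h1, -, -⟩, -⟩ := (mem_autSub_hypForm hG).1 h
  ext (i | i) (j | j)
  · fin_cases i <;> fin_cases j
    · simp [superComm, Fintype.sum_sum_type, Fin.sum_univ_two, colElem]
    · simp [superComm, Fintype.sum_sum_type, Fin.sum_univ_two, colElem]
    · exact h1
    · simp [superComm, Fintype.sum_sum_type, Fin.sum_univ_two, colElem]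
  · simp [superComm, Fintype.sum_sum_type, Fin.sum_univ_two, colElem]
  · simp [superComm, Fintype.sum_sum_type, Fin.sum_univ_two, colElem]
  · simp [superComm, Fintype.sum_sum_type, Fin.sum_univ_two, colElem]

theorem colElem_par (hG : IsSuperForm q G) (v : I → ℂ) :
    colElem G 0 (fun i => sgn (q i) * v i) = matPar (hypParity q) (colElem G 0 v) := by
  ext (i | i) (j | j)
  · simp [matPar, colElem]
  · simp only [colElem, matPar, LinearMap.coe_mk, AddHom.coe_mk, hG.mulVec_sgn]
    simp [hypParity]
  · simp [matPar, colElem, hypParity]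
  · simp [matPar, colElem]

/-- The bracket of the elements of degree `1` and `-1` given by `w` and `v`, as an operator on
degree `-1`. -/
theorem quadricBlock_col_col (v w : I → ℂ) (i j : I) :
    quadricBlock (superComm (hypParity q) (colElem G 1 w) (colElem G 0 v)) i j =
      (if i = j then ∑ k, (G *ᵥ w) k * v k else 0) - w i * (G *ᵥ v) j +
        sgn (q i * q j) * (v i * (G *ᵥ w) j) := by
  simp [superComm, Fintype.sum_sum_type, Fin.sum_univ_two, hypParity, colElem, quadricBlock,
    sgn_zero, Matrix.one_apply]
  ring

/-- A nonzero scalar matrix does not preserve a nonzero form, so that the sum of `osp` and the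
scalars is direct. -/
theorem eq_zero_of_smul_one_mem_autSub [Nonempty I] (hG : IsSuperForm q G) {c : ℂ}
    (h : c • (1 : Matrix I I ℂ) ∈ autSub q G) : c = 0 := by
  obtain ⟨i⟩ := ‹Nonempty I›
  by_contra hc
  have h' := mem_autSub.1 h
  have e : supertranspose q (c • (1 : Matrix I I ℂ)) = c • 1 := by
    ext i j
    rw [supertranspose_apply]
    by_cases hij : i = j
    · subst hij; simp [CharTwo.add_self_eq_zero, sgn_zero]
    · simp [Matrix.one_apply_ne hij, Matrix.one_apply_ne (Ne.symm hij)]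
  rw [e, Matrix.smul_mul, Matrix.mul_smul, Matrix.one_mul, Matrix.mul_one, ← two_smul ℂ,
      smul_smul] at h'
  have hG0 : G = 0 := (smul_eq_zero.1 h').resolve_left (mul_ne_zero two_ne_zero hc)
  have := hG.eq_zero_of_mulVec (w := fun _ => 1) (by rw [hG0, Matrix.zero_mulVec])
  exact one_ne_zero (congrFun this i)

/-- An element of `osp` vanishes if its coordinates from `mem_autSub_hypForm` do. -/
theorem quadric_ext (hG : IsSuperForm q G) {X : Matrix (Fin 2 ⊕ I) (Fin 2 ⊕ I) ℂ}
    (hX : X ∈ autSub (hypParity q) (hypForm G)) (h0 : ∀ i, X (.inr i) (.inl 0) = 0)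
    (h1 : ∀ i, X (.inr i) (.inl 1) = 0) (h2 : X (.inl 0) (.inl 0) = 0)
    (h3 : ∀ i j, X (.inr i) (.inr j) = 0) : X = 0 := by
  obtain ⟨⟨x1, x2, x3⟩, x4, x5, x6⟩ := (mem_autSub_hypForm hG).1 hX
  ext (i | i) (j | j)
  · fin_cases i <;> fin_cases j <;> simp [x1, x2, x3, h2]
  · fin_cases i
    · simp [x5, h1, Matrix.mulVec, dotProduct]
    · simp [x4, h0, Matrix.mulVec, dotProduct]
  · fin_cases j
    · simp [h0]
    · simp [h1]
  · simp [h3]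

theorem exists_of_mem_cautSub {A : Matrix I I ℂ} (hA : A ∈ cautSub q G) :
    ∃ Y : Matrix I I ℂ, Y ∈ autSub q G ∧ ∃ c : ℂ, Y + c • 1 = A := by
  obtain ⟨Y, hY, Z, hZ, h⟩ := Submodule.mem_sup.1 hA
  obtain ⟨c, rfl⟩ := Submodule.mem_span_singleton.1 hZ
  exact ⟨Y, hY, c, h⟩

theorem quadric_lift (hG : IsSuperForm q G) {A : Matrix I I ℂ} (hA : A ∈ cautSub q G) :
    ∃ X : Matrix (Fin 2 ⊕ I) (Fin 2 ⊕ I) ℂ, X ∈ autSub (hypParity q) (hypForm G) ∧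
      (∀ i j, X i j = 0 ∨ hypWeight i - hypWeight j = 0) ∧ quadricBlock X = A := by
  obtain ⟨Y, hY, c, rfl⟩ := exists_of_mem_cautSub hA
  refine ⟨Matrix.fromBlocks !![-c, 0; 0, c] 0 0 Y, ?_, ?_, ?_⟩
  · rw [mem_autSub_hypForm hG]
    refine ⟨⟨by simp, by simp, by simp⟩, fun j => ?_, fun j => ?_, hY⟩
    · simp [Matrix.mulVec, dotProduct]
    · simp [Matrix.mulVec, dotProduct]
  · rintro (i | i) (j | j)
    · fin_cases i <;> fin_cases j <;> simp [hypWeight]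
    · left; rfl
    · left; rfl
    · right; rfl
  · ext i j
    simp [quadricBlock]

/-- The grading of `osp` by the weights `1`, `-1`, `0` has `cosp` and its identity module in the
degrees `0` and `-1`. -/
def quadricLocalPart [Nonempty I] (hG : IsSuperForm q G) :
    LocalPart (autLie (hypParity q) (hypForm G) (hypForm_even hG.even))
      (weightDegree (hypParity q) (hypForm G) (hypForm_even hG.even) hypWeight)
      (cautId q G hG.even) where
  inc := (colElem G 0).codRestrict (autSub (hypParity q) (hypForm G)) (colElem_mem hG 0)
  projV :=
    { toFun := fun (X : autSub (hypParity q) (hypForm G)) i => X.1 (.inr i) (.inl 0)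
      map_add' := fun X Y => rfl
      map_smul' := fun c X => rfl }
  projL := (quadricBlock ∘ₗ (autSub (hypParity q) (hypForm G)).subtype).codRestrict (cautSub q G)
    fun X => quadricBlock_mem hG X.2
  inc_par := fun v => Subtype.ext (colElem_par hG v)
  projV_par := fun X => by
    funext i
    change sgn (q i + 0) * _ = sgn (q i) * _
    rw [add_zero]; rfl
  projL_par := fun X => by
    refine Subtype.ext (Matrix.ext fun i j => ?_)
    change sgn (q i + q j) * X.1 (.inr i) (.inr j) -
      sgn (0 + 0) * X.1 (.inl 0) (.inl 0) * (1 : Matrix I I ℂ) i j =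
        sgn (q i + q j) * (X.1 (.inr i) (.inr j) - X.1 (.inl 0) (.inl 0) * (1 : Matrix I I ℂ) i j)
    by_cases hij : i = j
    · subst hij; rw [CharTwo.add_self_eq_zero, add_zero, sgn_zero]; ring
    · rw [Matrix.one_apply_ne hij]; ring
  inc_comm := fun v w => Subtype.ext (colElem_superComm hG v w)
  projV_inc := fun v => by
    funext i
    change colElem G 0 v (.inr i) (.inl 0) = v i
    simp [colElem]
  projL_inc := fun v => by
    refine Subtype.ext (Matrix.ext fun i j => ?_)
    change quadricBlock (colElem G 0 v) i j = 0
    simp [colElem, quadricBlock]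
  projV_bracket_inc := fun X v => funext fun i => superComm_colElem_apply X.1 v i
  projV_bracket := fun X Y hX hY => funext fun i =>
    superComm_apply_inl_zero_eq_zero hG X.2 Y.2 (congrFun hX) (congrFun hY) i
  projL_bracket := fun X Y hX hY => Subtype.ext
    (quadricBlock_superComm hG X.2 Y.2 (congrFun hX) (congrFun hY))
  inc_mem := by
    rintro v (i | i) (j | j)
    · left; rfl
    · fin_cases i
      · left; rfl
      · right; rfl
    · fin_cases j
      · right; rfl
      · left; rfl
    · left; rfl
  bracket_inc_mem := fun d X v hX => superComm_mem_weightDegree hX (by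
    rintro (i | i) (j | j)
    · left; rfl
    · fin_cases i
      · left; rfl
      · right; rfl
    · fin_cases j
      · right; rfl
      · left; rfl
    · left; rfl)
  projV_eq_zero := fun d X hX hd => funext fun i =>
    (hX (.inr i) (.inl 0)).resolve_right (by simp [hypWeight]; omega)
  projL_eq_zero := fun d X hX hd => by
    refine Subtype.ext (Matrix.ext fun i j => ?_)
    change X.1 (.inr i) (.inr j) - X.1 (.inl 0) (.inl 0) * (1 : Matrix I I ℂ) i j = 0
    have h1 : X.1 (.inr i) (.inr j) = 0 :=
      (hX (.inr i) (.inr j)).resolve_right (by simp [hypWeight]; omega)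
    have h2 : X.1 (.inl 0) (.inl 0) = 0 :=
      (hX (.inl 0) (.inl 0)).resolve_right (by simp [hypWeight]; omega)
    simp only [h1, h2, zero_mul, sub_zero]
  iSup_eq_top := iSup_weightDegree _ (c := 0) (by
      rintro (i | i) (j | j)
      · fin_cases i <;> fin_cases j <;> simp [hypForm, hypWeight]
      · left; rfl
      · left; rfl
      · right; rfl) (by
      intro X hX
      obtain ⟨⟨x1, x2, -⟩, -⟩ := (mem_autSub_hypForm hG).1 hX
      rintro (i | i) (j | j)
      · fin_cases i <;> fin_cases j <;> simp [hypWeight, x1, x2]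
      · fin_cases i <;> simp [hypWeight]
      · fin_cases j <;> simp [hypWeight]
      · simp [hypWeight])
  eq_zero_of_projV := fun X hX h => Subtype.ext (quadric_ext hG X.2 (congrFun h)
    (fun i => (hX (.inr i) (.inl 1)).resolve_right (by simp [hypWeight]))
    ((hX (.inl 0) (.inl 0)).resolve_right (by simp [hypWeight]))
    fun i j => (hX (.inr i) (.inr j)).resolve_right (by simp [hypWeight]))
  eq_zero_of_projL := fun X hX h => by
    have h1 : X.1.submatrix Sum.inr Sum.inr = X.1 (.inl 0) (.inl 0) • (1 : Matrix I I ℂ) :=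
      sub_eq_zero.1 (congrArg Subtype.val h)
    have h2 := ((mem_autSub_hypForm hG).1 X.2).2.2.2
    rw [h1] at h2
    have h3 := eq_zero_of_smul_one_mem_autSub hG h2
    rw [h3, zero_smul] at h1
    exact Subtype.ext (quadric_ext hG X.2
      (fun i => (hX (.inr i) (.inl 0)).resolve_right (by simp [hypWeight]))
      (fun i => (hX (.inr i) (.inl 1)).resolve_right (by simp [hypWeight])) h3
      fun i j => congrFun (congrFun h1 i) j)
  transitive := fun k X hX h => by
    have h00 : X.1 (.inl 0) (.inl 0) = 0 :=
      (hX (.inl 0) (.inl 0)).resolve_right (by simp [hypWeight]; omega)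
    have hx := (mem_autSub_hypForm hG).1 X.2
    have h1 : (G *ᵥ fun k => X.1 (.inr k) (.inl 1)) = 0 := by
      funext j
      have := congrFun (congrFun (congrArg Subtype.val (h (Pi.single j 1))) (.inl 0)) (.inl 0)
      change superComm (hypParity q) X.1 (colElem G 0 (Pi.single j 1)) (.inl 0) (.inl 0) = 0 at this
      simp [superComm, Fintype.sum_sum_type, Fin.sum_univ_two, colElem, Pi.single_apply,
        h00] at this
      have h5 := hx.2.2.1 j
      rw [this] at h5
      simpa using h5.symm
    refine Subtype.ext (quadric_ext hG X.2
      (fun i => (hX (.inr i) (.inl 0)).resolve_right (by simp [hypWeight]; omega))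
      (congrFun (hG.eq_zero_of_mulVec h1)) h00
      fun i j => (hX (.inr i) (.inr j)).resolve_right (by simp [hypWeight]; omega))
  projL_surj := fun A => by
    obtain ⟨X, hX, hw, hA⟩ := quadric_lift hG A.2
    exact ⟨⟨X, hX⟩, hw, Subtype.ext hA⟩

theorem homog_single (q : I → ZMod 2) (i : I) :
    (vecSpace q).Homog (q i) (Pi.single i (1 : ℂ) : I → ℂ) := by
  funext j
  change sgn (q j) * (Pi.single i (1 : ℂ) : I → ℂ) j = sgn (q i) * (Pi.single i (1 : ℂ) : I → ℂ) j
  by_cases h : j = i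
  · rw [h]
  · rw [Pi.single_eq_of_ne h]; simp

theorem vecSpace_ext {W : Type} [AddCommGroup W] [Module ℂ W] {f f' : vecSpace q →ₗ[ℂ] W}
    (h : ∀ i, f (Pi.single i (1 : ℂ) : I → ℂ) = f' (Pi.single i (1 : ℂ) : I → ℂ)) : f = f' :=
  LinearMap.pi_ext' (R := ℂ) (φ := fun _ : I => ℂ) (f := f) (g := f')
    fun i => LinearMap.ext_ring (h i)

/-- The first prolong of `osp` vanishes: the trilinear form `⟨e_i, A_l e_j⟩` is super-antisymmetric
in `i, j` and supersymmetric in `l, j`. -/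
theorem osp_tensor_eq_zero (hG : IsSuperForm q G) (A : I → Matrix I I ℂ)
    (hA : ∀ l, A l ∈ autSub q G)
    (hs : ∀ l i j, A l i j = sgn (q l * q j) * A j i l) (l : I) : A l = 0 := by
  set C : I → Matrix I I ℂ := fun l => G * A l with hC
  -- `C l i j = ⟨e_i, A_l e_j⟩`
  have h1 : ∀ l i j, C l i j = -(sgn (q i * q j) * C l j i) := by
    intro l i j
    have h := mem_autSub_apply.1 (hA l) i j
    have e : ∑ k, sgn ((q i + q k) * q k) * A l k i * G k j = sgn (q i * q j) * C l j i := by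
      simp only [hC, Matrix.mul_apply, Finset.mul_sum]
      refine Finset.sum_congr rfl fun k _ => ?_
      rw [hG.symm j k]
      rcases hG.eq_zero_or k j with h0 | h0
      · simp [h0]
      · rw [h0]
        rcases parity_zero_or_one (q i) with hi | hi <;>
        rcases parity_zero_or_one (q j) with hj | hj <;>
        simp [hi, hj, sgn_zero, sgn_one, one_add_one_parity] <;> ring
    rw [e] at h
    exact eq_neg_of_add_eq_zero_right h
  have h2 : ∀ l i j, C l i j = sgn (q l * q j) * C j i l := by
    intro l i j
    simp only [hC, Matrix.mul_apply, Finset.mul_sum]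
    refine Finset.sum_congr rfl fun k _ => ?_
    rw [hs l k j]; ring
  have h3 : C l = 0 := by
    ext i j
    have e1 := h2 l i j
    have e2 := h1 j i l
    have e3 := h2 j l i
    have e4 := h1 i l j
    have e5 := h2 i j l
    have e6 := h1 l j i
    rw [Matrix.zero_apply]
    clear_value C
    clear hC
    rcases parity_zero_or_one (q i) with hi | hi <;> rcases parity_zero_or_one (q j) with hj | hj <;>
    rcases parity_zero_or_one (q l) with hl | hl <;>
    simp only [hi, hj, hl, mul_zero, mul_one, zero_mul, sgn_zero, sgn_one] at e1 e2 e3 e4 e5 e6 <;>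
    grind
  have hd := (Matrix.isUnit_iff_isUnit_det G).1 hG.unit
  calc A l = G⁻¹ * (G * A l) := by
        rw [← Matrix.mul_assoc, Matrix.nonsing_inv_mul _ hd, Matrix.one_mul]
    _ = 0 := by rw [show G * A l = 0 from h3, Matrix.mul_zero]

/-- The identity module of `autLie`. -/
def autId (q : I → ZMod 2) (G : Matrix I I ℂ) (hG : (matSpace q).Homog 0 G) :
    SuperModule (autLie q G hG) (vecSpace q) :=
  glRestrict (idModule q) (autSub q G) (autSub_par q G hG) (autSub_bracket q G hG)

theorem component_autId (hG : IsSuperForm q G) : component (autId q G hG.even) 2 = ⊥ := by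
  rw [eq_bot_iff]
  rintro (X : vecSpace q →ₗ[ℂ] autLie q G hG.even) ⟨-, hX⟩
  refine vecSpace_ext fun l => ?_
  let A : I → Matrix I I ℂ := fun l => (X (Pi.single l (1 : ℂ) : I → ℂ)).1
  refine Subtype.ext (osp_tensor_eq_zero hG A (fun l => (X (Pi.single l (1 : ℂ) : I → ℂ)).2) ?_ l)
  intro l i j
  have h := congrFun (hX _ _ _ _ (homog_single q l) (homog_single q j)) i
  change (A l *ᵥ Pi.single j 1) i = sgn (q l * q j) * (A j *ᵥ Pi.single l 1) i at h
  simpa using h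

/-- The elements of degree one of the prolong come from `osp`: the scalar part `v ↦ c(v)` of `X(v) ∈
osp ⊕ ℂ` is matched by the element of degree `1` whose column is dual to `c`, and the difference
lies in the first prolong of `osp`, which vanishes. -/
theorem exists_of_mem_component_cautId [Nonempty I] (hG : IsSuperForm q G)
    {X : level (cautId q G hG.even) 2} (hX : X ∈ component (cautId q G hG.even) 2) :
    ∃ w, (quadricLocalPart hG).toLevel 2 ⟨colElem G 1 w, colElem_mem hG 1 w⟩ = X := by
  let X' : vecSpace q →ₗ[ℂ] cautLie q G hG.even := X
  let M : I → Matrix I I ℂ := fun l => (X' (Pi.single l (1 : ℂ) : I → ℂ)).1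
  have h1 : ∀ l, ∃ c : ℂ, M l - c • (1 : Matrix I I ℂ) ∈ autSub q G := by
    intro l
    obtain ⟨Y, hY, c, h⟩ := exists_of_mem_cautSub (X' (Pi.single l (1 : ℂ) : I → ℂ)).2
    exact ⟨c, by rw [show M l = _ from h.symm, add_sub_cancel_right]; exact hY⟩
  choose c hc using h1
  obtain ⟨w, hw⟩ := hG.exists_mulVec c
  refine ⟨w, ?_⟩
  have hY := (quadricLocalPart hG).toLevel_mem 2 ⟨colElem G 1 w, colElem_mem hG 1 w⟩
  set Y := (quadricLocalPart hG).toLevel 2 ⟨colElem G 1 w, colElem_mem hG 1 w⟩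
  let Y' : vecSpace q →ₗ[ℂ] cautLie q G hG.even := Y
  have hXY := (component (cautId q G hG.even) 2).sub_mem hX hY
  refine (sub_eq_zero.1 (?_ : X' - Y' = 0)).symm
  refine vecSpace_ext fun l => ?_
  let A : I → Matrix I I ℂ := fun l => ((X' - Y') (Pi.single l (1 : ℂ) : I → ℂ)).1
  refine Subtype.ext (osp_tensor_eq_zero hG A (fun l => ?_) ?_ l)
  · have e : A l = (M l - c l • (1 : Matrix I I ℂ)) -
        (superComm (hypParity q) (colElem G 1 w) (colElem G 0 (Pi.single l 1))).submatrix
          Sum.inr Sum.inr := by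
      change M l - quadricBlock (superComm (hypParity q)
        (colElem G 1 w) (colElem G 0 (Pi.single l 1))) = _
      have e1 : superComm (hypParity q) (colElem G 1 w) (colElem G 0 (Pi.single l 1))
          (.inl 0) (.inl 0) = -c l := by
        rw [← hw]
        simp [superComm, Fintype.sum_sum_type, Fin.sum_univ_two, colElem, hypParity,
            Pi.single_apply]
      have e2 : ∀ Z : Matrix (Fin 2 ⊕ I) (Fin 2 ⊕ I) ℂ, quadricBlock Z =
        Z.submatrix Sum.inr Sum.inr - Z (.inl 0) (.inl 0) • 1 := fun Z => rfl
      rw [e2, e1, neg_smul, sub_neg_eq_add, sub_add_eq_sub_sub_swap]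
    rw [e]
    refine (autSub q G).sub_mem (hc l) ((mem_autSub_hypForm hG).1 ?_).2.2.2
    exact autSub_bracket (hypParity q) (hypForm G) (hypForm_even hG.even) _ (colElem_mem hG 1 w) _
      (colElem_mem hG 0 _)
  · intro l i j
    have h := congrFun (hXY.2 _ _ _ _ (homog_single q l) (homog_single q j)) i
    change (A l *ᵥ Pi.single j 1) i = sgn (q l * q j) * (A j *ᵥ Pi.single l 1) i at h
    simpa using h

/-- The entry `(i, k)` of the value at `e_j` of the element of degree `1` with column `w`. -/
def quadricTensor (q : I → ZMod 2) (G : Matrix I I ℂ) (w : I → ℂ) (j i k : I) : ℂ :=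
  (if i = k then (G *ᵥ w) j else 0) - w i * G k j +
    (if i = j then sgn (q i * q k) * (G *ᵥ w) k else 0)

/-- The value at a single odd vector determines an element of degree `1`. -/
theorem quadricTensor_odd (hG : IsSuperForm q G) {o : I} (ho : q o = 1) {w : I → ℂ}
    (h : ∀ i k, quadricTensor q G w o i k = 0) : w = 0 := by
  obtain ⟨o', ho'⟩ : ∃ o', G o' o ≠ 0 := by
    by_contra! hne
    have h0 := hG.eq_zero_of_mulVec (w := Pi.single o 1) (by ext k; simp [hne k])
    simpa using congrFun h0 o
  have hq : q o' = 1 := ((hG.eq_zero_or o' o).resolve_left ho').trans ho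
  have hoo : G o o = 0 := by
    have := hG.symm o o
    rw [ho, sgn_one] at this
    grind
  have hoo' : o' ≠ o := by rintro rfl; exact ho' hoo
  have z : ∀ i, i ≠ o → i ≠ o' → w i = 0 := by
    intro i hio hio'
    have := h i o'
    simpa [quadricTensor, hio, hio', ho'] using this
  have e1 := h o o'
  have e2 := h o' o'
  simp [quadricTensor, hoo', hoo'.symm, ho, hq, sgn_one] at e1 e2
  have s : ∀ j, (G *ᵥ w) j = G j o * w o + G j o' * w o' := by
    intro j
    simp only [Matrix.mulVec, dotProduct]
    exact Fintype.sum_eq_add o o' hoo'.symm fun k hk => by rw [z k hk.1 hk.2, mul_zero]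
  rw [s, hoo, hG.symm o o', hq, sgn_one] at e2
  have hoo2 : G o' o' = 0 := by
    have := hG.symm o' o'
    rw [hq, sgn_one] at this
    grind
  rw [s, hoo2] at e1
  have w' : w o' = 0 := by
    have : w o' * G o' o = 0 := by linear_combination (-1 / 2 : ℂ) * e2
    exact (mul_eq_zero.1 this).resolve_right ho'
  have w0 : w o = 0 := by
    have : w o * G o' o = 0 := by linear_combination (-1 / 2 : ℂ) * e1
    exact (mul_eq_zero.1 this).resolve_right ho'
  funext i
  by_cases hio : i = o
  · rw [hio, w0]; rfl
  by_cases hio' : i = o'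
  · rw [hio', w']; rfl
  exact z i hio hio'

/-- The second prolong of `cosp` vanishes. If there is an odd vector `e_o`, supersymmetry forces the
value at `(e_o, e_o)` to vanish, and `quadricTensor_odd` propagates this to all of the tensor; in
the purely even case three indices are needed. -/
theorem quadricTensor_eq_zero (hG : IsSuperForm q G) (w : I → I → ℂ)
    (hI : (∃ o, q o = 1) ∨ (G = 1 ∧ (∀ i, q i = 0) ∧ ∀ i j : I, ∃ k, k ≠ i ∧ k ≠ j))
    (h : ∀ l j i k, quadricTensor q G (w l) j i k =
      sgn (q l * q j) * quadricTensor q G (w j) l i k) (l : I) : w l = 0 := by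
  rcases hI with ⟨o, ho⟩ | ⟨rfl, hq, hI⟩
  · have h0 : w o = 0 := quadricTensor_odd hG ho fun i k => by
      have := h o o i k
      rw [ho, mul_one, sgn_one] at this
      grind
    refine quadricTensor_odd hG ho fun i k => ?_
    rw [h l o i k, h0]
    simp [quadricTensor]
  · have off : ∀ l k, k ≠ l → w l k = 0 := by
      intro l k hkl
      obtain ⟨j, hjk, hjl⟩ := hI k l
      have := h l j j k
      simpa [quadricTensor, hq, sgn_zero, hjk, hjl, hjk.symm, hjl.symm, hkl, hkl.symm] using this
    have diag : ∀ l j, l ≠ j → w l l = -w j j := by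
      intro l j hlj
      have := h l j l j
      have o1 := off l j hlj.symm
      simp [quadricTensor, hq, sgn_zero, hlj, hlj.symm] at this
      grind
    funext k
    by_cases hkl : k = l
    · subst hkl
      obtain ⟨a, hak, -⟩ := hI k k
      obtain ⟨b, hbk, hba⟩ := hI k a
      have e1 := diag k a hak.symm
      have e2 := diag k b hbk.symm
      have e3 := diag a b hba.symm
      rw [Pi.zero_apply]
      grind
    · exact off l k hkl

/-- The quadric grading is a full prolong: degree one is `exists_of_mem_component_cautId`, and
degree two vanishes by `quadricTensor_eq_zero`. -/
theorem isCartanProlong_quadric [Nonempty I] (hG : IsSuperForm q G)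
    (hI : (∃ o, q o = 1) ∨ (G = 1 ∧ (∀ i, q i = 0) ∧ ∀ i j : I, ∃ k, k ≠ i ∧ k ≠ j)) :
    IsCartanProlong (autLie (hypParity q) (hypForm G) (hypForm_even hG.even))
      (weightDegree (hypParity q) (hypForm G) (hypForm_even hG.even) hypWeight)
      (cautId q G hG.even) := by
  have h3 : component (cautId q G hG.even) 3 = ⊥ := by
    rw [eq_bot_iff]
    rintro X ⟨hX1, hX⟩
    let X' : vecSpace q →ₗ[ℂ] level (cautId q G hG.even) 2 := X
    have h1 := fun l => exists_of_mem_component_cautId hG (hX1 (Pi.single l (1 : ℂ) : I → ℂ))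
    choose w hw using h1
    have key : ∀ l, w l = 0 := by
      refine quadricTensor_eq_zero hG w hI fun l j i k => ?_
      have h := hX _ _ _ _ (homog_single q l) (homog_single q j)
      rw [← hw l, ← hw j] at h
      have h' := congrFun (congrFun (congrArg Subtype.val h) i) k
      change quadricBlock (superComm (hypParity q) (colElem G 1 (w l))
        (colElem G 0 (Pi.single j 1))) i k = sgn (q l * q j) * quadricBlock (superComm (hypParity q)
        (colElem G 1 (w j)) (colElem G 0 (Pi.single l 1))) i k at h'
      rw [quadricBlock_col_col, quadricBlock_col_col] at h'
      simpa [quadricTensor, Pi.single_apply] using h'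
    refine vecSpace_ext (f := X') fun l => ?_
    refine (hw l).symm.trans ?_
    have e : (⟨colElem G 1 (w l), colElem_mem hG 1 (w l)⟩ :
        autSub (hypParity q) (hypForm G)) = 0 := by
      refine Subtype.ext ?_
      change colElem G 1 (w l) = 0
      rw [key l, map_zero]
    exact (congrArg ((quadricLocalPart hG).toLevel 2) e).trans (map_zero _)
  refine (quadricLocalPart hG).isCartanProlong fun k X hX => ?_
  match k, X, hX with
  | 0, X, hX =>
    obtain ⟨w, h⟩ := exists_of_mem_component_cautId hG hX
    refine ⟨_, ?_, h⟩
    rintro (i | i) (j | j)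
    · left; rfl
    · fin_cases i
      · right; rfl
      · left; rfl
    · fin_cases j
      · left; rfl
      · right; rfl
    · left; rfl
  | k + 1, X, hX =>
    have h := component_eq_bot_of_le (m := 1) h3 (Nat.le_add_left 1 k)
    rw [h] at hX
    exact ⟨0, Submodule.zero_mem _, by rw [map_zero]; exact hX.symm⟩

end Quadric

/-! ### The standard form of `osp(p+2|2n)` in an isotropic basis -/

section QuadricBasis

theorem ospForm_isSuperForm (M N : Type) [Fintype M] [Fintype N] [DecidableEq M] [DecidableEq N] :
    IsSuperForm (ospParity M N) (ospForm M N) where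
  even := ospForm_even M N
  symm := by
    rintro (i | i | i) (j | j | j) <;>
      simp [ospForm, ospParity, sgn_zero, sgn_one, Matrix.one_apply, eq_comm]
    all_goals split_ifs <;> simp
  unit := by
    refine IsUnit.of_mul_eq_one (Matrix.fromBlocks 1 0 0 (Matrix.fromBlocks 0 (-1) 1 0)) ?_
    simp [ospForm, Matrix.fromBlocks_multiply, Matrix.fromBlocks_one]

variable (S T : Type) [DecidableEq S] [DecidableEq T]

/-- The columns are the isotropic vectors `(-i/2, 1/2)` and `(i, 1)` of the first plane, of
eigenvalue `1` and `-1` for the grading element and with product `1`, followed by the standard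
basis. -/
def quadricBasis : Matrix ((Fin 2 ⊕ S) ⊕ T) (Fin 2 ⊕ (S ⊕ T)) ℂ :=
  (Matrix.fromBlocks !![-Complex.I / 2, Complex.I; 1 / 2, 1] 0 0 1).submatrix
    (Equiv.sumAssoc (Fin 2) S T) id

/-- The inverse of `quadricBasis`. -/
def quadricBasisInv : Matrix (Fin 2 ⊕ (S ⊕ T)) ((Fin 2 ⊕ S) ⊕ T) ℂ :=
  (Matrix.fromBlocks !![Complex.I, 1; -Complex.I / 2, 1 / 2] 0 0 1).submatrix id
    (Equiv.sumAssoc (Fin 2) S T)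

variable [Fintype S] [Fintype T]

theorem quadricBasis_mul_inv : quadricBasis S T * quadricBasisInv S T = 1 := by
  rw [quadricBasis, quadricBasisInv, ← Matrix.submatrix_mul _ _ _ _ _ Function.bijective_id,
    Matrix.fromBlocks_multiply]
  have e : (!![-Complex.I / 2, Complex.I; 1 / 2, 1] * !![Complex.I, 1; -Complex.I / 2, 1 / 2] :
      Matrix (Fin 2) (Fin 2) ℂ) = 1 := by
    ext i j; fin_cases i <;> fin_cases j <;> simp [Matrix.mul_apply, Fin.sum_univ_two] <;>
      ring_nf <;> simp
  rw [e]
  simp [Matrix.fromBlocks_one]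

theorem quadricBasis_inv_mul : quadricBasisInv S T * quadricBasis S T = 1 :=
  Matrix.mul_eq_one_comm_of_equiv (Equiv.sumAssoc (Fin 2) S T) |>.1 (quadricBasis_mul_inv S T)

end QuadricBasis

theorem isCartanProlong_osp_quadric (p n : ℕ) (hp : n = 0 → 3 ≤ p) :
    IsCartanProlong (osp (Fin 2 ⊕ Fin p) (Fin n)) (ospDegree (quadricElement p n))
      (cospId (Fin p) (Fin n)) := by
  have hG := ospForm_isSuperForm (Fin p) (Fin n)
  have hne : Nonempty (Fin p ⊕ (Fin n ⊕ Fin n)) := by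
    rcases Nat.eq_zero_or_pos n with h | h
    · have := hp h
      exact ⟨.inl ⟨0, by omega⟩⟩
    · exact ⟨.inr (.inl ⟨0, h⟩)⟩
  have hI : (∃ o, ospParity (Fin p) (Fin n) o = 1) ∨ (ospForm (Fin p) (Fin n) = 1 ∧
      (∀ i, ospParity (Fin p) (Fin n) i = 0) ∧
        ∀ i j : Fin p ⊕ (Fin n ⊕ Fin n), ∃ k, k ≠ i ∧ k ≠ j) := by
    rcases Nat.eq_zero_or_pos n with h | h
    · right
      have h3 := hp h
      subst h
      refine ⟨?_, ?_, ?_⟩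
      · ext (i | i | i) (j | j | j)
        · simp [ospForm, Matrix.one_apply]
        all_goals first | exact i.elim0 | exact j.elim0
      · rintro (i | i | i)
        · rfl
        all_goals exact i.elim0
      · rintro (i | i | i) (j | j | j)
        · obtain ⟨k, hk⟩ := Finset.exists_mem_notMem_of_card_lt_card (s := {i, j})
            (t := (Finset.univ : Finset (Fin p))) (by
              rw [Finset.card_univ, Fintype.card_fin]
              exact (Finset.card_le_two).trans_lt h3)
          simp only [Finset.mem_univ, Finset.mem_insert, Finset.mem_singleton, not_or,
              true_and] at hk
          exact ⟨.inl k, fun h => hk.1 (Sum.inl_injective h), fun h => hk.2 (Sum.inl_injective h)⟩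
        all_goals first | exact i.elim0 | exact j.elim0
    · exact Or.inl ⟨.inr (.inl ⟨0, h⟩), rfl⟩
  refine IsCartanProlong.of_conj (P := quadricBasis (Fin p) (Fin n ⊕ Fin n))
    (Q := quadricBasisInv (Fin p) (Fin n ⊕ Fin n))
    (q := hypParity (ospParity (Fin p) (Fin n))) ?_ ?_
    (quadricBasis_mul_inv _ _) (quadricBasis_inv_mul _ _) (ospForm_even _ _)
    (hypForm_even hG.even) ?_ (h := quadricElement p n) (m := hypWeight) 0 ?_
    (isCartanProlong_quadric hG hI)
  · rintro ((i | i) | i) (j | j | j)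
    · right; rfl
    · left; rfl
    · left; rfl
    · left; rfl
    · right; rfl
    · left; simp [quadricBasis]
    · left; rfl
    · left; simp [quadricBasis]
    · right; rfl
  · rintro (j | j | j) ((i | i) | i)
    · right; rfl
    · left; rfl
    · left; rfl
    · left; rfl
    · right; rfl
    · left; simp [quadricBasisInv]
    · left; rfl
    · left; simp [quadricBasisInv]
    · right; rfl
  · have e : ospForm (Fin 2 ⊕ Fin p) (Fin n) = (Matrix.fromBlocks (1 : Matrix (Fin 2) (Fin 2) ℂ) 0 0
        (ospForm (Fin p) (Fin n))).submatrix (Equiv.sumAssoc _ _ _) (Equiv.sumAssoc _ _ _) := by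
      ext ((i | i) | i) ((j | j) | j) <;> simp [ospForm, Matrix.one_apply]
    rw [e, quadricBasis, Matrix.transpose_submatrix, Matrix.submatrix_mul_equiv,
      Matrix.submatrix_mul_equiv, Matrix.submatrix_id_id, Matrix.fromBlocks_transpose,
      Matrix.fromBlocks_multiply, Matrix.fromBlocks_multiply, hypForm]
    congr 1
    · ext i j
      fin_cases i <;> fin_cases j <;> simp [Matrix.mul_apply, Fin.sum_univ_two] <;>
      ring_nf <;> simp <;> norm_num
    · simp
    · simp
    · simp
  · have e : quadricElement p n = (Matrix.fromBlocks !![0, -Complex.I; Complex.I, 0] 0 0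
        (0 : Matrix (Fin p ⊕ (Fin n ⊕ Fin n)) (Fin p ⊕ (Fin n ⊕ Fin n)) ℂ)).submatrix
          (Equiv.sumAssoc _ _ _) (Equiv.sumAssoc _ _ _) := by
      ext ((i | i) | i) ((j | j) | j) <;> simp [quadricElement]
    have d : (Matrix.diagonal fun i => ((hypWeight i : ℤ) : ℂ) - 0) = Matrix.fromBlocks !![1,
        0; 0, -1] 0 0
        (0 : Matrix (Fin p ⊕ (Fin n ⊕ Fin n)) (Fin p ⊕ (Fin n ⊕ Fin n)) ℂ) := by
      ext (i | i) (j | j)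
      · fin_cases i <;> fin_cases j <;> simp [hypWeight]
      · simp
      · simp
      · by_cases h : i = j
        · simp [h, hypWeight]
        · simp [h]
    rw [e, d, quadricBasis, Matrix.submatrix_mul_equiv]
    rw [← Matrix.submatrix_id_id (Matrix.fromBlocks !![1, 0; 0, -1] 0 0 0),
      ← Matrix.submatrix_mul _ _ _ _ _ Function.bijective_id]
    congr 1
    rw [Matrix.fromBlocks_multiply, Matrix.fromBlocks_multiply]
    congr 1
    · ext i j
      fin_cases i <;> fin_cases j <;> simp [Matrix.mul_apply, Fin.sum_univ_two] <;>
      ring_nf; simp; norm_num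
    · simp
    · simp
    · simp

theorem isTrivialProlong_ospId (p n : ℕ) : IsTrivialProlong (ospId (Fin p) (Fin n)) :=
  isTrivialProlong_of_component (component_autId (ospForm_isSuperForm (Fin p) (Fin n)))

/-! ### The exterior square of a superspace -/

section WedgeBasis

variable {K : Type} [DecidableEq K] {p : K → ZMod 2}

/-- The tensor `e_i ∧ e_j = e_i ⊗ e_j - (-1)^{p_i p_j} e_j ⊗ e_i`. -/
def wedgeVec (p : K → ZMod 2) (i j : K) : Matrix K K ℂ :=
  Matrix.single i j 1 - sgn (p i * p j) • Matrix.single j i 1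

theorem wedgeVec_apply (i j a b : K) : wedgeVec p i j a b =
    (if i = a ∧ j = b then 1 else 0) - sgn (p i * p j) * (if j = a ∧ i = b then 1 else 0) := by
  simp [wedgeVec, Matrix.single_apply]

theorem wedgeVec_mem (i j : K) : wedgeVec p i j ∈ wedgeSquare p := by
  intro a b
  rw [wedgeVec_apply, wedgeVec_apply]
  have h := sgn_mul_self (p i * p j)
  by_cases h1 : i = a ∧ j = b
  · obtain ⟨rfl, rfl⟩ := h1
    by_cases h2 : j = i
    · subst h2; simp; grind
    · simp [h2, Ne.symm h2]; grind
  · by_cases h2 : j = a ∧ i = b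
    · obtain ⟨rfl, rfl⟩ := h2
      have h3 : ¬ i = j := fun h => h1 ⟨h, h.symm⟩
      simp [h3, Ne.symm h3, mul_comm (p j)]
    · have h1' : ¬ (j = b ∧ i = a) := fun h => h1 h.symm
      have h2' : ¬ (i = b ∧ j = a) := fun h => h2 h.symm
      simp [h1, h2, h1', h2']

theorem wedgeVec_swap (i j : K) : wedgeVec p i j = -(sgn (p i * p j) • wedgeVec p j i) := by
  have h := sgn_mul_self (p i * p j)
  rw [wedgeVec, wedgeVec, smul_sub, smul_smul, mul_comm (p j), h, one_smul, neg_sub]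

theorem wedgeVec_homog (i j : K) : (matSpace p).Homog (p i + p j) (wedgeVec p i j) := by
  rw [homog_matSpace]
  intro a b
  rw [wedgeVec_apply]
  by_cases h1 : i = a ∧ j = b
  · rw [h1.1, h1.2]
  · by_cases h2 : j = a ∧ i = b
    · rw [h2.1, h2.2, add_comm (p a)]
    · simp [h1, h2]

variable [Fintype K]

/-- The factor `1 / 2` accounts for the two orders of each pair of indices, and for `e_i ∧ e_i = 2
e_i ⊗ e_i` when `i` is odd. -/
theorem sum_wedgeVec {t : Matrix K K ℂ} (ht : t ∈ wedgeSquare p) :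
    t = ∑ i, ∑ j, (t i j / 2) • wedgeVec p i j := by
  have ht' : ∀ i j, t i j = -(sgn (p i * p j) * t j i) := ht
  ext a b
  simp only [Matrix.sum_apply, Matrix.smul_apply, wedgeVec_apply, smul_eq_mul, mul_sub,
    Finset.sum_sub_distrib]
  have e1 : ∑ i, ∑ j, t i j / 2 * (if i = a ∧ j = b then 1 else 0) = t a b / 2 := by
    simp [ite_and]
  have e2 : ∑ i, ∑ j, t i j / 2 * (sgn (p i * p j) * (if j = a ∧ i = b then 1 else 0)) =
      t b a / 2 * sgn (p b * p a) := by
    simp [ite_and]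
  rw [e1, e2, ht' b a, mul_comm (p b)]
  linear_combination (-t a b / 2) * sgn_mul_self (p a * p b)

theorem tensorAct_wedgeVec (M : Matrix K K ℂ) (k l a b : K) :
    tensorAct p M (wedgeVec p k l) a b = wedgeCoeff p M k l a b := by
  simp only [tensorAct, Matrix.of_apply, wedgeVec_apply, wedgeCoeff, Finset.sum_add_distrib,
    mul_sub, Finset.sum_sub_distrib]
  simp [ite_and, eq_comm]
  split_ifs <;> ring

/-- The exterior square of the superspace with parities `p`. -/
abbrev wedgeOf (p : K → ZMod 2) : SuperSpace := (matSpace p).sub (wedgeSquare p) (wedgeSquare_par p)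

/-- `e_i ∧ e_j` as an element of the exterior square. -/
def wedgeElt (p : K → ZMod 2) (i j : K) : wedgeOf p :=
  (⟨wedgeVec p i j, wedgeVec_mem i j⟩ : wedgeSquare p)

theorem wedgeElt_homog (i j : K) : (wedgeOf p).Homog (p i + p j) (wedgeElt p i j) :=
  Subtype.ext (wedgeVec_homog i j)

theorem wedgeElt_swap (i j : K) : wedgeElt p i j = -(sgn (p i * p j) • wedgeElt p j i) :=
  Subtype.ext (wedgeVec_swap i j)

theorem wedge_eq_sum (t : wedgeOf p) : t = ∑ i, ∑ j,
    ((t.1 : Matrix K K ℂ) i j / 2) • wedgeElt p i j := by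
  have e : ∀ t : wedgeSquare p, t = ∑ i, ∑ j, ((t.1 : Matrix K K ℂ) i j / 2) •
      (⟨wedgeVec p i j, wedgeVec_mem i j⟩ : wedgeSquare p) := by
    intro t
    refine Subtype.ext ((sum_wedgeVec t.2).trans ?_)
    simp only [AddSubmonoidClass.coe_finsetSum]
    rfl
  exact e t

theorem wedge_ext {W : Type} [AddCommGroup W] [Module ℂ W] {f f' : wedgeOf p →ₗ[ℂ] W}
    (h : ∀ i j, f (wedgeElt p i j) = f' (wedgeElt p i j)) : f = f' := by
  refine LinearMap.ext fun t => ?_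
  have e := wedge_eq_sum t
  rw [e]
  simp only [map_sum, map_smul, h]

theorem isWedgeSymbol_of_linearMap (X : wedgeOf p →ₗ[ℂ] Matrix K K ℂ)
    (hX : ∀ i j k l, tensorAct p (X (wedgeElt p i j)) (wedgeVec p k l) =
      sgn ((p i + p j) * (p k + p l)) • tensorAct p (X (wedgeElt p k l)) (wedgeVec p i j)) :
    IsWedgeSymbol p fun i j => X (wedgeElt p i j) where
  anti := by
    intro i j a k
    rw [wedgeElt_swap, map_neg, map_smul]
    rfl
  symm := by
    intro i j k l a b
    rw [← tensorAct_wedgeVec, ← tensorAct_wedgeVec, hX]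
    rfl

/-- Up to sign, the entry `(a, b)` of the bracket of the element of degree `1` given by the block
`s` with `e_k ∧ e_l`. -/
def lowCoeff (p : K → ZMod 2) (s : Matrix K K ℂ) (k l a b : K) : ℂ :=
  (if a = k then sgn ((p a + p l) * (p l + p b) + p l) * s l b else 0) -
    sgn (p k * p l) * (if a = l then sgn ((p a + p k) * (p k + p b) + p k) * s k b else 0)

/-- The second prolong of `gl` on the exterior square vanishes. An index `i` outside `j`, `k`, `l`
annihilates the entry `(j, b)` of `S_{kl}`, as does `i = j` if `j` is odd and differs from `k` and
`l`. -/
theorem lowCoeff_eq_zero (S : K → K → Matrix K K ℂ) (hS : ∀ k l, S k l ∈ wedgeSquare p)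
    (hK : 3 ≤ Fintype.card K ∨ (∀ i, p i = 1) ∧ 2 ≤ Fintype.card K)
    (h : ∀ i j k l a b, lowCoeff p (S k l) i j a b =
      sgn ((p k + p l) * (p i + p j)) * lowCoeff p (S i j) k l a b) (k l : K) : S k l = 0 := by
  have anti : ∀ k l j b, S k l j b = -(sgn (p j * p b) * S k l b j) := fun k l => hS k l
  have z1 : ∀ i j k l b, i ≠ j → i ≠ k → i ≠ l → S k l j b = 0 := by
    intro i j k l b hij hik hil
    have := h i j k l i b
    simpa [lowCoeff, hij, hik, hil, sgn_ne_zero] using this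
  have z2 : ∀ j k l b, p j = 1 → j ≠ k → j ≠ l → S k l j b = 0 := by
    intro j k l b hj hjk hjl
    have := h j j k l j b
    simp [lowCoeff, hjk, hjl, hj, sgn_one, sgn_ne_zero] at this
    have h2 := sgn_ne_zero ((1 + 1) * (1 + p b) + 1)
    grind
  ext j b
  rw [Matrix.zero_apply]
  by_cases h1 : ∃ i, i ≠ j ∧ i ≠ k ∧ i ≠ l
  · obtain ⟨i, h1, h2, h3⟩ := h1
    exact z1 i j k l b h1 h2 h3
  by_cases h2 : ∃ i, i ≠ b ∧ i ≠ k ∧ i ≠ l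
  · obtain ⟨i, h1, h2, h3⟩ := h2
    rw [anti, z1 i b k l j h1 h2 h3, mul_zero, neg_zero]
  push Not at h1 h2
  by_cases hjkl : j ≠ k ∧ j ≠ l
  · have hjb : j = b := by
      by_contra hjb
      exact hjkl.2 (h2 j hjb hjkl.1)
    subst hjb
    rcases parity_zero_or_one (p j) with hj | hj
    · have := anti k l j j
      rw [hj, mul_zero, sgn_zero] at this
      grind
    · exact z2 j k l j hj hjkl.1 hjkl.2
  have hj : j = k ∨ j = l := by tauto
  have hK2 : ∀ i, i = k ∨ i = l := by
    intro i
    by_cases hij : i = j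
    · rw [hij]; exact hj
    · by_cases hik : i = k
      · exact Or.inl hik
      · exact Or.inr (h1 i hij hik)
  have hcard : Fintype.card K ≤ ({k, l} : Finset K).card :=
    Finset.card_le_card fun i _ => by simpa using hK2 i
  rcases hK with hK | ⟨hodd, hK⟩
  · have := Finset.card_le_two (a := k) (b := l); omega
  have hkl : k ≠ l := by
    rintro rfl
    simp at hcard; omega
  have hjl : j = k ∨ j = l := hj
  rcases hj with rfl | rfl
  · have e := h j j j l j b
    have z := z2 l j j b (hodd l) hkl.symm hkl.symm
    simp [lowCoeff, hkl, hkl.symm, hodd, sgn_one, z, one_add_one_parity,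
        CharTwo.add_self_eq_zero] at e
    grind
  · have e := h j j k j j b
    have z := z2 k j j b (hodd k) hkl hkl
    simp [lowCoeff, hkl, hkl.symm, hodd, sgn_one, z, one_add_one_parity,
        CharTwo.add_self_eq_zero] at e
    grind

end WedgeBasis

/-! ### Orthosymplectic Lie superalgebras graded by a Lagrangian decomposition -/

section Lagrangian

variable {K : Type} [Fintype K] [DecidableEq K] {p : K → ZMod 2}

/-- The parities of the sum of a superspace and its dual. -/
def lagParity (p : K → ZMod 2) : K ⊕ K → ZMod 2 := Sum.elim p p

/-- The form on the sum of a superspace and its dual given by the pairing of the summands. -/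
def lagForm (p : K → ZMod 2) : Matrix (K ⊕ K) (K ⊕ K) ℂ :=
  Matrix.fromBlocks 0 1 (Matrix.diagonal fun i => sgn (p i)) 0

/-- The weights `0` and `1` of the two isotropic summands. -/
def lagWeight : K ⊕ K → ℤ := Sum.elim (fun _ => 0) fun _ => 1

theorem lagForm_even : (matSpace (lagParity p)).Homog 0 (lagForm p) := by
  rw [homog_matSpace]
  rintro (i | i) (j | j)
  · simp [lagForm]
  · by_cases h : i = j
    · subst h; simp [lagForm, lagParity, CharTwo.add_self_eq_zero]
    · simp [lagForm, h]
  · by_cases h : i = j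
    · subst h; simp [lagForm, lagParity, CharTwo.add_self_eq_zero]
    · simp [lagForm, h]
  · simp [lagForm]

/-- Up to signs, the off-diagonal blocks are a tensor in the exterior square and in that of the
dual; the lower right block is determined by the upper left one, which is arbitrary. -/
theorem mem_autSub_lagForm {X : Matrix (K ⊕ K) (K ⊕ K) ℂ} :
    X ∈ autSub (lagParity p) (lagForm p) ↔
      (∀ i j, X (.inr i) (.inl j) = -(sgn (p i * p j) * X (.inr j) (.inl i))) ∧
      (∀ i j, X (.inl i) (.inr j) = -(sgn (p i + p j + p i * p j) * X (.inl j) (.inr i))) ∧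
      ∀ i j, X (.inr i) (.inr j) = -(sgn ((p i + p j) * p j) * X (.inl j) (.inl i)) := by
  rw [mem_autSub_apply]
  have key : ∀ x y : ZMod 2, ∀ u v : ℂ,
      (sgn ((x + y) * y) * u * sgn y + v = 0 ↔ v = -(sgn (x * y) * u)) ∧
      (sgn ((x + y) * y) * u + sgn x * v = 0 ↔ v = -(sgn (x + y + x * y) * u)) ∧
      (sgn ((x + y) * y) * u + v = 0 ↔ v = -(sgn ((x + y) * y) * u)) ∧
      (u = -(sgn ((y + x) * x) * v) → sgn ((x + y) * y) * u * sgn y + sgn x * v = 0) := by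
    intro x y u v
    rcases parity_zero_or_one x with rfl | rfl <;> rcases parity_zero_or_one y with rfl | rfl <;>
    simp [sgn_zero, sgn_one, one_add_one_parity] <;> grind
  constructor
  · intro h
    refine ⟨fun i j => ?_, fun i j => ?_, fun i j => ?_⟩
    · have e := h (.inl i) (.inl j)
      simp [lagForm, lagParity, Fintype.sum_sum_type, Matrix.one_apply, Matrix.diagonal_apply] at e
      exact (key _ _ _ _).1.1 e
    · have e := h (.inr i) (.inr j)
      simp [lagForm, lagParity, Fintype.sum_sum_type, Matrix.one_apply, Matrix.diagonal_apply] at e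
      exact (key _ _ _ _).2.1.1 e
    · have e := h (.inl i) (.inr j)
      simp [lagForm, lagParity, Fintype.sum_sum_type, Matrix.one_apply, Matrix.diagonal_apply] at e
      exact (key _ _ _ _).2.2.1.1 e
  · rintro ⟨h1, h2, h3⟩
    rintro (i | i) (j | j)
    · simp [lagForm, lagParity, Fintype.sum_sum_type, Matrix.one_apply, Matrix.diagonal_apply]
      exact (key _ _ _ _).1.2 (h1 i j)
    · simp [lagForm, lagParity, Fintype.sum_sum_type, Matrix.one_apply, Matrix.diagonal_apply]
      exact (key _ _ _ _).2.2.1.2 (h3 i j)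
    · simp [lagForm, lagParity, Fintype.sum_sum_type, Matrix.one_apply, Matrix.diagonal_apply]
      exact (key _ _ _ _).2.2.2 (h3 j i)
    · simp [lagForm, lagParity, Fintype.sum_sum_type, Matrix.one_apply, Matrix.diagonal_apply]
      exact (key _ _ _ _).2.1.2 (h2 i j)

theorem lag_ext {X : Matrix (K ⊕ K) (K ⊕ K) ℂ} (hX : X ∈ autSub (lagParity p) (lagForm p))
    (h0 : ∀ i j, X (.inl i) (.inl j) = 0) (h1 : ∀ i j, X (.inl i) (.inr j) = 0)
    (h2 : ∀ i j, X (.inr i) (.inl j) = 0) : X = 0 := by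
  ext (i | i) (j | j)
  · exact h0 i j
  · exact h1 i j
  · exact h2 i j
  · rw [(mem_autSub_lagForm.1 hX).2.2, h0]; simp

/-- The element of degree `-1` given by a tensor `t`; the signs turn the symmetry of the upper right
block into that of the exterior square. -/
def upElem (p : K → ZMod 2) : Matrix K K ℂ →ₗ[ℂ] Matrix (K ⊕ K) (K ⊕ K) ℂ where
  toFun := fun t => Matrix.fromBlocks 0 (Matrix.of fun i j => sgn (p j) * t i j) 0 0
  map_add' := by intro s t; ext (i | i) (j | j) <;> simp [mul_add]
  map_smul' := by intro c t; ext (i | i) (j | j) <;> simp [mul_left_comm]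

theorem upElem_mem {t : Matrix K K ℂ} (ht : t ∈ wedgeSquare p) :
    upElem p t ∈ autSub (lagParity p) (lagForm p) := by
  have ht' : ∀ i j, t i j = -(sgn (p i * p j) * t j i) := ht
  rw [mem_autSub_lagForm]
  refine ⟨fun i j => ?_, fun i j => ?_, fun i j => ?_⟩
  · simp [upElem]
  · simp only [upElem, LinearMap.coe_mk, AddHom.coe_mk, Matrix.fromBlocks_apply₁₂, Matrix.of_apply]
    rw [ht' i j, sgn_add, sgn_add]
    linear_combination (sgn (p j) * sgn (p i * p j) * t j i) * sgn_mul_self (p i)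
  · simp [upElem]

/-- The element of degree `1` given by a block `s`. -/
def lowElem : Matrix K K ℂ →ₗ[ℂ] Matrix (K ⊕ K) (K ⊕ K) ℂ where
  toFun := fun s => Matrix.fromBlocks 0 0 s 0
  map_add' := by intro s t; ext (i | i) (j | j) <;> simp
  map_smul' := by intro c t; ext (i | i) (j | j) <;> simp

theorem lowElem_mem {s : Matrix K K ℂ} (hs : s ∈ wedgeSquare p) :
    lowElem s ∈ autSub (lagParity p) (lagForm p) := by
  rw [mem_autSub_lagForm]
  refine ⟨fun i j => hs i j, fun i j => ?_, fun i j => ?_⟩ <;> simp [lowElem]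

/-- The component of degree `-1` of a matrix, as a tensor. -/
def upBlock (p : K → ZMod 2) : Matrix (K ⊕ K) (K ⊕ K) ℂ →ₗ[ℂ] Matrix K K ℂ where
  toFun := fun X => Matrix.of fun i j => sgn (p j) * X (.inl i) (.inr j)
  map_add' := by intro s t; ext i j; simp [mul_add]
  map_smul' := by intro c t; ext i j; simp [mul_left_comm]

theorem upBlock_mem {X : Matrix (K ⊕ K) (K ⊕ K) ℂ} (hX : X ∈ autSub (lagParity p) (lagForm p)) :
    upBlock p X ∈ wedgeSquare p := by
  have e : ∀ i j, sgn (p j) * X (.inl i) (.inr j) =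
      -(sgn (p i * p j) * (sgn (p i) * X (.inl j) (.inr i))) := by
    intro i j
    rw [(mem_autSub_lagForm.1 hX).2.1 i j, sgn_add, sgn_add]
    linear_combination (-sgn (p i) * sgn (p i * p j) * X (.inl j) (.inr i)) * sgn_mul_self (p j)
  exact e

theorem upBlock_eq_zero {X : Matrix (K ⊕ K) (K ⊕ K) ℂ} :
    upBlock p X = 0 ↔ ∀ i j, X (.inl i) (.inr j) = 0 := by
  rw [← Matrix.ext_iff]
  simp [upBlock, sgn_ne_zero]

theorem upBlock_bracket {X : Matrix (K ⊕ K) (K ⊕ K) ℂ}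
    (hX : X ∈ autSub (lagParity p) (lagForm p)) (t : Matrix K K ℂ) :
    upBlock p (superComm (lagParity p) X (upElem p t)) = tensorAct p X.toBlocks₁₁ t := by
  ext i j
  have e : superComm (lagParity p) X (upElem p t) (.inl i) (.inr j) =
      ∑ k, (X (.inl i) (.inl k) * (sgn (p j) * t k j) -
        sgn ((p i + p k) * (p k + p j)) * (sgn (p k) * t i k * X (.inr k) (.inr j))) := by
    simp [superComm, upElem, Fintype.sum_sum_type, lagParity, Finset.sum_sub_distrib,
      sub_eq_add_neg, Finset.sum_add_distrib]
  change sgn (p j) * superComm (lagParity p) X (upElem p t) (.inl i) (.inr j) =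
    ∑ k, (X (.inl i) (.inl k) * t k j + sgn ((p j + p k) * p i) * (X (.inl j) (.inl k) * t i k))
  rw [e, Finset.mul_sum]
  refine Finset.sum_congr rfl fun k _ => ?_
  rw [(mem_autSub_lagForm.1 hX).2.2]
  rcases parity_zero_or_one (p i) with hi | hi <;>
  rcases parity_zero_or_one (p j) with hj | hj <;>
  rcases parity_zero_or_one (p k) with hk | hk <;>
  simp [hi, hj, hk, sgn_zero, sgn_one, one_add_one_parity] <;> ring

theorem lowElem_bracket (s t : Matrix K K ℂ) (a b : K) :
    superComm (lagParity p) (lowElem s) (upElem p t) (.inl a) (.inl b) =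
      -∑ c, sgn ((p a + p c) * (p c + p b) + p c) * (t a c * s c b) := by
  simp [superComm, upElem, lowElem, Fintype.sum_sum_type, lagParity]
  refine Finset.sum_congr rfl fun c _ => ?_
  rw [sgn_add]; ring

theorem lowElem_bracket_wedgeVec (s : Matrix K K ℂ) (k l a b : K) :
    superComm (lagParity p) (lowElem s) (upElem p (wedgeVec p k l)) (.inl a) (.inl b) =
      -lowCoeff p s k l a b := by
  rw [lowElem_bracket]
  simp only [wedgeVec_apply, lowCoeff, sub_mul, mul_sub, Finset.sum_sub_distrib]
  simp [ite_and, eq_comm]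
  split_ifs <;> ring

/-- The supertrace of the bracket of elements of degree `1` and `-1` recovers the former, so that
the elements of degree `1` are detected by the supertraces of their values. -/
theorem str_lowElem {s : Matrix K K ℂ} (hs : s ∈ wedgeSquare p) (k l : K) :
    ∑ a, sgn (p a) * superComm (lagParity p) (lowElem s) (upElem p (wedgeVec p k l))
      (.inl a) (.inl a) = -2 * s l k := by
  have hs' : s k l = -(sgn (p k * p l) * s l k) := hs k l
  have h := sgn_mul_self (p k * p l)
  simp only [lowElem_bracket_wedgeVec, lowCoeff, mul_neg, mul_sub, Finset.sum_sub_distrib,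
    Finset.sum_neg_distrib, mul_ite, mul_zero, Finset.sum_ite_eq', Finset.mem_univ, if_true]
  rw [hs']
  rcases parity_zero_or_one (p k) with hk | hk <;> rcases parity_zero_or_one (p l) with hl | hl <;>
    simp [hk, hl, sgn_zero, sgn_one, one_add_one_parity] <;> ring

/-- The grading of `osp` by a Lagrangian decomposition has `gl` and the exterior square of its
identity module in the degrees `0` and `-1`. -/
def lagrangianLocalPart (p : K → ZMod 2) :
    LocalPart (autLie (lagParity p) (lagForm p) lagForm_even)
      (weightDegree (lagParity p) (lagForm p) lagForm_even lagWeight) (wedgeModule p) where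
  inc := (upElem p ∘ₗ (wedgeSquare p).subtype).codRestrict (autSub (lagParity p) (lagForm p))
    fun t => upElem_mem t.2
  projV := (upBlock p ∘ₗ (autSub (lagParity p) (lagForm p)).subtype).codRestrict (wedgeSquare p)
    fun X => upBlock_mem X.2
  projL :=
    { toFun := fun (X : autSub (lagParity p) (lagForm p)) => Matrix.toBlocks₁₁ X.1
      map_add' := fun X Y => rfl
      map_smul' := fun c X => rfl }
  inc_par := fun t => by
    refine Subtype.ext (Matrix.ext ?_)
    rintro (i | i) (j | j)
    · exact (mul_zero _).symm
    · exact mul_left_comm _ _ _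
    · exact (mul_zero _).symm
    · exact (mul_zero _).symm
  projV_par := fun X => Subtype.ext (Matrix.ext fun i j => mul_left_comm _ _ _)
  projL_par := fun X => rfl
  inc_comm := fun s t => by
    refine Subtype.ext ?_
    change superComm (lagParity p) (upElem p s.1) (upElem p t.1) = 0
    ext (i | i) (j | j) <;> simp [superComm, upElem, Fintype.sum_sum_type]
  projV_inc := fun t => by
    refine Subtype.ext (Matrix.ext fun i j => ?_)
    change sgn (p j) * (sgn (p j) * _) = _
    rw [← mul_assoc, sgn_mul_self, one_mul]
    rfl
  projL_inc := fun t => rfl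
  projV_bracket_inc := fun X t => Subtype.ext (upBlock_bracket X.2 t.1)
  projV_bracket := fun X Y hX hY => by
    have hX' := upBlock_eq_zero.1 (congrArg Subtype.val hX)
    have hY' := upBlock_eq_zero.1 (congrArg Subtype.val hY)
    refine Subtype.ext (upBlock_eq_zero.2 fun i j => ?_)
    refine Finset.sum_eq_zero fun k _ => ?_
    rcases k with k | k
    · exact sub_eq_zero.2 ((mul_eq_zero_of_right _ (hY' k j)).trans
        (mul_eq_zero_of_right _ (mul_eq_zero_of_right _ (hX' k j))).symm)
    · exact sub_eq_zero.2 ((mul_eq_zero_of_left (hX' i k) _).trans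
        (mul_eq_zero_of_right _ (mul_eq_zero_of_left (hY' i k) _)).symm)
  projL_bracket := fun X Y hX hY => by
    have hX' := upBlock_eq_zero.1 (congrArg Subtype.val hX)
    have hY' := upBlock_eq_zero.1 (congrArg Subtype.val hY)
    refine Matrix.ext fun i j => ?_
    change superComm (lagParity p) X.1 Y.1 (.inl i) (.inl j) =
      superComm p (Matrix.toBlocks₁₁ X.1) (Matrix.toBlocks₁₁ Y.1) i j
    refine (Fintype.sum_sum_type _).trans ((congrArg₂ (· + ·) rfl ?_).trans (add_zero _))
    exact Finset.sum_eq_zero fun k _ => sub_eq_zero.2 ((mul_eq_zero_of_left (hX' i k) _).trans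
        (mul_eq_zero_of_right _ (mul_eq_zero_of_left (hY' i k) _)).symm)
  inc_mem := by
    rintro t (i | i) (j | j)
    · left; rfl
    · right; rfl
    · left; rfl
    · left; rfl
  bracket_inc_mem := fun d X t hX => superComm_mem_weightDegree hX (by
    rintro (i | i) (j | j)
    · left; rfl
    · right; rfl
    · left; rfl
    · left; rfl)
  projV_eq_zero := fun d X hX hd => Subtype.ext (upBlock_eq_zero.2 fun i j =>
    (hX (.inl i) (.inr j)).resolve_right (by simp [lagWeight]; omega))
  projL_eq_zero := fun d X hX hd => Matrix.ext fun i j =>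
    (hX (.inl i) (.inl j)).resolve_right (by simp [lagWeight]; omega)
  iSup_eq_top := iSup_weightDegree _ (c := 1) (by
      rintro (i | i) (j | j)
      · left; rfl
      · right; rfl
      · right; rfl
      · left; rfl) (by
      intro X hX
      rintro (i | i) (j | j) <;> simp [lagWeight])
  eq_zero_of_projV := fun X hX h => Subtype.ext (lag_ext X.2
    (fun i j => (hX (.inl i) (.inl j)).resolve_right (by simp [lagWeight]))
    (upBlock_eq_zero.1 (congrArg Subtype.val h))
    fun i j => (hX (.inr i) (.inl j)).resolve_right (by simp [lagWeight]))
  eq_zero_of_projL := fun X hX h => Subtype.ext (lag_ext X.2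
    (fun i j => congrFun (congrFun h i) j)
    (fun i j => (hX (.inl i) (.inr j)).resolve_right (by simp [lagWeight]))
    fun i j => (hX (.inr i) (.inl j)).resolve_right (by simp [lagWeight]))
  transitive := fun k X hX h => by
    have h0 : ∀ i j, X.1 (.inl i) (.inl j) = 0 := fun i j =>
      (hX (.inl i) (.inl j)).resolve_right (by simp [lagWeight]; omega)
    have h1 : ∀ i j, X.1 (.inl i) (.inr j) = 0 := fun i j =>
      (hX (.inl i) (.inr j)).resolve_right (by simp [lagWeight]; omega)
    let s : Matrix K K ℂ := Matrix.toBlocks₂₁ X.1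
    have hs : s ∈ wedgeSquare p := (mem_autSub_lagForm.1 X.2).1
    have e : X.1 = lowElem s := by
      refine Matrix.ext ?_
      rintro (i | i) (j | j)
      · exact h0 i j
      · exact h1 i j
      · rfl
      · refine ((mem_autSub_lagForm.1 X.2).2.2 i j).trans ?_
        rw [h0, mul_zero, neg_zero]
        rfl
    refine Subtype.ext (lag_ext X.2 h0 h1 fun l k => ?_)
    have hb : superComm (lagParity p) X.1 (upElem p (wedgeVec p k l)) = 0 :=
      congrArg Subtype.val (h (wedgeElt p k l))
    rw [e] at hb
    have hstr := str_lowElem hs k l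
    rw [hb] at hstr
    have : s l k = 0 := by simpa using hstr
    exact this
  projL_surj := fun (A : Matrix K K ℂ) => by
    let Y : Matrix (K ⊕ K) (K ⊕ K) ℂ := Matrix.fromBlocks A 0 0
      (Matrix.of fun i j => -(sgn ((p i + p j) * p j) * A j i))
    have hm : Y ∈ autSub (lagParity p) (lagForm p) := by
      rw [mem_autSub_lagForm]
      refine ⟨fun i j => ?_, fun i j => ?_, fun i j => ?_⟩ <;> simp [Y]
    refine ⟨⟨Y, hm⟩, ?_, rfl⟩
    rintro (i | i) (j | j)
    · right; rfl
    · left; rfl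
    · left; rfl
    · right; rfl

end Lagrangian

section LagrangianProlong

variable {K : Type} [Fintype K] [DecidableEq K] {p : K → ZMod 2}

/-- The vanishing of the first prolong of `sl`, for linear maps on the exterior square. -/
theorem wedge_linearMap_eq_zero (hK : EnoughEven p) (hK' : EnoughMixed p)
    (X : wedgeOf p →ₗ[ℂ] Matrix K K ℂ)
    (hX : ∀ i j k l, tensorAct p (X (wedgeElt p i j)) (wedgeVec p k l) =
      sgn ((p i + p j) * (p k + p l)) • tensorAct p (X (wedgeElt p k l)) (wedgeVec p i j))
    (hstr : ∀ i j, supertrace p (X (wedgeElt p i j)) = 0) : X = 0 :=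
  wedge_ext fun i j => (isWedgeSymbol_of_linearMap X hX).eq_zero hK hK' hstr i j

theorem component_wedgeModule_symm {X : wedgeOf p →ₗ[ℂ] Matrix K K ℂ}
    (hX : (X : level (wedgeModule p) 2) ∈ component (wedgeModule p) 2) (i j k l : K) :
    tensorAct p (X (wedgeElt p i j)) (wedgeVec p k l) =
      sgn ((p i + p j) * (p k + p l)) • tensorAct p (X (wedgeElt p k l)) (wedgeVec p i j) :=
  congrArg Subtype.val (hX.2 _ _ _ _ (wedgeElt_homog i j) (wedgeElt_homog k l))

/-- The exterior square of the identity module of `sl`, for arbitrary parities. -/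
def slWedgeOf (p : K → ZMod 2) : SuperModule (sl p) (wedgeOf p) :=
  glRestrict (wedgeModule p) (LinearMap.ker (supertrace p)) (slSub_par p) (slSub_bracket p)

theorem component_slWedgeOf (hK : EnoughEven p) (hK' : EnoughMixed p) :
    component (slWedgeOf p) 2 = ⊥ := by
  rw [eq_bot_iff]
  rintro (X : wedgeOf p →ₗ[ℂ] LinearMap.ker (supertrace p)) ⟨-, hX⟩
  have h : (LinearMap.ker (supertrace p)).subtype ∘ₗ X = 0 := by
    refine wedge_linearMap_eq_zero hK hK' _ (fun i j k l => ?_) fun i j => (X (wedgeElt p i j)).2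
    exact congrArg Subtype.val (hX _ _ _ _ (wedgeElt_homog i j) (wedgeElt_homog k l))
  refine LinearMap.ext (f := X) (g := 0) fun t => Subtype.ext ?_
  exact LinearMap.congr_fun h t

/-- The elements of degree one of the prolong come from `osp`: an element of degree `1` of `osp`
matches the supertraces of all values `X(e_i ∧ e_j)`, and the difference lies in the first prolong
of `sl`, which vanishes. -/
theorem exists_of_mem_component_wedgeModule (hK : EnoughEven p) (hK' : EnoughMixed p)
    {X : level (wedgeModule p) 2} (hX : X ∈ component (wedgeModule p) 2) :
    ∃ s : wedgeSquare p,
      (lagrangianLocalPart p).toLevel 2 ⟨lowElem s.1, lowElem_mem s.2⟩ = X := by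
  let X' : wedgeOf p →ₗ[ℂ] Matrix K K ℂ := X
  let s : Matrix K K ℂ := Matrix.of fun i j => -(1 / 2) * supertrace p (X' (wedgeElt p j i))
  have hs : s ∈ wedgeSquare p := by
    have e : ∀ i j, -(1 / 2) * supertrace p (X' (wedgeElt p j i)) =
        -(sgn (p i * p j) * (-(1 / 2) * supertrace p (X' (wedgeElt p i j)))) := by
      intro i j
      rw [wedgeElt_swap j i, map_neg, map_smul, map_neg, map_smul, smul_eq_mul, mul_comm (p j)]
      ring
    exact e
  refine ⟨⟨s, hs⟩, ?_⟩
  have hY := (lagrangianLocalPart p).toLevel_mem 2 ⟨lowElem s, lowElem_mem hs⟩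
  let Y' : wedgeOf p →ₗ[ℂ] Matrix K K ℂ :=
    (lagrangianLocalPart p).toLevel 2 ⟨lowElem s, lowElem_mem hs⟩
  have hXY := (component (wedgeModule p) 2).sub_mem hX hY
  refine (sub_eq_zero.1 (?_ : X' - Y' = 0)).symm
  refine wedge_linearMap_eq_zero hK hK' _ (component_wedgeModule_symm hXY) fun i j => ?_
  have e : supertrace p (Y' (wedgeElt p i j)) = -2 * s j i := str_lowElem hs i j
  rw [LinearMap.sub_apply, map_sub, e]
  simp [s]

/-- The Lagrangian grading is a full prolong: degree one is `exists_of_mem_component_wedgeModule`,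
and degree two vanishes by `lowCoeff_eq_zero`. -/
theorem isCartanProlong_lagrangian (hK : EnoughEven p) (hK' : EnoughMixed p)
    (hK2 : 3 ≤ Fintype.card K ∨ (∀ i, p i = 1) ∧ 2 ≤ Fintype.card K) :
    IsCartanProlong (autLie (lagParity p) (lagForm p) lagForm_even)
      (weightDegree (lagParity p) (lagForm p) lagForm_even lagWeight) (wedgeModule p) := by
  have h3 : component (wedgeModule p) 3 = ⊥ := by
    rw [eq_bot_iff]
    rintro X ⟨hX1, hX⟩
    let X' : wedgeOf p →ₗ[ℂ] level (wedgeModule p) 2 := X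
    have h1 := fun k l => exists_of_mem_component_wedgeModule hK hK' (hX1 (wedgeElt p k l))
    choose S hS using h1
    let T : K → K → Matrix K K ℂ := fun k l => (S k l).1
    have key : ∀ k l, T k l = 0 := by
      refine lowCoeff_eq_zero T (fun k l => (S k l).2) hK2 fun i j k l a b => ?_
      have h := hX _ _ _ _ (wedgeElt_homog k l) (wedgeElt_homog i j)
      rw [← hS k l, ← hS i j] at h
      have h' := congrFun (congrFun h a) b
      change superComm (lagParity p) (lowElem (T k l)) (upElem p (wedgeVec p i j)) (.inl a) (.inl b)
        = sgn ((p k + p l) * (p i + p j)) *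
        superComm (lagParity p) (lowElem (T i j)) (upElem p (wedgeVec p k l)) (.inl a) (.inl b) at h'
      rw [lowElem_bracket_wedgeVec, lowElem_bracket_wedgeVec, mul_neg] at h'
      exact neg_injective h'
    refine wedge_ext (f := X') fun k l => ?_
    refine (hS k l).symm.trans ?_
    have e : (⟨lowElem (T k l), lowElem_mem (S k l).2⟩ : autSub (lagParity p) (lagForm p)) = 0 := by
      refine Subtype.ext ?_
      change lowElem (T k l) = 0
      rw [key k l, map_zero]
    exact (congrArg ((lagrangianLocalPart p).toLevel 2) e).trans (map_zero _)
  refine (lagrangianLocalPart p).isCartanProlong fun k X hX => ?_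
  match k, X, hX with
  | 0, X, hX =>
    obtain ⟨s, h⟩ := exists_of_mem_component_wedgeModule hK hK' hX
    refine ⟨_, ?_, h⟩
    rintro (i | i) (j | j)
    · left; rfl
    · left; rfl
    · right; rfl
    · left; rfl
  | k + 1, X, hX =>
    have h := component_eq_bot_of_le (m := 1) h3 (Nat.le_add_left 1 k)
    rw [h] at hX
    exact ⟨0, Submodule.zero_mem _, by rw [map_zero]; exact hX.symm⟩

end LagrangianProlong

section LinearFormat

theorem enoughEven_glParity {r n : ℕ} (h3 : (r, n) ≠ (3, 0)) (h2 : (r, n) ≠ (2, 0)) :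
    EnoughEven (glParity r n) := by
  rintro (j | j) (k | k) hj hk hjk
  · rcases Nat.eq_zero_or_pos n with rfl | hn
    · right
      have hr : 4 ≤ r := by
        have : r ≠ 3 := by rintro rfl; exact h3 rfl
        have : r ≠ 2 := by rintro rfl; exact h2 rfl
        have hjk' : j.1 ≠ k.1 := fun h => hjk (congrArg _ (Fin.ext h))
        have := j.2
        have := k.2
        omega
      have hc : ({j, k} : Finset (Fin r)).card ≤ 2 := Finset.card_le_two
      have hc' : 1 < (({j, k} : Finset (Fin r))ᶜ).card := by
        rw [Finset.card_compl, Fintype.card_fin]; omega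
      obtain ⟨a, ha, b, hb, hab⟩ := Finset.one_lt_card.1 hc'
      simp only [Finset.mem_compl, Finset.mem_insert, Finset.mem_singleton, not_or] at ha hb
      refine ⟨.inl a, .inl b, ?_, ?_, ?_, ?_, ?_⟩ <;> simp [hab, ha, hb]
    · exact Or.inl ⟨.inr ⟨0, hn⟩, rfl⟩
  · exact absurd hk one_ne_zero
  · exact absurd hj one_ne_zero
  · exact absurd hj one_ne_zero

theorem enoughMixed_glParity {r n : ℕ} (h1 : (r, n) ≠ (1, 1)) : EnoughMixed (glParity r n) := by
  rintro (a | a) (i | i) ha hi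
  · exact absurd hi zero_ne_one
  · by_cases hr : ∃ b : Fin r, b ≠ a
    · obtain ⟨b, hb⟩ := hr
      exact ⟨.inl b, by simpa using hb, by simp⟩
    · have hn : ∃ b : Fin n, b ≠ i := by
        by_contra! hn
        push Not at hr
        refine h1 (Prod.ext ?_ ?_)
        · exact (Fintype.card_fin r).symm.trans (Fintype.card_eq_one_iff.2 ⟨a, hr⟩)
        · exact (Fintype.card_fin n).symm.trans (Fintype.card_eq_one_iff.2 ⟨i, hn⟩)
      obtain ⟨b, hb⟩ := hn
      exact ⟨.inr b, by simp, by simpa using hb⟩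
  · exact absurd ha one_ne_zero
  · exact absurd ha one_ne_zero

theorem isTrivialProlong_slWedge {r n : ℕ} (h3 : (r, n) ≠ (3, 0)) (h2 : (r, n) ≠ (2, 0))
    (h1 : (r, n) ≠ (1, 1)) : IsTrivialProlong (slWedge r n) :=
  isTrivialProlong_of_component (ρ := slWedge r n)
    (component_slWedgeOf (enoughEven_glParity h3 h2) (enoughMixed_glParity h1))

end LinearFormat

/-! ### The standard form of `osp(2r|2n)` in a Lagrangian basis -/

section LagrangianBasis

open Complex Matrix

variable (S T : Type) [DecidableEq S] [DecidableEq T]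

/-- The columns are the basis vectors of two complementary Lagrangian subspaces, of eigenvalue
`-1/2` and `1/2` for the grading element, and dual to each other: `(i/2, 1/2)` and `(-i, 1)` in the
even part, and `(0, -1)` and `(1, 0)` in the odd part. -/
def lagBasis : Matrix ((S ⊕ S) ⊕ (T ⊕ T)) ((S ⊕ T) ⊕ (S ⊕ T)) ℂ :=
  fromBlocks (fromBlocks ((I / 2) • 1) 0 ((1 / 2 : ℂ) • 1) 0) (fromBlocks (-I • 1) 0 1 0)
    (fromBlocks 0 0 0 (-1)) (fromBlocks 0 1 0 0)

/-- The inverse of `lagBasis`. -/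
def lagBasisInv : Matrix ((S ⊕ T) ⊕ (S ⊕ T)) ((S ⊕ S) ⊕ (T ⊕ T)) ℂ :=
  fromBlocks (fromBlocks (-I • 1) 1 0 0) (fromBlocks 0 0 0 (-1))
    (fromBlocks ((I / 2) • 1) ((1 / 2 : ℂ) • 1) 0 0) (fromBlocks 0 0 1 0)

variable [Fintype S] [Fintype T]

theorem lagBasis_mul_inv : lagBasis S T * lagBasisInv S T = 1 := by
  simp only [lagBasis, lagBasisInv, fromBlocks_multiply, fromBlocks_add]
  rw [← fromBlocks_one]
  congr 1
  · rw [← fromBlocks_one]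
    congr 1 <;> simp [smul_smul, ← add_smul]
    · match_scalars; linear_combination (-1 : ℂ) * I_mul_I
    · module
    · module
    · module
  · simp
  · simp
  · simp

theorem lagBasis_inv_mul : lagBasisInv S T * lagBasis S T = 1 :=
  Matrix.mul_eq_one_comm_of_equiv (Equiv.sumSumSumComm S S T T) |>.1 (lagBasis_mul_inv S T)

end LagrangianBasis

theorem isCartanProlong_osp_lagrangian {r n : ℕ} (hrn : 2 ≤ r + n) (h3 : (r, n) ≠ (3, 0))
    (h2 : (r, n) ≠ (2, 0)) (h1 : (r, n) ≠ (1, 1)) :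
    IsCartanProlong (osp (Fin r ⊕ Fin r) (Fin n)) (ospDegree (lagrangianElement r n))
      (glWedge r n) := by
  have hK : 3 ≤ Fintype.card (Fin r ⊕ Fin n) ∨ (∀ i, glParity r n i = 1) ∧
      2 ≤ Fintype.card (Fin r ⊕ Fin n) := by
    rw [Fintype.card_sum, Fintype.card_fin, Fintype.card_fin]
    by_cases h : 3 ≤ r + n
    · exact Or.inl h
    · right
      have hr : r = 0 := by
        by_contra hr
        have : r = 1 ∧ n = 1 ∨ r = 2 ∧ n = 0 := by omega
        rcases this with ⟨rfl, rfl⟩ | ⟨rfl, rfl⟩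
        · exact h1 rfl
        · exact h2 rfl
      subst hr
      refine ⟨?_, hrn⟩
      rintro (i | i)
      · exact i.elim0
      · rfl
  refine IsCartanProlong.of_conj (P := lagBasis (Fin r) (Fin n)) (Q := lagBasisInv (Fin r) (Fin n))
    (q := lagParity (glParity r n)) ?_ ?_ (lagBasis_mul_inv _ _) (lagBasis_inv_mul _ _)
    (ospForm_even _ _) lagForm_even ?_ (h := lagrangianElement r n) (m := lagWeight) (1 / 2) ?_
    (isCartanProlong_lagrangian (enoughEven_glParity h3 h2) (enoughMixed_glParity h1) hK)
  · rintro ((i | i) | (i | i)) ((j | j) | (j | j)) <;> first | (right; rfl) | (left; rfl)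
  · rintro ((i | i) | (i | i)) ((j | j) | (j | j)) <;> first | (right; rfl) | (left; rfl)
  · have d : Matrix.diagonal (fun i => sgn (glParity r n i)) =
        Matrix.fromBlocks 1 0 0 (-1 : Matrix (Fin n) (Fin n) ℂ) := by
      ext (i | i) (j | j)
      all_goals simp [glParity, Matrix.diagonal_apply, Matrix.one_apply, sgn_zero, sgn_one]
      split_ifs <;> simp
    rw [lagForm, d, ospForm, lagBasis, ← Matrix.fromBlocks_one, ← Matrix.fromBlocks_one,
      ← Matrix.fromBlocks_zero, ← Matrix.fromBlocks_zero, ← Matrix.fromBlocks_zero]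
    simp only [Matrix.fromBlocks_transpose, Matrix.fromBlocks_multiply, Matrix.fromBlocks_add]
    congr 2 <;> simp [smul_smul]
    · match_scalars; linear_combination (1 / 4 : ℂ) * Complex.I_mul_I
    · match_scalars; linear_combination (-1 / 2 : ℂ) * Complex.I_mul_I
    · match_scalars; linear_combination (-1 / 2 : ℂ) * Complex.I_mul_I
  · have d : (Matrix.diagonal fun i => ((lagWeight i : ℤ) : ℂ) - 1 / 2) =
        Matrix.fromBlocks ((-1 / 2 : ℂ) • (1 : Matrix (Fin r ⊕ Fin n) (Fin r ⊕ Fin n) ℂ)) 0 0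
          ((1 / 2 : ℂ) • 1) := by
      ext (i | i) (j | j)
      all_goals simp [lagWeight, Matrix.diagonal_apply, Matrix.one_apply]
      all_goals split_ifs <;> norm_num
    rw [d, lagrangianElement, lagBasis]
    simp only [Matrix.fromBlocks_smul, Matrix.fromBlocks_multiply, Matrix.fromBlocks_add]
    congr 1
    · simp only [Matrix.mul_smul, Matrix.mul_one, Matrix.fromBlocks_smul]
      simp [smul_smul]
      constructor <;> match_scalars
      · ring
      · linear_combination (1 / 4 : ℂ) * Complex.I_mul_I
    · simp only [Matrix.mul_smul, Matrix.mul_one, Matrix.fromBlocks_smul]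
      simp [smul_smul]
      match_scalars; linear_combination (-1 / 2 : ℂ) * Complex.I_mul_I
    · simp only [Matrix.mul_smul, Matrix.mul_one, Matrix.fromBlocks_smul]
      simp [smul_smul]
      module
    · simp only [Matrix.mul_smul, Matrix.mul_one, Matrix.fromBlocks_smul]
      simp [smul_smul]

/-! ### Polynomial vector fields -/

section VectorFields

open MvPolynomial

variable {n : ℕ}

/-- Polynomial vector fields in `n` variables. -/
abbrev PolyField (n : ℕ) : Type := Derivation ℂ (MvPolynomial (Fin n) ℂ) (MvPolynomial (Fin n) ℂ)

/-- The vector field with constant coefficients `a`. -/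
def constField (n : ℕ) : (Fin n → ℂ) →ₗ[ℂ] PolyField n :=
  (mkDerivationEquiv ℂ).toLinearMap ∘ₗ
    LinearMap.pi fun i => (Algebra.linearMap ℂ (MvPolynomial (Fin n) ℂ)) ∘ₗ LinearMap.proj i

theorem constField_X (a : Fin n → ℂ) (i : Fin n) : constField n a (X i) = C (a i) :=
  mkDerivation_X _ _ _

theorem sum_polyField_apply {κ : Type} (s : Finset κ) (D : κ → PolyField n)
    (f : MvPolynomial (Fin n) ℂ) : (∑ k ∈ s, D k) f = ∑ k ∈ s, D k f := by
  rw [← Derivation.coeFnAddMonoidHom_apply, map_sum, Finset.sum_apply]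
  rfl

/-- A vector field is the sum of its coefficients times the partial derivatives. -/
theorem polyField_apply (D : PolyField n) (f : MvPolynomial (Fin n) ℂ) :
    D f = ∑ j, D (X j) * pderiv j f := by
  have e : D = ∑ j, D (X j) • pderiv j := by
    refine derivation_ext fun i => ?_
    simp [sum_polyField_apply, pderiv_X, Pi.single_apply]
  conv_lhs => rw [e]
  simp [sum_polyField_apply]

theorem constField_apply (a : Fin n → ℂ) (f : MvPolynomial (Fin n) ℂ) :
    constField n a f = ∑ j, a j • pderiv j f := by
  rw [polyField_apply]
  exact Finset.sum_congr rfl fun j _ => by rw [constField_X, C_mul']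

theorem constField_single (j : Fin n) (f : MvPolynomial (Fin n) ℂ) :
    constField n (Pi.single j 1) f = pderiv j f := by
  rw [constField_apply, Finset.sum_eq_single j]
  · simp
  · intro b _ hb; simp [hb]
  · simp

theorem bracket_constField_X (D : PolyField n) (a : Fin n → ℂ) (i : Fin n) :
    ⁅D, constField n a⁆ (X i) = -constField n a (D (X i)) := by
  rw [Derivation.commutator_apply, constField_X, derivation_C, zero_sub]

/-- The vector fields of degree `k - 1` are those with homogeneous coefficients of degree `k`. -/
theorem mem_vectDegree_nat {k : ℕ} {d : ℤ} (hd : d = (k : ℤ) - 1) {D : PolyField n} :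
    (D : vect n) ∈ vectDegree n d ↔ ∀ i, (D (X i)).IsHomogeneous k := by
  subst hd
  have e : ∀ m : Fin n →₀ ℕ, m.degree = Finsupp.weight 1 m :=
    fun m => DFunLike.congr_fun Finsupp.degree_eq_weight_one m
  constructor
  · intro h i m hm
    have := h i m hm
    rw [← e]
    omega
  · intro h i m hm
    have := h i hm
    rw [← e] at this
    omega

theorem coeff_zero_of_mem_vectDegree {d : ℤ} {D : PolyField n} (hD : (D : vect n) ∈ vectDegree n d)
    (i : Fin n) {m : Fin n →₀ ℕ} (hm : (m.degree : ℤ) ≠ d + 1) : (D (X i)).coeff m = 0 :=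
  by_contra fun h => hm (hD i m h)

theorem eq_zero_of_isHomogeneous_zero {f : MvPolynomial (Fin n) ℂ} (hf : f.IsHomogeneous 0)
    (h0 : constantCoeff f = 0) : f = 0 := by
  rw [(totalDegree_eq_zero_iff_eq_C).1 ((totalDegree_zero_iff_isHomogeneous _).2 hf)]
  rw [constantCoeff_eq] at h0
  rw [h0, C_0]

/-- A homogeneous polynomial of positive degree is determined by its derivatives, by Euler's
identity. -/
theorem eq_zero_of_pderiv {k : ℕ} {f : MvPolynomial (Fin n) ℂ} (hf : f.IsHomogeneous (k + 1))
    (h : ∀ j, pderiv j f = 0) : f = 0 := by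
  have e := hf.sum_X_mul_pderiv
  simp only [h, mul_zero, Finset.sum_const_zero] at e
  exact (smul_eq_zero.1 e.symm).resolve_left (Nat.succ_ne_zero k)

/-- The Poincaré lemma for closed one-forms `∑ f_j dx_j` with homogeneous coefficients: a primitive
is `(k + 1)⁻¹ ∑ x_l f_l`, by Euler's identity. -/
theorem exists_pderiv_eq {k : ℕ} (f : Fin n → MvPolynomial (Fin n) ℂ)
    (hf : ∀ j, (f j).IsHomogeneous k) (h : ∀ j l, pderiv l (f j) = pderiv j (f l)) :
    ∃ g : MvPolynomial (Fin n) ℂ, g.IsHomogeneous (k + 1) ∧ ∀ j, pderiv j g = f j := by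
  refine ⟨((k : ℂ) + 1)⁻¹ • ∑ l, X l * f l, ?_, fun j => ?_⟩
  · rw [← C_mul']
    refine IsHomogeneous.C_mul (IsHomogeneous.sum _ _ _ fun l _ => ?_) _
    rw [add_comm]
    exact (isHomogeneous_X _ l).mul (hf l)
  · have hk : (k : ℂ) + 1 ≠ 0 := Nat.cast_add_one_ne_zero k
    rw [Derivation.map_smul, map_sum, inv_smul_eq_iff₀ hk]
    simp only [Derivation.leibniz, smul_eq_mul, Finset.sum_add_distrib]
    have e1 : ∑ l, X l * pderiv j (f l) = k • f j := by
      rw [← (hf j).sum_X_mul_pderiv]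
      exact Finset.sum_congr rfl fun l _ => by rw [h j l]
    rw [e1]
    simp [pderiv_X, Pi.single_apply, add_smul, ← Nat.cast_smul_eq_nsmul ℂ, C_mul']

theorem iSup_vectDegree : ⨆ k : ℕ, vectDegree n ((k : ℤ) - 1) = ⊤ := by
  rw [eq_top_iff]
  rintro (D : PolyField n) -
  let E : ℕ → PolyField n := fun k => mkDerivation ℂ fun i => homogeneousComponent k (D (X i))
  have e : D = ∑ k ∈ Finset.range (∑ i, (D (X i)).totalDegree + 1), E k := by
    refine derivation_ext fun i => ?_
    rw [sum_polyField_apply]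
    simp only [E, mkDerivation_X]
    conv_lhs => rw [← sum_homogeneousComponent (D (X i))]
    refine Finset.sum_subset ?_ fun k _ hk => ?_
    · refine Finset.range_subset_range.2 (Nat.succ_le_succ ?_)
      exact Finset.single_le_sum (f := fun i => (D (X i)).totalDegree) (fun _ _ => Nat.zero_le _)
        (Finset.mem_univ i)
    · refine homogeneousComponent_eq_zero _ _ ?_
      simp only [Finset.mem_range] at hk
      omega
  rw [e]
  refine Submodule.sum_mem (M := vect n) _ (f := E) fun k _ => ?_
  refine Submodule.mem_iSup_of_mem k ((mem_vectDegree_nat rfl).2 fun i => ?_)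
  simp only [E, mkDerivation_X]
  exact homogeneousComponent_isHomogeneous _ _

/-- The constant terms of the coefficients of a vector field. -/
def constPart (n : ℕ) : PolyField n →ₗ[ℂ] (Fin n → ℂ) where
  toFun D i := constantCoeff (D (X i))
  map_add' D E := by ext i; simp
  map_smul' r D := by ext i; simp [smul_eq_C_mul]

/-- The matrix by which the linear part of a vector field acts on fields with constant coefficients;
the sign is that of `[D, ∂_j](x_i) = -∂_j (D x_i)`. -/
def linearPart (n : ℕ) : PolyField n →ₗ[ℂ] Matrix (Fin n) (Fin n) ℂ where
  toFun D := Matrix.of fun i j => -constantCoeff (pderiv j (D (X i)))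
  map_add' D E := by ext i; simp [add_comm]
  map_smul' r D := by ext i; simp [smul_eq_C_mul]

theorem constPart_apply (D : PolyField n) (i : Fin n) :
    constPart n D i = constantCoeff (D (X i)) := rfl

theorem linearPart_apply (D : PolyField n) (i j : Fin n) :
    linearPart n D i j = -constantCoeff (pderiv j (D (X i))) := rfl

theorem constPart_bracket (D : PolyField n) (a : Fin n → ℂ) :
    constPart n ⁅D, constField n a⁆ = linearPart n D *ᵥ a := by
  funext i
  rw [constPart_apply, bracket_constField_X, constField_apply, map_neg, map_sum, Matrix.mulVec,
    dotProduct, ← Finset.sum_neg_distrib]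
  refine Finset.sum_congr rfl fun j _ => ?_
  rw [linearPart_apply, smul_eq_C_mul, map_mul, constantCoeff_C]
  ring

theorem constPart_bracket_eq_zero {D E : PolyField n} (hD : constPart n D = 0)
    (hE : constPart n E = 0) : constPart n ⁅D, E⁆ = 0 := by
  have hD' : ∀ i, constantCoeff (D (X i)) = 0 := congrFun hD
  have hE' : ∀ i, constantCoeff (E (X i)) = 0 := congrFun hE
  funext i
  rw [constPart_apply, Derivation.commutator_apply, polyField_apply D (E _),
    polyField_apply E (D _)]
  simp [hD', hE']

theorem linearPart_bracket {D E : PolyField n} (hD : constPart n D = 0)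
    (hE : constPart n E = 0) :
    linearPart n ⁅D, E⁆ = linearPart n D * linearPart n E - linearPart n E * linearPart n D := by
  have hD' : ∀ i, constantCoeff (D (X i)) = 0 := congrFun hD
  have hE' : ∀ i, constantCoeff (E (X i)) = 0 := congrFun hE
  ext i k
  rw [linearPart_apply, Derivation.commutator_apply, polyField_apply D (E _),
    polyField_apply E (D _)]
  simp only [map_sub, map_sum, Derivation.leibniz, smul_eq_mul, map_add, map_mul, hD', hE',
    zero_mul, zero_add, Matrix.sub_apply, Matrix.mul_apply, linearPart_apply, neg_mul_neg, neg_sub]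

variable {L : LieSuperalgebra} {V : SuperSpace} {ρ : SuperModule L V}

/-- If `L` acts on a purely even `V ≅ ℂⁿ` by all matrices, then `V` and `L` are the constant and the
linear vector fields. -/
def vectLocalPart (hL : ∀ A, L.par A = A) (hV : ∀ v, V.par v = v) (c : V ≃ₗ[ℂ] (Fin n → ℂ))
    (m : L ≃ₗ[ℂ] Matrix (Fin n) (Fin n) ℂ) (hm : ∀ A v, c (ρ.act A v) = m A *ᵥ c v) :
    LocalPart (vect n) (vectDegree n) ρ where
  inc := constField n ∘ₗ c.toLinearMap
  projV := c.symm.toLinearMap ∘ₗ constPart n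
  projL := m.symm.toLinearMap ∘ₗ linearPart n
  inc_par := fun v => congrArg (fun w => constField n (c w)) (hV v)
  projV_par := fun x => (hV _).symm
  projL_par := fun x => (hL _).symm
  inc_comm := fun v w => by
    refine (derivation_ext fun i => ?_ : ⁅constField n (c v), constField n (c w)⁆ = 0)
    rw [bracket_constField_X, constField_X, derivation_C, neg_zero]
    rfl
  projV_inc := fun v => by
    refine (LinearEquiv.symm_apply_eq c).2 (funext fun i => ?_)
    exact (congrArg constantCoeff (constField_X _ _)).trans (constantCoeff_C _ _)
  projL_inc := fun v => by
    refine (LinearEquiv.symm_apply_eq m).2 ?_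
    rw [map_zero]
    ext i j
    refine (linearPart_apply (constField n (c v)) i j).trans ?_
    rw [constField_X, derivation_C, map_zero, neg_zero, Matrix.zero_apply]
  projV_bracket_inc := fun D v => by
    refine (LinearEquiv.symm_apply_eq c).2 ?_
    rw [hm]
    refine (constPart_bracket D (c v)).trans ?_
    exact congrArg (· *ᵥ c v) (m.apply_symm_apply _).symm
  projV_bracket := fun D E hD hE => by
    have hD' : constPart n D = 0 := (LinearEquiv.map_eq_zero_iff c.symm).1 hD
    have hE' : constPart n E = 0 := (LinearEquiv.map_eq_zero_iff c.symm).1 hE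
    exact (LinearEquiv.map_eq_zero_iff c.symm).2 (constPart_bracket_eq_zero hD' hE')
  projL_bracket := fun D E hD hE => by
    have hD' : constPart n D = 0 := (LinearEquiv.map_eq_zero_iff c.symm).1 hD
    have hE' : constPart n E = 0 := (LinearEquiv.map_eq_zero_iff c.symm).1 hE
    have hb : ∀ A B : L, m (L.bracket A B) = m A * m B - m B * m A := by
      intro A B
      refine Matrix.ext_of_mulVec_single fun i => ?_
      obtain ⟨v, hv⟩ := c.surjective (Pi.single i 1)
      have hom : ∀ A : L, L.Homog 0 A := fun A => (hL A).trans (by rw [sgn_zero, one_smul])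
      rw [← hv, ← hm, ρ.act_bracket 0 0 A B v (hom A) (hom B), mul_zero, sgn_zero, one_smul,
        map_sub, hm, hm, hm, hm, Matrix.sub_mulVec, Matrix.mulVec_mulVec, Matrix.mulVec_mulVec]
    refine (LinearEquiv.symm_apply_eq m).2 ?_
    rw [hb]
    refine (linearPart_bracket hD' hE').trans ?_
    change _ = m (m.symm (linearPart n D)) * m (m.symm (linearPart n E)) -
      m (m.symm (linearPart n E)) * m (m.symm (linearPart n D))
    rw [m.apply_symm_apply, m.apply_symm_apply]
  inc_mem := fun v => (mem_vectDegree_nat (k := 0) (by simp)).2 fun i => by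
    refine (congrArg (IsHomogeneous · 0) (constField_X (c v) i)).mpr (isHomogeneous_C _ _)
  bracket_inc_mem := fun d (D : PolyField n) v hD i k hk => by
    have hk' : coeff k (⁅D, constField n (c v)⁆ (X i)) ≠ 0 := hk
    rw [bracket_constField_X, constField_apply, coeff_neg, coeff_sum, neg_ne_zero] at hk'
    obtain ⟨j, -, hj⟩ := Finset.exists_ne_zero_of_sum_ne_zero hk'
    rw [coeff_smul, coeff_pderiv] at hj
    have h := hD i (k + Finsupp.single j 1) fun h0 => hj (by rw [h0]; simp)
    rw [map_add, Finsupp.degree_single] at h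
    push_cast at h
    omega
  projV_eq_zero := fun d D hD hd => by
    refine (LinearEquiv.map_eq_zero_iff c.symm).2 (funext fun i => ?_)
    exact coeff_zero_of_mem_vectDegree hD i (by rw [map_zero]; push_cast; omega)
  projL_eq_zero := fun d D hD hd => by
    refine (LinearEquiv.map_eq_zero_iff m.symm).2 (Matrix.ext fun i j => ?_)
    refine (linearPart_apply D i j).trans ?_
    rw [constantCoeff_eq, coeff_pderiv, zero_add, coeff_zero_of_mem_vectDegree hD i]
    · simp
    · rw [Finsupp.degree_single]; push_cast; omega
  iSup_eq_top := iSup_vectDegree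
  eq_zero_of_projV := fun D hD h => by
    have h' : constPart n D = 0 := (LinearEquiv.map_eq_zero_iff c.symm).1 h
    refine derivation_ext fun i => ?_
    exact eq_zero_of_isHomogeneous_zero ((mem_vectDegree_nat (k := 0) (by simp)).1 hD i)
      (congrFun h' i)
  eq_zero_of_projL := fun D hD h => by
    have h' : linearPart n D = 0 := (LinearEquiv.map_eq_zero_iff m.symm).1 h
    refine derivation_ext fun i => ?_
    have hi := (mem_vectDegree_nat (k := 1) (by simp)).1 hD i
    refine eq_zero_of_pderiv (k := 0) hi fun j => ?_
    refine eq_zero_of_isHomogeneous_zero hi.pderiv ?_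
    exact neg_eq_zero.1 (congrFun (congrFun h' i) j)
  transitive := fun k (D : PolyField n) hD h => by
    refine derivation_ext fun i => ?_
    have hi := (mem_vectDegree_nat (k := k + 2) (by push_cast; ring)).1 hD i
    refine eq_zero_of_pderiv (k := k + 1) hi fun j => ?_
    have h1 : ⁅D, constField n (c (c.symm (Pi.single j 1)))⁆ = 0 :=
      h (c.symm (Pi.single j 1))
    rw [c.apply_symm_apply] at h1
    have h2 := congrArg (fun E : PolyField n => E (X i)) h1
    simp only [bracket_constField_X, constField_single] at h2
    exact neg_eq_zero.1 h2
  projL_surj := fun A => by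
    let D : PolyField n := mkDerivation ℂ fun i => -∑ j, m A i j • X j
    refine ⟨D, (mem_vectDegree_nat (k := 1) (by simp)).2 fun i => ?_, ?_⟩
    · simp only [D, mkDerivation_X]
      refine (IsHomogeneous.sum _ _ _ fun j _ => ?_).neg
      rw [smul_eq_C_mul]
      exact isHomogeneous_C_mul_X _ _
    · refine (LinearEquiv.symm_apply_eq m).2 (Matrix.ext fun i k => ?_)
      refine (linearPart_apply D i k).trans ?_
      simp [D, mkDerivation_X, pderiv_X, Pi.single_apply, smul_eq_C_mul]

/-- The prolong of the full matrix algebra consists of all polynomial vector fields. An element `Y`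
of degree `k + 1` of the prolong gives fields `D_j = Y(e_j)` of degree `k`; its symmetry says that
`∂_l (D_j x_i) = ∂_j (D_l x_i)`, and the Poincaré lemma provides a field `E` with `[E, ∂_j] = D_j`.
-/
theorem isCartanProlong_vect (hL : ∀ A, L.par A = A) (hV : ∀ v, V.par v = v)
    (c : V ≃ₗ[ℂ] (Fin n → ℂ)) (m : L ≃ₗ[ℂ] Matrix (Fin n) (Fin n) ℂ)
    (hm : ∀ A v, c (ρ.act A v) = m A *ᵥ c v) :
    IsCartanProlong (vect n) (vectDegree n) ρ := by
  set P := vectLocalPart hL hV c m hm with hP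
  have hom : ∀ v : V, V.Homog 0 v := fun v => (hV v).trans (by rw [sgn_zero, one_smul])
  have br : ∀ (D : PolyField n) (j : Fin n), (vect n).bracket D (P.inc (c.symm (Pi.single j 1))) =
      ⁅D, constField n (Pi.single j 1)⁆ := fun D j =>
    congrArg (fun a => ⁅D, constField n a⁆) (c.apply_symm_apply _)
  have surj : ∀ k : ℕ, ∀ X ∈ component ρ (k + 1),
      ∃ D ∈ vectDegree n k, P.toLevel (k + 1) D = X := by
    intro k
    induction k with
    | zero => intro X _; exact P.projL_surj X
    | succ k ih =>
      intro Y hY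
      let Y' : V →ₗ[ℂ] level ρ (k + 1) := Y
      have hex : ∀ j, ∃ D : PolyField n, (D : vect n) ∈ vectDegree n k ∧
          P.toLevel (k + 1) D = Y' (c.symm (Pi.single j 1)) :=
        fun j => ih _ (hY.1 (c.symm (Pi.single j 1)))
      choose D hD hDY using hex
      have hD' : ∀ j i, (D j (X i)).IsHomogeneous (k + 1) := fun j =>
        (mem_vectDegree_nat (by push_cast; ring)).1 (hD j)
      have hsymm : ∀ i j l, pderiv l (D j (X i)) =
          pderiv j (D l (X i)) := by
        intro i j l
        have h := hY.2 0 0 (c.symm (Pi.single j 1)) (c.symm (Pi.single l 1)) (hom _) (hom _)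
        rw [mul_zero, sgn_zero, one_smul] at h
        have e : P.toLevel k ((vect n).bracket (D j) (P.inc (c.symm (Pi.single l 1)))) =
            P.toLevel k ((vect n).bracket (D l) (P.inc (c.symm (Pi.single j 1)))) :=
          (P.ev_toLevel k (D j) _).symm.trans <| (congrArg (fun Z => ev ρ k Z _) (hDY j)).trans <|
            h.trans <| (congrArg (fun Z => ev ρ k Z _) (hDY l)).symm.trans <|
              P.ev_toLevel k (D l) _
        have h' := P.eq_zero_of_toLevel k ((vect n).bracket (D j) (P.inc (c.symm (Pi.single l 1))) -
          (vect n).bracket (D l) (P.inc (c.symm (Pi.single j 1))))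
          ((vectDegree n _).sub_mem (P.bracket_inc_mem _ _ _ (hD j))
            (P.bracket_inc_mem _ _ _ (hD l))) (by rw [map_sub, e, sub_self])
        have h2 := (br (D j) l).symm.trans ((sub_eq_zero.1 h').trans (br (D l) j))
        have h3 := congrArg (fun E : PolyField n => E (X i)) h2
        simp only [bracket_constField_X, constField_single] at h3
        exact neg_injective h3
      choose g hg hgD using fun i => exists_pderiv_eq (fun j => D j (X i))
        (fun j => hD' j i) (hsymm i)
      let E : PolyField n := mkDerivation ℂ fun i => -g i
      refine ⟨E, (mem_vectDegree_nat (k := k + 2) (by push_cast; ring)).2 fun i => ?_, ?_⟩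
      · simp only [E, mkDerivation_X]
        exact (hg i).neg
      · let Z : V →ₗ[ℂ] level ρ (k + 1) := P.toLevel (k + 2) E
        have hb : ∀ j, Z (c.symm (Pi.single j 1)) = Y' (c.symm (Pi.single j 1)) := by
          intro j
          rw [← hDY]
          refine congrArg (P.toLevel (k + 1)) ((br E j).trans ?_)
          refine derivation_ext fun i => ?_
          rw [bracket_constField_X, constField_single]
          simp only [E, mkDerivation_X, map_neg, neg_neg]
          exact hgD i j
        have hc : Z ∘ₗ c.symm.toLinearMap = Y' ∘ₗ c.symm.toLinearMap :=
          LinearMap.pi_ext' fun j => LinearMap.ext_ring (hb j)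
        refine (LinearMap.ext fun v => ?_ : Z = Y')
        have := LinearMap.congr_fun hc (c v)
        simpa using this
  refine P.isCartanProlong fun k Y hY => ?_
  obtain ⟨D, hD, h⟩ := surj (k + 1) Y hY
  exact ⟨D, by exact_mod_cast hD, h⟩

end VectorFields

/-! ### The exterior square of `ℂ³` -/

section ExteriorSquare

theorem glParity_zero_right (r : ℕ) (i : Fin r ⊕ Fin 0) : glParity r 0 i = 0 := by
  rcases i with i | i
  · rfl
  · exact i.elim0

theorem glWedge_apply_swap {r : ℕ} (t : wedgeSquare (glParity r 0)) (i j : Fin r ⊕ Fin 0) :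
    (t.1 : Matrix _ _ ℂ) i j = -(t.1 : Matrix _ _ ℂ) j i := by
  have h : (t.1 : Matrix _ _ ℂ) i j =
    -(sgn (glParity r 0 i * glParity r 0 j) * (t.1 : Matrix _ _ ℂ) j i) := t.2 i j
  rw [h, glParity_zero_right, zero_mul, sgn_zero, one_mul]

/-- The identification of `Λ²(ℂ³)` with `ℂ³` that sends `e_{i+1} ∧ e_{i+2}` to `e_i`, the indices
being taken modulo `3`. -/
def wedgeThree : wedgeSquare (glParity 3 0) ≃ₗ[ℂ] (Fin 3 → ℂ) where
  toFun t i := (t.1 : Matrix _ _ ℂ) (.inl (i + 1)) (.inl (i + 2))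
  map_add' s t := rfl
  map_smul' a t := rfl
  invFun v := ⟨Matrix.of fun i j => Sum.elim (fun i => Sum.elim
      (fun j => !![0, v 2, -v 1; -v 2, 0, v 0; v 1, -v 0, 0] i j) Fin.elim0 j) Fin.elim0 i, by
    have e : ∀ i j : Fin 3, !![0, v 2, -v 1; -v 2, 0, v 0; v 1, -v 0, 0] i j =
        -(sgn (0 * 0) * !![0, v 2, -v 1; -v 2, 0, v 0; v 1, -v 0, 0] j i) := by
      intro i j
      rw [mul_zero, sgn_zero, one_mul]
      fin_cases i <;> fin_cases j <;> simp
    rintro (i | i) (j | j)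
    · exact e i j
    all_goals first | exact i.elim0 | exact j.elim0⟩
  left_inv t := by
    have s := glWedge_apply_swap t
    have d : ∀ i, (t.1 : Matrix _ _ ℂ) i i = 0 := fun i => self_eq_neg.1 (s i i)
    refine Subtype.ext (Matrix.ext ?_)
    rintro (i | i) (j | j)
    · fin_cases i <;> fin_cases j
      · exact (d _).symm
      · rfl
      · exact (s _ _).symm
      · exact (s _ _).symm
      · exact (d _).symm
      · rfl
      · rfl
      · exact (s _ _).symm
      · exact (d _).symm
    all_goals first | exact i.elim0 | exact j.elim0
  right_inv v := by
    funext i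
    fin_cases i <;> rfl

/-- Under the identification of `Λ²(ℂ³)` with `ℂ³`, a matrix `A` acts as `tr(A) - Aᵀ`; every matrix
arises in this way exactly once. -/
def wedgeThreeAction :
    Matrix (Fin 3 ⊕ Fin 0) (Fin 3 ⊕ Fin 0) ℂ ≃ₗ[ℂ] Matrix (Fin 3) (Fin 3) ℂ where
  toFun A := A.trace • 1 - (A.submatrix Sum.inl Sum.inl)ᵀ
  map_add' A B := by ext i j; simp [add_mul]; ring
  map_smul' a A := by ext i j; simp [mul_sub, mul_assoc]
  invFun M := ((1 / 2 : ℂ) • M.trace • 1 - Mᵀ).submatrix (Equiv.sumEmpty _ _) (Equiv.sumEmpty _ _)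
  left_inv A := by
    ext (i | i) (j | j)
    · have h0 : ∀ x : Fin 0, False := fun x => x.elim0
      simp [Matrix.trace, Fin.sum_univ_three]
      fin_cases i <;> fin_cases j <;> simp <;> ring
    all_goals first | exact i.elim0 | exact j.elim0
  right_inv M := by
    ext i j
    simp [Matrix.trace, Fin.sum_univ_three]
    fin_cases i <;> fin_cases j <;> simp <;> ring

theorem isCartanProlong_vect_three : IsCartanProlong (vect 3) (vectDegree 3) (glWedge 3 0) := by
  refine isCartanProlong_vect (L := gl (glParity 3 0)) (V := wedgeSpace 3 0) ?_ ?_ wedgeThree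
    wedgeThreeAction ?_
  · intro A
    refine Matrix.ext fun i j => ?_
    change sgn (glParity 3 0 i + glParity 3 0 j) * _ = _
    rw [glParity_zero_right, glParity_zero_right, add_zero, sgn_zero, one_mul]
  · intro t
    refine Subtype.ext (Matrix.ext fun i j => ?_)
    change sgn (glParity 3 0 i + glParity 3 0 j) * _ = _
    rw [glParity_zero_right, glParity_zero_right, add_zero, sgn_zero, one_mul]
    rfl
  · intro (A : Matrix _ _ ℂ) t
    let u : Matrix _ _ ℂ := t.1
    have s : ∀ i j, u i j = - u j i := glWedge_apply_swap t
    funext i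
    change ∑ k, (A (.inl (i + 1)) k * u k (.inl (i + 2)) +
      sgn ((glParity 3 0 (.inl (i + 2)) + glParity 3 0 k) * glParity 3 0 (.inl (i + 1))) *
        (A (.inl (i + 2)) k * u (.inl (i + 1)) k)) =
      ∑ j, (A.trace • 1 - (A.submatrix Sum.inl Sum.inl)ᵀ : Matrix (Fin 3) (Fin 3) ℂ) i j *
        u (.inl (j + 1)) (.inl (j + 2))
    have d : ∀ i, u i i = 0 := fun i => self_eq_neg.1 (s i i)
    simp only [glParity_zero_right, mul_zero, sgn_zero, one_mul, Fintype.sum_sum_type,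
      Fin.sum_univ_three, Finset.univ_eq_empty, Finset.sum_empty, add_zero, Matrix.sub_apply,
      Matrix.smul_apply, smul_eq_mul, Matrix.transpose_apply, Matrix.submatrix_apply, Matrix.trace,
      Matrix.diag_apply, Matrix.one_apply]
    fin_cases i <;> simp [d]
    · linear_combination A (.inl 1) (.inl 0) * s (.inl 0) (.inl 2) +
        A (.inl 2) (.inl 0) * s (.inl 1) (.inl 0)
    · linear_combination A (.inl 2) (.inl 1) * s (.inl 1) (.inl 0) +
        A (.inl 0) (.inl 1) * s (.inl 2) (.inl 1)
    · linear_combination A (.inl 0) (.inl 2) * s (.inl 2) (.inl 1) +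
        A (.inl 1) (.inl 2) * s (.inl 0) (.inl 2)

end ExteriorSquare

end SuperLie

end

theorem mainTheorem9 :
    -- case a): `osp(p+2|2n)` with `g_0 = cosp(p|2n)` and `g_{-1} = id`
    (∀ p n : ℕ, (n = 0 → 3 ≤ p) →
      SuperLie.IsCartanProlong (SuperLie.osp (Fin 2 ⊕ Fin p) (Fin n))
        (SuperLie.ospDegree (SuperLie.quadricElement p n)) (SuperLie.cospId (Fin p) (Fin n))) ∧
    -- case b): `osp(2r|2n)` with `g_0 = gl(r|n)` and `g_{-1} = Λ²(id)`
    (∀ r n : ℕ, 2 ≤ r + n → (r, n) ≠ (3, 0) → (r, n) ≠ (2, 0) → (r, n) ≠ (1, 1) →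
      SuperLie.IsCartanProlong (SuperLie.osp (Fin r ⊕ Fin r) (Fin n))
        (SuperLie.ospDegree (SuperLie.lagrangianElement r n)) (SuperLie.glWedge r n)) ∧
    -- the exceptional case `g_0 = gl(3|0)`
    SuperLie.IsCartanProlong (SuperLie.vect 3) (SuperLie.vectDegree 3) (SuperLie.glWedge 3 0) ∧
    -- `ĝ_0 = osp(p|2n)` in case a), and `ĝ_0 = sl(r|n)` in case b)
    (∀ p n : ℕ, SuperLie.IsTrivialProlong (SuperLie.ospId (Fin p) (Fin n))) ∧
    (∀ r n : ℕ, (r, n) ≠ (3, 0) → (r, n) ≠ (2, 0) → (r, n) ≠ (1, 1) →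
      SuperLie.IsTrivialProlong (SuperLie.slWedge r n)) := by
  exact ⟨SuperLie.isCartanProlong_osp_quadric,
    fun _ _ h h3 h2 h1 => SuperLie.isCartanProlong_osp_lagrangian h h3 h2 h1,
    SuperLie.isCartanProlong_vect_three, SuperLie.isTrivialProlong_ospId,
    fun _ _ h3 h2 h1 => SuperLie.isTrivialProlong_slWedge h3 h2 h1⟩
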